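/- Let $n\ge 1$ and let $\Omega\subseteq\mathbb R^n$ be a bounded open set of class $C^{1,1}$, with outer unit normal $\nu$ and surface measure $\sigma$ on $\partial\Omega$. Let $(a_{lj})_{l,j=1}^n$ be a symmetric real matrix with $$\inf_{\xi\in\mathbb R^n,\ |\xi|=1}\ \sum_{l,j=1}^n a_{lj}\xi_l\xi_j>0,$$ let $a_1,\dots,a_n,a\in\mathbb C$, and let $\mathbf a$ denote the collection of these coefficients. Let $S_{\mathbf a}$ be a fundamental solution of the operator $$P[\mathbf a,D]u=\sum_{l,j=1}^n\partial_{x_l}(a_{lj}\partial_{x_j}u)+\sum_{l=1}^n a_l\,\partial_{x_l}u+a\,u ,$$ that is, a locally integrable function on $\mathbb R^n$, continuous on $\mathbb R^n\setminus\{0\}$, with $P[\mathbf a,D]S_{\mathbf a}=\delta_0$ in the sense of distributions. For $x\in\partial\Omega$ put $$W_\Omega[\mathbf a,S_{\mathbf a},1](x)=-\int_{\partial\Omega\setminus\{x\}}\Big(\sum_{l,j=1}^n a_{jl}\,\nu_l(y)\,\frac{\partial S_{\mathbf a}}{\partial x_j}(x-y)+\sum_{l=1}^n\nu_l(y)\,a_l\,S_{\mathbf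 a}(x-y)\Big)\,d\sigma_y ,$$ the double layer potential with density $1$ (if $n\ge2$ the omitted point has measure zero). Then, for every $x\in\partial\Omega$, this integral converges absolutely, and $$W_\Omega[\mathbf a,S_{\mathbf a},1]\in C^{1,\omega_1(\cdot)}(\partial\Omega),$$ where $\omega_1(0)=0$, $\omega_1(r)=r|\ln r|$ for $0<r\le e^{-1}$ and $\omega_1(r)=e^{-1}$ for $r>e^{-1}$. Here $C^{1,\omega_1(\cdot)}(\partial\Omega)$ is the space of functions $f:\partial\Omega\to\mathbb C$ that are continuously differentiable and whose first order derivatives $g$ satisfy $\sup_{\xi\ne\eta}|g(\xi)-g(\eta)|/\omega_1(|\xi-\eta|)<\infty$ in every local parametrization of $\partial\Omega$ as the graph of a function of class $C^{1,1}$ on a closed ball of $\mathbb R^{n-1}$ (in a coordinate cylinder for $\Omega$, after a rigid motion). -/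

import Mathlib

open scoped ContDiff MeasureTheory

noncomputable section

namespace DoubleLayer

/-- The Euclidean space `ℝⁿ`. -/
abbrev E (n : ℕ) : Type := EuclideanSpace ℝ (Fin n)

/-- The partial derivative `∂u/∂x_j` of a complex valued function on `ℝⁿ`. -/
def pd {n : ℕ} (j : Fin n) (u : E n → ℂ) (x : E n) : ℂ :=
  fderiv ℝ u x (EuclideanSpace.single j (1 : ℝ))

/-! ### The differential operator and its fundamental solutions -/

/-- The coefficients `(a_γ)_{|γ| ≤ 2}` of a second order operator, arranged as the symmetric matrix
`a⁽²⁾ = (a_{lj})` with `a_{jj} = a_{2e_j}` and `a_{lj} = a_{e_l+e_j}/2` for `l ≠ j`, the vector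
`a⁽¹⁾ = (a_{e_j})` and the scalar `a = a_0`. -/
structure Coeffs (n : ℕ) where
  a2 : Matrix (Fin n) (Fin n) ℂ
  symm : a2.IsSymm
  a1 : Fin n → ℂ
  a0 : ℂ

/-- `P[𝐚,D]u = ∑_{l,j} ∂_l (a_{lj} ∂_j u) + ∑_l a_l ∂_l u + a u`. -/
def Coeffs.op {n : ℕ} (a : Coeffs n) (u : E n → ℂ) (x : E n) : ℂ :=
  (∑ l, ∑ j, pd l (fun z => a.a2 l j * pd j u z) x) + (∑ l, a.a1 l * pd l u x) + a.a0 * u x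

/-- The coefficients of the formal transpose of `P[𝐚,D]`, for which
`∫ (P[𝐚,D]u) φ = ∫ u (P[𝐚,D]ᵗφ)` when `φ` is a test function. -/
def Coeffs.transpose {n : ℕ} (a : Coeffs n) : Coeffs n where
  a2 := a.a2
  symm := a.symm
  a1 := fun l => -a.a1 l
  a0 := a.a0

/-- Ellipticity: `inf_{|ξ|=1} Re ∑_{|γ|=2} a_γ ξ^γ > 0`,
where `∑_{|γ|=2} a_γ ξ^γ = ∑_{l,j} a_{lj} ξ_l ξ_j`. -/
def Coeffs.IsElliptic {n : ℕ} (a : Coeffs n) : Prop :=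
  ∃ c : ℝ, 0 < c ∧ ∀ ξ : E n, ‖ξ‖ = 1 → c ≤ (∑ l, ∑ j, a.a2 l j * (ξ l : ℂ) * (ξ j : ℂ)).re

/-- The second order coefficients `a_{lj}` are real. -/
def Coeffs.HasRealPrincipalPart {n : ℕ} (a : Coeffs n) : Prop :=
  ∀ l j, (a.a2 l j).im = 0

/-- `S` is a fundamental solution of `P[𝐚,D]`: it is a locally integrable function with
`P[𝐚,D]S = δ₀` in the sense of distributions. As its pointwise values on hypersurfaces matter, `S`
is taken to be the representative that is continuous off the origin; the value `S 0` is arbitrary.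
-/
structure IsFundamentalSolution {n : ℕ} (a : Coeffs n) (S : E n → ℂ) : Prop where
  locallyIntegrable : MeasureTheory.LocallyIntegrable S MeasureTheory.volume
  continuousOn : ContinuousOn S {0}ᶜ
  integral_eq : ∀ φ : E n → ℂ, ContDiff ℝ ∞ φ → HasCompactSupport φ →
    ∫ x, S x * a.transpose.op φ x = φ 0

/-! ### Domains of class `C^{1,1}`, outer normal, surface measure -/

/-- A coordinate cylinder for `Ω` around `p`: after the rigid motion `x ↦ R (x - p)`, the set `Ω`
coincides in the cylinder `𝔹_{n-1}(0,r) × ]-δ,δ[` with the strict hypograph of `γ`. -/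
structure CoordCylinder {n : ℕ} (Ω : Set (E n)) (p : E n) where
  R : E n ≃ₗᵢ[ℝ] WithLp 2 (E (n - 1) × ℝ)
  r : ℝ
  r_pos : 0 < r
  δ : ℝ
  δ_pos : 0 < δ
  γ : E (n - 1) → ℝ
  γ_zero : γ 0 = 0
  abs_γ_lt : ∀ η ∈ Metric.ball (0 : E (n - 1)) r, |γ η| < δ / 2
  mem_iff : ∀ η ∈ Metric.ball (0 : E (n - 1)) r, ∀ t ∈ Set.Ioo (-δ) δ,
    p + R.symm (WithLp.toLp 2 (η, t)) ∈ Ω ↔ t < γ η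

/-- The local parametrization `η ↦ p + Rᵗ(η, γ(η))` of `∂Ω`, for `η ∈ 𝔹_{n-1}(0,r)`. -/
def CoordCylinder.param {n : ℕ} {Ω : Set (E n)} {p : E n} (c : CoordCylinder Ω p)
    (η : E (n - 1)) : E n :=
  p + c.R.symm (WithLp.toLp 2 (η, c.γ η))

/-- The function `γ` of the cylinder is of class `C^{1,1}` on the closed ball of radius `r`; as the
ball is convex, this means that `γ` is differentiable in the open ball with Lipschitz gradient. -/
def CoordCylinder.IsC11 {n : ℕ} {Ω : Set (E n)} {p : E n} (c : CoordCylinder Ω p) : Prop :=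
  DifferentiableOn ℝ c.γ (Metric.ball 0 c.r) ∧
    ∃ K : NNReal, LipschitzOnWith K (fderiv ℝ c.γ) (Metric.ball 0 c.r)

/-- The open set `Ω` is of class `C^{1,1}`. -/
def IsC11Domain {n : ℕ} (Ω : Set (E n)) : Prop :=
  ∀ p ∈ frontier Ω, ∃ c : CoordCylinder Ω p, c.IsC11

/-- `v` is the outer unit normal to `∂Ω` at `x`: `v` is a unit vector and the rays from `x` in a
direction `w` with `w ⬝ v < 0` enter `Ω`, those with `w ⬝ v > 0` enter the exterior of `Ω`.
There is at most one such `v`, and for a set of class `C¹` there is one, namely the vector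
`Rᵗ(-∇γ(0), 1) / √(1 + |∇γ(0)|²)` of any coordinate cylinder around `x`. -/
def IsOuterUnitNormal {n : ℕ} (Ω : Set (E n)) (x v : E n) : Prop :=
  ‖v‖ = 1 ∧
    (∀ w : E n, inner ℝ w v < 0 → ∀ᶠ t : ℝ in nhdsWithin 0 (Set.Ioi 0), x + t • w ∈ Ω) ∧
    (∀ w : E n, 0 < inner ℝ w v → ∀ᶠ t : ℝ in nhdsWithin 0 (Set.Ioi 0), x + t • w ∉ closure Ω)

open Classical in
/-- The outer unit normal field `ν_Ω` on `∂Ω` (with value `0` where there is no normal). -/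
def outerNormal {n : ℕ} (Ω : Set (E n)) (x : E n) : E n :=
  if h : ∃ v, IsOuterUnitNormal Ω x v then h.choose else 0

/-- The surface measure `σ`: the `(n-1)`-dimensional Hausdorff measure, normalized to agree with
Lebesgue measure on hyperplanes. -/
def surfaceMeasure (n : ℕ) : MeasureTheory.Measure (E n) :=
  MeasureTheory.Measure.euclideanHausdorffMeasure (n - 1)

/-! ### The double layer potential -/

/-- The kernel of the double layer potential,
`-∑_{l,j} a_{jl} ν_l(y) (∂S/∂x_j)(x-y) - ∑_l ν_l(y) a_l S(x-y)`, for `x, y ∈ ∂Ω`, `x ≠ y`. -/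
def kernel {n : ℕ} (Ω : Set (E n)) (a : Coeffs n) (S : E n → ℂ) (x y : E n) : ℂ :=
  -(∑ l, ∑ j, a.a2 j l * (outerNormal Ω y l : ℂ) * pd j S (x - y))
    - ∑ l, (outerNormal Ω y l : ℂ) * a.a1 l * S (x - y)

/-- The double layer potential `W_Ω[𝐚,S,μ](x)`, for `x ∈ ∂Ω`. The kernel is only defined for
`y ≠ x`; the omitted point has measure zero if `n ≥ 2`. -/
def doubleLayer {n : ℕ} (Ω : Set (E n)) (a : Coeffs n) (S : E n → ℂ) (μ : E n → ℂ) (x : E n) : ℂ :=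
  ∫ y in frontier Ω \ {x}, μ y * kernel Ω a S x y ∂(surfaceMeasure n)

/-! ### Generalized Schauder spaces -/

/-- The function `ω_θ` on `[0,+∞[`. -/
def omega (θ r : ℝ) : ℝ :=
  if r = 0 then 0
  else if r ≤ Real.exp (-1 / θ) then r ^ θ * |Real.log r|
  else Real.exp (-1 / θ) ^ θ * |Real.log (Real.exp (-1 / θ))|

/-- `g` is `om`-Hölder continuous on `D`. -/
def IsOmegaHolderOn {X Y : Type*} [PseudoMetricSpace X] [SeminormedAddCommGroup Y]
    (om : ℝ → ℝ) (g : X → Y) (D : Set X) : Prop :=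
  ∃ C : ℝ, ∀ x ∈ D, ∀ y ∈ D, ‖g x - g y‖ ≤ C * om (dist x y)

/-- `f` is of class `C^{1,om}(∂Ω)`, for `Ω` of class `C^{1,1}`: in every local parametrization of
`∂Ω` given by a coordinate cylinder of class `C^{1,1}`, `f` is continuously differentiable and its
first order derivatives are `om`-Hölder continuous. Only the values of `f` on `∂Ω` matter. -/
def IsC1OmegaOnBoundary {n : ℕ} (om : ℝ → ℝ) (Ω : Set (E n)) (f : E n → ℂ) : Prop :=
  ∀ p ∈ frontier Ω, ∀ c : CoordCylinder Ω p, c.IsC11 →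
    ContDiffOn ℝ 1 (fun η => f (c.param η)) (Metric.ball 0 c.r) ∧
      IsOmegaHolderOn om (fderiv ℝ (fun η => f (c.param η))) (Metric.ball 0 c.r)

end DoubleLayer

end

open scoped ContDiff MeasureTheory

noncomputable section

namespace DoubleLayer

open MeasureTheory Set Filter Topology

/-! ### The area formula for graphs -/

/-! The double layer potential with density one is rewritten as volume potentials over `Ω`, whose
gradients are then estimated. The device is the heat kernel `K_t` of the full operator. Since the
coefficients are constant and the principal part `A` is real and positive definite, `K_t` is
explicit: with `B = A⁻¹` it is a Gaussian in `Bx·x` times an exponential that absorbs the lower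
order terms, and `∂_t K = P K` (`op_K`).

With `par = -∫₀¹ K_t dt` one gets `P par = δ₀ - K_1`, so any fundamental solution is `S = par + w`
off the origin with `w` smooth (`exists_contDiff_eq_par_add`). The kernel of the potential is minus
the conormal flux of `S(x - y)`. For each `t > 0` the kernel `K_t` is smooth, and the divergence
theorem turns its boundary flux into `-d/dt ∫_Ω K_t(x - y) dy + a₀ ∫_Ω K_t(x - y) dy`. Integrating
over `0 < t ≤ 1`, the first term telescopes; its limit at `t = 0` is `1/2`, because `Ω` blows up to
a half space at a boundary point and the limit profile is even. Hence (`doubleLayer_one_eq`)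
`W[1](x) = 1/2 - ∫_Ω K_1(x - y) dy + a₀ ∫₀¹ ∫_Ω K_t(x - y) dy dt + ∫_Ω (P w - a₀ w)(x - y) dy`.

Exchanging the time and surface integrals, and absolute convergence itself, rest on the `C^{1,1}`
estimate `|(x - y)·ν(y)| ≤ C |x - y|²`: it cancels the factor `1/t` in the flux of `K_t`, because
`AB = 1` makes `z·ν` the only singular term there (`flux_K`).

Only the term with `a₀` has a singular kernel. The gradient of `∫_Ω K_t(x - y) dy` is `O(t^{-1/2})`
and Lipschitz with constant `O(1/t)`; splitting the time integral at `t = d²` gives the modulus `d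
|log d|` (`exists_setIntegral_le_omega_one`). Composition with a `C^{1,1}` parametrization preserves
it.

The area formula for graphs and the divergence theorem on `C^{1,1}` domains are proved along the
way. For `n = 1` the boundary is locally a point and the claim degenerates. -/

theorem euclideanHausdorffMeasure_image_le_of_dist_le {X Y Z : Type*}
    [MetricSpace Y] [MeasurableSpace Y] [BorelSpace Y]
    [MetricSpace Z] [MeasurableSpace Z] [BorelSpace Z] (d : ℕ) {A : Set X}
    (f : X → Y) (g : X → Z) (C : NNReal)
    (h : ∀ x ∈ A, ∀ y ∈ A, dist (f x) (f y) ≤ C * dist (g x) (g y)) :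
    (μHE[d] : Measure Y) (f '' A) ≤ (C : ENNReal) ^ d * (μHE[d] : Measure Z) (g '' A) := by
  rcases A.eq_empty_or_nonempty with rfl | ⟨x0, hx0⟩
  · simp
  have : Nonempty X := ⟨x0⟩
  -- The hypothesis makes `f` constant on the fibres of `g` in `A`, so `f ∘ g⁻¹` is well defined and
  -- `C`-Lipschitz on `g '' A`; any choice of inverse does.
  have himg : f '' A = (fun z => f (Function.invFunOn g A z)) '' (g '' A) := by
    ext y
    constructor
    · rintro ⟨x, hx, rfl⟩
      refine ⟨g x, mem_image_of_mem _ hx, ?_⟩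
      have hm : Function.invFunOn g A (g x) ∈ A := Function.invFunOn_mem ⟨x, hx, rfl⟩
      have he : g (Function.invFunOn g A (g x)) = g x := Function.invFunOn_eq ⟨x, hx, rfl⟩
      have := h _ hm _ hx
      rw [he, dist_self, mul_zero] at this
      exact dist_le_zero.mp this
    · rintro ⟨z, ⟨x, hx, rfl⟩, rfl⟩
      exact ⟨_, Function.invFunOn_mem ⟨x, hx, rfl⟩, rfl⟩
  have hlip : LipschitzOnWith C (fun z => f (Function.invFunOn g A z)) (g '' A) := by
    refine LipschitzOnWith.of_dist_le_mul ?_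
    rintro z ⟨x, hx, rfl⟩ w ⟨y, hy, rfl⟩
    have h1 : g (Function.invFunOn g A (g x)) = g x := Function.invFunOn_eq ⟨x, hx, rfl⟩
    have h2 : g (Function.invFunOn g A (g y)) = g y := Function.invFunOn_eq ⟨y, hy, rfl⟩
    have := h _ (Function.invFunOn_mem (f := g) (b := g x) ⟨x, hx, rfl⟩) _
      (Function.invFunOn_mem (f := g) (b := g y) ⟨y, hy, rfl⟩)
    rwa [h1, h2] at this
  rw [himg, Measure.euclideanHausdorffMeasure_def, Measure.euclideanHausdorffMeasure_def,
    Measure.smul_apply, Measure.smul_apply]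
  have := hlip.hausdorffMeasure_image_le (d := d) (by positivity)
  rw [ENNReal.rpow_natCast] at this
  rw [ENNReal.smul_def, ENNReal.smul_def, smul_eq_mul, smul_eq_mul]
  calc _ ≤ _ := mul_le_mul_right this _
    _ = _ := by ring

/-- A linear map of `ℝᵐ` with the same metric distortion as the graph of the linear form `f`. -/
theorem exists_linearMap_norm_sq_eq {V : Type*} [NormedAddCommGroup V] [InnerProductSpace ℝ V]
    [FiniteDimensional ℝ V] (f : V →L[ℝ] ℝ) :
    ∃ T : V →ₗ[ℝ] V, T.det = √(1 + ‖f‖ ^ 2) ∧ ∀ x, ‖T x‖ ^ 2 = ‖x‖ ^ 2 + (f x) ^ 2 := by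
  set J := √(1 + ‖f‖ ^ 2) with hJ
  have hJ2 : J ^ 2 = 1 + ‖f‖ ^ 2 := Real.sq_sqrt (by positivity)
  have hJ0 : 0 ≤ J := Real.sqrt_nonneg _
  -- For `T x = x + c f(x) g` one needs `2c + c²‖f‖² = 1`. As `‖f‖² = J² - 1`, this holds for `c =
  -- 1/(1+J)`, and then `det T = 1 + c‖f‖² = J`.
  set c := 1 / (1 + J) with hc
  set g := (InnerProductSpace.toDual ℝ V).symm f with hg
  have hgf : ∀ x, inner ℝ g x = f x := fun x => InnerProductSpace.toDual_symm_apply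
  have hgn : ‖g‖ = ‖f‖ := LinearIsometryEquiv.norm_map _ _
  have hfg : f g = ‖f‖ ^ 2 := by rw [← hgf, real_inner_self_eq_norm_sq, hgn]
  refine ⟨LinearMap.transvection (f : V →ₗ[ℝ] ℝ) (c • g), ?_, ?_⟩
  · rw [LinearMap.transvection.det]
    simp only [ContinuousLinearMap.coe_coe, map_smul, smul_eq_mul, hfg]
    rw [show ‖f‖ ^ 2 = J ^ 2 - 1 by rw [hJ2]; ring, hc]
    field_simp
    ring
  · intro x
    rw [LinearMap.transvection.apply]
    simp only [ContinuousLinearMap.coe_coe]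
    rw [@norm_add_sq_real, smul_smul, real_inner_smul_right, norm_smul, real_inner_comm, hgf, hgn,
      mul_pow, Real.norm_eq_abs, sq_abs, show ‖f‖ ^ 2 = J ^ 2 - 1 by rw [hJ2]; ring, hc]
    field_simp
    ring

/-- This is the reverse triangle inequality for the vectors `(x, a)` and `(x, b)` of the plane. -/
theorem abs_sqrt_sub_sqrt_le (x a b : ℝ) : |√(x ^ 2 + a ^ 2) - √(x ^ 2 + b ^ 2)| ≤ |a - b| := by
  have key : ∀ a b : ℝ, √(x ^ 2 + a ^ 2) ≤ √(x ^ 2 + b ^ 2) + |a - b| := by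
    intro a b
    have hb : |b| ≤ √(x ^ 2 + b ^ 2) := by
      rw [← Real.sqrt_sq_eq_abs]; exact Real.sqrt_le_sqrt (by nlinarith)
    rw [Real.sqrt_le_left (by positivity)]
    have h2 := Real.sq_sqrt (show 0 ≤ x ^ 2 + b ^ 2 by positivity)
    have h3 : b * (a - b) ≤ √(x ^ 2 + b ^ 2) * |a - b| := by
      calc b * (a - b) ≤ |b * (a - b)| := le_abs_self _
        _ = |b| * |a - b| := abs_mul _ _
        _ ≤ _ := by gcongr
    nlinarith [sq_abs (a - b)]
  rw [abs_le]
  constructor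
  · have := key b a; rw [abs_sub_comm] at this; linarith
  · have := key a b; linarith

section Area

variable {m : ℕ} {X : Type*} [MetricSpace X] [MeasurableSpace X] [BorelSpace X]

/-- Where `γ` is `ε`-close to the linear form `f` on increments, the metric of the graph and that of
the linear model `T` differ by at most `ε‖η - η'‖`. Both dominate `‖η - η'‖`, so each is at most `1
+ ε` times the other, and `T` scales volume by its determinant. -/
theorem area_graph_piece {A : Set (E m)} {γ : E m → ℝ} {F : E m → X} {ε : ℝ} (hε : 0 ≤ ε)
    (hF : ∀ η ∈ A, ∀ η' ∈ A, dist (F η) (F η') = √(‖η - η'‖ ^ 2 + (γ η - γ η') ^ 2))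
    (f : E m →L[ℝ] ℝ) (hA : ∀ η ∈ A, ∀ η' ∈ A, |γ η - γ η' - f (η - η')| ≤ ε * ‖η - η'‖) :
    (μHE[m] : Measure X) (F '' A) ≤
        ENNReal.ofReal (1 + ε) ^ m * (ENNReal.ofReal √(1 + ‖f‖ ^ 2) * volume A) ∧
      ENNReal.ofReal √(1 + ‖f‖ ^ 2) * volume A ≤
        ENNReal.ofReal (1 + ε) ^ m * (μHE[m] : Measure X) (F '' A) := by
  obtain ⟨T, hTd, hT⟩ := exists_linearMap_norm_sq_eq f
  have hTA : (μHE[m] : Measure (E m)) (T '' A) = ENNReal.ofReal √(1 + ‖f‖ ^ 2) * volume A := by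
    rw [EuclideanSpace.euclideanHausdorffMeasure_eq_volume, Measure.addHaar_image_linearMap, hTd,
      abs_of_nonneg (Real.sqrt_nonneg _)]
  have hTn : ∀ x, ‖T x‖ = √(‖x‖ ^ 2 + (f x) ^ 2) := fun x => by
    rw [← hT, Real.sqrt_sq (norm_nonneg _)]
  have hc : ((1 + ε).toNNReal : ℝ) = 1 + ε := Real.coe_toNNReal _ (by linarith)
  rw [← hTA]
  have h0 : ∀ η ∈ A, ∀ η' ∈ A, |dist (F η) (F η') - dist (T η) (T η')| ≤ ε * ‖η - η'‖ := by
    intro η h η' h'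
    rw [hF η h η' h', dist_eq_norm, ← map_sub, hTn]
    exact (abs_sqrt_sub_sqrt_le _ _ _).trans (hA η h η' h')
  have hle : ∀ (x a : ℝ), 0 ≤ x → x ≤ √(x ^ 2 + a ^ 2) := fun x a hx =>
    Real.le_sqrt_of_sq_le (by nlinarith)
  constructor
  · refine euclideanHausdorffMeasure_image_le_of_dist_le m F T (1 + ε).toNNReal ?_
    intro η h η' h'
    have h1 := (abs_le.mp (h0 η h η' h')).2
    have h2 : ‖η - η'‖ ≤ dist (T η) (T η') := by
      rw [dist_eq_norm, ← map_sub, hTn]; exact hle _ _ (norm_nonneg _)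
    rw [hc]
    nlinarith
  · refine euclideanHausdorffMeasure_image_le_of_dist_le m T F (1 + ε).toNNReal ?_
    intro η h η' h'
    have h1 := (abs_le.mp (h0 η h η' h')).1
    have h2 : ‖η - η'‖ ≤ dist (F η) (F η') := by
      rw [hF η h η' h']; exact hle _ _ (norm_nonneg _)
    rw [hc]
    nlinarith

theorem le_of_forall_one_add_pow {a b : ENNReal} (k : ℕ)
    (h : ∀ ε : ℝ, 0 < ε → a ≤ ENNReal.ofReal (1 + ε) ^ k * b) : a ≤ b := by
  have ht : Tendsto (fun ε : ℝ => ENNReal.ofReal (1 + ε) ^ k * b) (𝓝[>] 0) (𝓝 (1 * b)) := by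
    have h1 : Tendsto (fun ε : ℝ => ENNReal.ofReal (1 + ε) ^ k) (𝓝[>] 0) (𝓝 1) := by
      have : Tendsto (fun ε : ℝ => ENNReal.ofReal (1 + ε) ^ k) (𝓝 0)
          (𝓝 (ENNReal.ofReal (1 + 0) ^ k)) := by
        refine ENNReal.Tendsto.pow (ENNReal.tendsto_ofReal ?_)
        exact (continuous_const.add continuous_id).tendsto 0
      simp only [add_zero, ENNReal.ofReal_one, one_pow] at this
      exact this.mono_left nhdsWithin_le_nhds
    exact ENNReal.Tendsto.mul_const h1 (Or.inl one_ne_zero)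
  rw [one_mul] at ht
  refine ge_of_tendsto ht ?_
  filter_upwards [self_mem_nhdsWithin] with ε hε using h ε hε

/-- A countable measurable partition into sets of small diameter. -/
theorem exists_partition_small (Y : Type*) [PseudoMetricSpace Y] [TopologicalSpace.SeparableSpace Y]
    [Nonempty Y] [MeasurableSpace Y] [OpensMeasurableSpace Y] {δ : ℝ} (hδ : 0 < δ) :
    ∃ (D : ℕ → Set Y) (c : ℕ → Y), (∀ i, MeasurableSet (D i)) ∧ Pairwise (Function.onFun Disjoint D) ∧
      (⋃ i, D i) = univ ∧ ∀ i, D i ⊆ Metric.ball (c i) δ := by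
  refine ⟨disjointed fun i => Metric.ball (TopologicalSpace.denseSeq Y i) δ,
    TopologicalSpace.denseSeq Y, ?_, disjoint_disjointed _, ?_, fun i => disjointed_subset _ i⟩
  · exact fun i => MeasurableSet.disjointed (fun _ => Metric.isOpen_ball.measurableSet) i
  · rw [iUnion_disjointed]
    refine eq_univ_of_forall fun y => ?_
    obtain ⟨i, hi⟩ := (TopologicalSpace.denseRange_denseSeq Y).exists_dist_lt y hδ
    exact mem_iUnion.mpr ⟨i, hi⟩

/-- The area formula for a graph of class `C^{1,1}` over a convex open set. -/
theorem area_graph {U : Set (E m)} (hUo : IsOpen U) (hUc : Convex ℝ U) {γ : E m → ℝ}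
    (hγ : DifferentiableOn ℝ γ U) {K : NNReal} (hK : LipschitzOnWith K (fderiv ℝ γ) U) {F : E m → X}
    (hF : ∀ η ∈ U, ∀ η' ∈ U, dist (F η) (F η') = √(‖η - η'‖ ^ 2 + (γ η - γ η') ^ 2))
    {A : Set (E m)} (hA : MeasurableSet A) (hAU : A ⊆ U) :
    (μHE[m] : Measure X) (F '' A) = ∫⁻ η in A, ENNReal.ofReal √(1 + ‖fderiv ℝ γ η‖ ^ 2) := by
  have hFinj : InjOn F U := by
    intro η h η' h' he
    have := hF η h η' h'
    rw [he, dist_self, eq_comm, Real.sqrt_eq_zero (by positivity)] at this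
    have h1 : ‖η - η'‖ ^ 2 = 0 := by nlinarith [sq_nonneg ‖η - η'‖, sq_nonneg (γ η - γ η')]
    exact sub_eq_zero.mp (norm_eq_zero.mp (by simpa using h1))
  have hFc : ContinuousOn F U := by
    intro η h
    rw [ContinuousWithinAt, tendsto_iff_dist_tendsto_zero]
    have h1 : Tendsto (fun η' => √(‖η' - η‖ ^ 2 + (γ η' - γ η) ^ 2)) (𝓝[U] η) (𝓝 0) := by
      have hc : ContinuousWithinAt (fun η' => √(‖η' - η‖ ^ 2 + (γ η' - γ η) ^ 2)) U η := by
        have := hγ.continuousOn η h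
        fun_prop
      have := hc.tendsto
      simpa using this
    refine h1.congr' ?_
    filter_upwards [self_mem_nhdsWithin] with η' h' using (hF η' h' η h).symm
  set J : E m → ENNReal := fun η => ENNReal.ofReal √(1 + ‖fderiv ℝ γ η‖ ^ 2) with hJ
  -- Of the `m + 1` factors, `m` come from the distortion of the metric and one from freezing the
  -- density at a point of the piece.
  have hloc : ∀ ε : ℝ, 0 < ε → ∃ δ > 0, ∀ (c : E m) (B : Set (E m)), MeasurableSet B → B ⊆ U →
      B ⊆ Metric.ball c δ → (μHE[m] : Measure X) (F '' B) ≤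
        ENNReal.ofReal (1 + ε) ^ (m + 1) * (∫⁻ η in B, J η) ∧
      (∫⁻ η in B, J η) ≤ ENNReal.ofReal (1 + ε) ^ (m + 1) * (μHE[m] : Measure X) (F '' B) := by
    intro ε hε
    -- Two points of a ball of radius `δ` are at distance less than `2δ`, so this radius lets the
    -- gradient vary by at most `ε`; the summand `1` covers `K = 0`.
    refine ⟨ε / (2 * (K + 1)), by positivity, ?_⟩
    intro c B hBm hBU hBc
    rcases B.eq_empty_or_nonempty with rfl | ⟨η0, h0⟩
    · simp
    set f := fderiv ℝ γ η0 with hf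
    have hder : ∀ η ∈ U ∩ Metric.ball c (ε / (2 * (K + 1))), ‖fderiv ℝ γ η - f‖ ≤ ε := by
      intro η hη
      have h1 := hK.dist_le_mul η hη.1 η0 (hBU h0)
      rw [dist_eq_norm] at h1
      have h2 : dist η η0 ≤ 2 * (ε / (2 * (K + 1))) := by
        have ha := Metric.mem_ball.mp hη.2
        have hb := Metric.mem_ball.mp (hBc h0)
        have := dist_triangle_right η η0 c
        linarith
      have h3 : (K : ℝ) * (2 * (ε / (2 * (K + 1)))) ≤ ε := by
        have hK0 : (0 : ℝ) ≤ K := K.2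
        rw [show (K : ℝ) * (2 * (ε / (2 * (K + 1)))) = ε * (K / (K + 1)) by field_simp]
        have : (K : ℝ) / (K + 1) ≤ 1 := by rw [div_le_one (by positivity)]; linarith
        nlinarith
      calc _ ≤ _ := h1
        _ ≤ K * (2 * (ε / (2 * (K + 1)))) := by gcongr
        _ ≤ ε := h3
    have hlin : ∀ η ∈ B, ∀ η' ∈ B, |γ η - γ η' - f (η - η')| ≤ ε * ‖η - η'‖ := by
      intro η h η' h'
      have hconv : Convex ℝ (U ∩ Metric.ball c (ε / (2 * (K + 1)))) := hUc.inter (convex_ball _ _)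
      refine hconv.norm_image_sub_le_of_norm_hasFDerivWithin_le' (f := γ) (f' := fderiv ℝ γ)
        (fun x hx => ?_) (fun x hx => hder x hx) ⟨hBU h', hBc h'⟩ ⟨hBU h, hBc h⟩
      exact ((hγ.differentiableAt (hUo.mem_nhds hx.1)).hasFDerivAt).hasFDerivWithinAt
    obtain ⟨hp1, hp2⟩ := area_graph_piece hε.le (fun η h η' h' => hF η (hBU h) η' (hBU h')) f hlin
    have hJcmp : ∀ η ∈ B, |√(1 + ‖fderiv ℝ γ η‖ ^ 2) - √(1 + ‖f‖ ^ 2)| ≤ ε := by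
      intro η h
      have h1 := abs_sqrt_sub_sqrt_le 1 ‖fderiv ℝ γ η‖ ‖f‖
      rw [one_pow] at h1
      exact h1.trans ((abs_norm_sub_norm_le _ _).trans (hder η ⟨hBU h, hBc h⟩))
    have h1le : ∀ a : ℝ, 1 ≤ √(1 + a ^ 2) := fun a => Real.le_sqrt_of_sq_le (by nlinarith)
    have hc1 : ENNReal.ofReal √(1 + ‖f‖ ^ 2) * volume B ≤
        ENNReal.ofReal (1 + ε) * ∫⁻ η in B, J η := by
      rw [← setLIntegral_const, ← lintegral_const_mul' _ _ ENNReal.ofReal_ne_top]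
      refine setLIntegral_mono' hBm fun η h => ?_
      rw [hJ, ← ENNReal.ofReal_mul (by linarith)]
      refine ENNReal.ofReal_le_ofReal ?_
      have := (abs_le.mp (hJcmp η h)).1
      nlinarith [h1le ‖fderiv ℝ γ η‖]
    have hc2 : (∫⁻ η in B, J η) ≤
        ENNReal.ofReal (1 + ε) * (ENNReal.ofReal √(1 + ‖f‖ ^ 2) * volume B) := by
      rw [← setLIntegral_const, ← lintegral_const_mul' _ _ ENNReal.ofReal_ne_top]
      refine setLIntegral_mono' hBm fun η h => ?_
      rw [hJ, ← ENNReal.ofReal_mul (by linarith)]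
      refine ENNReal.ofReal_le_ofReal ?_
      have := (abs_le.mp (hJcmp η h)).2
      nlinarith [h1le ‖f‖]
    constructor
    · calc _ ≤ _ := hp1
        _ ≤ ENNReal.ofReal (1 + ε) ^ m * (ENNReal.ofReal (1 + ε) * ∫⁻ η in B, J η) := by gcongr
        _ = _ := by ring
    · calc _ ≤ _ := hc2
        _ ≤ ENNReal.ofReal (1 + ε) *
            (ENNReal.ofReal (1 + ε) ^ m * (μHE[m] : Measure X) (F '' B)) := by gcongr
        _ = _ := by ring
  have hglob : ∀ ε : ℝ, 0 < ε → (μHE[m] : Measure X) (F '' A) ≤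
        ENNReal.ofReal (1 + ε) ^ (m + 1) * (∫⁻ η in A, J η) ∧
      (∫⁻ η in A, J η) ≤ ENNReal.ofReal (1 + ε) ^ (m + 1) * (μHE[m] : Measure X) (F '' A) := by
    intro ε hε
    obtain ⟨δ, hδ, hB⟩ := hloc ε hε
    obtain ⟨D, c, hDm, hDd, hDu, hDc⟩ := exists_partition_small (E m) hδ
    have hAd : A = ⋃ i, A ∩ D i := by rw [← inter_iUnion, hDu, inter_univ]
    have hm : ∀ i, MeasurableSet (A ∩ D i) := fun i => hA.inter (hDm i)
    have hdis : Pairwise (Function.onFun Disjoint fun i => A ∩ D i) := fun i j hij =>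
      (hDd hij).mono inter_subset_right inter_subset_right
    have hsub : ∀ i, A ∩ D i ⊆ U := fun i => inter_subset_left.trans hAU
    have e1 : (μHE[m] : Measure X) (F '' A) = ∑' i, (μHE[m] : Measure X) (F '' (A ∩ D i)) := by
      conv_lhs => rw [hAd, image_iUnion]
      refine measure_iUnion (fun i j hij => ?_) fun i => ?_
      · refine disjoint_left.mpr ?_
        rintro _ ⟨x, hx, rfl⟩ ⟨y, hy, he⟩
        rw [hFinj (hsub j hy) (hsub i hx) he] at hy
        exact disjoint_left.mp (hdis hij) hx hy
      · exact (hm i).image_of_continuousOn_injOn (hFc.mono (hsub i)) (hFinj.mono (hsub i))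
    have e2 : (∫⁻ η in A, J η) = ∑' i, ∫⁻ η in A ∩ D i, J η := by
      conv_lhs => rw [hAd]
      exact lintegral_iUnion hm hdis J
    rw [e1, e2, ← ENNReal.tsum_mul_left, ← ENNReal.tsum_mul_left]
    exact ⟨ENNReal.tsum_le_tsum fun i => (hB (c i) _ (hm i) (hsub i)
        (inter_subset_right.trans (hDc i))).1,
      ENNReal.tsum_le_tsum fun i => (hB (c i) _ (hm i) (hsub i)
        (inter_subset_right.trans (hDc i))).2⟩
  exact le_antisymm (le_of_forall_one_add_pow (m + 1) fun ε hε => (hglob ε hε).1)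
    (le_of_forall_one_add_pow (m + 1) fun ε hε => (hglob ε hε).2)

end Area

end DoubleLayer

namespace DoubleLayer

open MeasureTheory Set Filter Topology

/-! ### Coordinate cylinders -/

namespace CoordCylinder

variable {n : ℕ} {Ω : Set (E n)} {p : E n} (c : CoordCylinder Ω p)

/-- The coordinates of a point with respect to a cylinder. -/
def coord (z : E n) : WithLp 2 (E (n - 1) × ℝ) := c.R (z - p)

/-- The point with given coordinates. -/
def pt (η : E (n - 1)) (t : ℝ) : E n := p + c.R.symm (WithLp.toLp 2 (η, t))

/-- The open cylinder. -/
def cyl : Set (E n) := {z | (c.coord z).fst ∈ Metric.ball (0 : E (n - 1)) c.r ∧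
  (c.coord z).snd ∈ Ioo (-c.δ) c.δ}

theorem param_eq (η : E (n - 1)) : c.param η = c.pt η (c.γ η) := rfl

@[simp] theorem coord_pt (η : E (n - 1)) (t : ℝ) : c.coord (c.pt η t) = WithLp.toLp 2 (η, t) := by
  simp [coord, pt]

@[simp] theorem pt_coord (z : E n) : c.pt (c.coord z).fst (c.coord z).snd = z := by
  have : WithLp.toLp 2 ((c.coord z).fst, (c.coord z).snd) = c.coord z := rfl
  rw [pt, this, coord]
  simp

theorem continuous_coord : Continuous c.coord := by
  unfold coord; fun_prop

theorem continuous_fst : Continuous fun z => (c.coord z).fst :=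
  (WithLp.continuous_fst 2 _ _).comp c.continuous_coord

theorem continuous_snd : Continuous fun z => (c.coord z).snd :=
  (WithLp.continuous_snd 2 _ _).comp c.continuous_coord

theorem isOpen_cyl : IsOpen c.cyl :=
  (Metric.isOpen_ball.preimage c.continuous_fst).inter (isOpen_Ioo.preimage c.continuous_snd)

theorem mem_cyl_pt {η : E (n - 1)} {t : ℝ} :
    c.pt η t ∈ c.cyl ↔ η ∈ Metric.ball (0 : E (n - 1)) c.r ∧ t ∈ Ioo (-c.δ) c.δ := by
  simp [cyl]

theorem mem_iff_coord {z : E n} (hz : z ∈ c.cyl) : z ∈ Ω ↔ (c.coord z).snd < c.γ (c.coord z).fst := by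
  conv_lhs => rw [← c.pt_coord z]
  exact c.mem_iff _ hz.1 _ hz.2

theorem γ_mem {η : E (n - 1)} (hη : η ∈ Metric.ball (0 : E (n - 1)) c.r) :
    c.γ η ∈ Ioo (-c.δ) c.δ := by
  have := abs_lt.mp (c.abs_γ_lt η hη)
  have := c.δ_pos
  constructor <;> linarith

theorem param_mem_cyl {η : E (n - 1)} (hη : η ∈ Metric.ball (0 : E (n - 1)) c.r) :
    c.param η ∈ c.cyl := by
  rw [param_eq, mem_cyl_pt]
  exact ⟨hη, c.γ_mem hη⟩

theorem zero_mem_ball : (0 : E (n - 1)) ∈ Metric.ball (0 : E (n - 1)) c.r :=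
  Metric.mem_ball_self c.r_pos

theorem param_zero : c.param 0 = p := by
  simp [param, c.γ_zero]

theorem center_mem_cyl : p ∈ c.cyl := by
  simpa only [c.param_zero] using c.param_mem_cyl c.zero_mem_ball

theorem continuousOn_γ (hc : c.IsC11) : ContinuousOn c.γ (Metric.ball 0 c.r) := hc.1.continuousOn

theorem hasFDerivAt_γ (hc : c.IsC11) {η : E (n - 1)} (hη : η ∈ Metric.ball (0 : E (n - 1)) c.r) :
    HasFDerivAt c.γ (fderiv ℝ c.γ η) η :=
  (hc.1.differentiableAt (Metric.isOpen_ball.mem_nhds hη)).hasFDerivAt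

theorem continuousOn_pt_comp {f : E (n - 1) → ℝ} {s : Set (E (n - 1))} (hf : ContinuousOn f s) :
    ContinuousOn (fun η => c.pt η (f η)) s := by
  unfold pt
  refine continuousOn_const.add (c.R.symm.continuous.comp_continuousOn ?_)
  exact (WithLp.prod_continuous_toLp 2 _ _).comp_continuousOn (continuousOn_id.prodMk hf)

theorem continuous_pt (η : E (n - 1)) : Continuous (c.pt η) := by
  unfold pt
  refine continuous_const.add (c.R.symm.continuous.comp ?_)
  exact (WithLp.prod_continuous_toLp 2 _ _).comp (continuous_const.prodMk continuous_id)

theorem continuousOn_param (hc : c.IsC11) : ContinuousOn c.param (Metric.ball 0 c.r) :=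
  c.continuousOn_pt_comp (c.continuousOn_γ hc)

theorem isOpen_above (hc : c.IsC11) :
    IsOpen (c.cyl ∩ {z | c.γ (c.coord z).fst < (c.coord z).snd}) := by
  rw [isOpen_iff_mem_nhds]
  rintro z ⟨hz, hlt⟩
  have h1 : ContinuousAt (fun z => c.γ (c.coord z).fst) z :=
    ((c.continuousOn_γ hc).continuousAt (Metric.isOpen_ball.mem_nhds hz.1)).comp
      (f := fun z => (c.coord z).fst) c.continuous_fst.continuousAt
  exact inter_mem (c.isOpen_cyl.mem_nhds hz)
    (h1.eventually_lt c.continuous_snd.continuousAt hlt)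

/-- A point strictly above the graph has a neighbourhood that misses `Ω`, by continuity of `γ`; a
point on or below it is the limit of its vertical downward translates, which lie in `Ω`. -/
theorem mem_closure_iff (hc : c.IsC11) {z : E n} (hz : z ∈ c.cyl) :
    z ∈ closure Ω ↔ (c.coord z).snd ≤ c.γ (c.coord z).fst := by
  constructor
  · intro h
    by_contra! hlt
    obtain ⟨w, ⟨hw, hw'⟩, hwΩ⟩ := _root_.mem_closure_iff.mp h _ (c.isOpen_above hc) ⟨hz, hlt⟩
    exact lt_asymm hw' ((c.mem_iff_coord hw).mp hwΩ)
  · intro h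
    have ht : Tendsto (fun s : ℝ => c.pt (c.coord z).fst ((c.coord z).snd - s)) (𝓝[>] 0) (𝓝 z) := by
      have : Tendsto (fun s : ℝ => c.pt (c.coord z).fst ((c.coord z).snd - s)) (𝓝 0)
          (𝓝 (c.pt (c.coord z).fst ((c.coord z).snd - 0))) :=
        ((c.continuous_pt _).comp (continuous_const.sub continuous_id)).tendsto 0
      rw [sub_zero, pt_coord] at this
      exact this.mono_left nhdsWithin_le_nhds
    refine mem_closure_of_tendsto ht ?_
    filter_upwards [ht.eventually (c.isOpen_cyl.mem_nhds hz), self_mem_nhdsWithin] with s hs hs0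
    rw [c.mem_iff_coord hs, coord_pt]
    change (c.coord z).snd - s < c.γ (c.coord z).fst
    have : 0 < s := hs0
    linarith

theorem mem_frontier_iff (hΩ : IsOpen Ω) (hc : c.IsC11) {z : E n} (hz : z ∈ c.cyl) :
    z ∈ frontier Ω ↔ (c.coord z).snd = c.γ (c.coord z).fst := by
  rw [hΩ.frontier_eq, Set.mem_sdiff, c.mem_closure_iff hc hz, c.mem_iff_coord hz, not_lt]
  exact ⟨fun h => le_antisymm h.1 h.2, fun h => ⟨h.le, h.ge⟩⟩

theorem param_mem_frontier (hΩ : IsOpen Ω) (hc : c.IsC11) {η : E (n - 1)}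
    (hη : η ∈ Metric.ball (0 : E (n - 1)) c.r) : c.param η ∈ frontier Ω := by
  rw [c.mem_frontier_iff hΩ hc (c.param_mem_cyl hη), param_eq, coord_pt]
  rfl

theorem frontier_inter_cyl (hΩ : IsOpen Ω) (hc : c.IsC11) :
    frontier Ω ∩ c.cyl = c.param '' Metric.ball 0 c.r := by
  ext z
  constructor
  · rintro ⟨hf, hz⟩
    refine ⟨(c.coord z).fst, hz.1, ?_⟩
    rw [param_eq, ← (c.mem_frontier_iff hΩ hc hz).mp hf, pt_coord]
  · rintro ⟨η, hη, rfl⟩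
    exact ⟨c.param_mem_frontier hΩ hc hη, c.param_mem_cyl hη⟩

theorem dist_param (η η' : E (n - 1)) :
    dist (c.param η) (c.param η') = √(‖η - η'‖ ^ 2 + (c.γ η - c.γ η') ^ 2) := by
  rw [param, param, dist_add_left, LinearIsometryEquiv.dist_map, dist_eq_norm, WithLp.prod_norm_eq_of_L2]
  simp

/-- The area density `√(1 + |∇γ|²)`. -/
def dens (η : E (n - 1)) : ℝ := √(1 + ‖fderiv ℝ c.γ η‖ ^ 2)

theorem one_le_dens (η : E (n - 1)) : 1 ≤ c.dens η := Real.le_sqrt_of_sq_le (by nlinarith)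

theorem dens_pos (η : E (n - 1)) : 0 < c.dens η := one_pos.trans_le (c.one_le_dens η)

/-- The outer unit normal in the coordinates of the cylinder. -/
def normal (η : E (n - 1)) : E n :=
  (c.dens η)⁻¹ • c.R.symm (WithLp.toLp 2 (-(InnerProductSpace.toDual ℝ _).symm (fderiv ℝ c.γ η), 1))

/-- Up to the positive density, `w·ν` is the rate at which the ray in direction `w` rises above the
graph. This links the analytic normal with the definition by rays. -/
theorem inner_normal (w : E n) (η : E (n - 1)) :
    inner ℝ w (c.normal η) = (c.dens η)⁻¹ * ((c.R w).snd - fderiv ℝ c.γ η (c.R w).fst) := by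
  rw [normal, real_inner_smul_right, ← c.R.inner_map_map, LinearIsometryEquiv.apply_symm_apply,
    WithLp.prod_inner_apply]
  congr 1
  change inner ℝ (c.R w).fst (-(InnerProductSpace.toDual ℝ _).symm (fderiv ℝ c.γ η)) +
    inner ℝ (c.R w).snd 1 = _
  rw [inner_neg_right, real_inner_comm, InnerProductSpace.toDual_symm_apply]
  simp
  ring

theorem norm_normal (η : E (n - 1)) : ‖c.normal η‖ = 1 := by
  rw [normal, norm_smul, LinearIsometryEquiv.norm_map, WithLp.prod_norm_eq_of_L2]
  change ‖(c.dens η)⁻¹‖ * √(‖-(InnerProductSpace.toDual ℝ _).symm (fderiv ℝ c.γ η)‖ ^ 2 +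
    ‖(1 : ℝ)‖ ^ 2) = 1
  rw [norm_neg, LinearIsometryEquiv.norm_map, norm_one, one_pow, add_comm, norm_inv, Real.norm_of_nonneg (c.dens_pos η).le]
  exact inv_mul_cancel₀ (c.dens_pos η).ne'

theorem coord_add (z w : E n) : c.coord (z + w) = c.coord z + c.R w := by
  rw [coord, coord, ← map_add]; congr 1; abel

/-- Along `t ↦ param η + t w` the height of the graph minus the height of the ray vanishes at `0`,
and its derivative has the sign opposite to `w·ν`. For small `t > 0` this decides on which side of
the graph the ray lies. -/
theorem isOuterUnitNormal (hc : c.IsC11) {η : E (n - 1)}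
    (hη : η ∈ Metric.ball (0 : E (n - 1)) c.r) : IsOuterUnitNormal Ω (c.param η) (c.normal η) := by
  have hcyl : ∀ w : E n, ∀ᶠ t : ℝ in 𝓝[>] 0, c.param η + t • w ∈ c.cyl := by
    intro w
    have : Tendsto (fun t : ℝ => c.param η + t • w) (𝓝 0) (𝓝 (c.param η + (0 : ℝ) • w)) :=
      (continuous_const.add (continuous_id.smul continuous_const)).tendsto 0
    rw [zero_smul, add_zero] at this
    exact (this.mono_left nhdsWithin_le_nhds).eventually
      (c.isOpen_cyl.mem_nhds (c.param_mem_cyl hη))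
  have hder : ∀ w : E n, HasDerivAt
      (fun t : ℝ => c.γ (η + t • (c.R w).fst) - (c.γ η + t * (c.R w).snd))
      (fderiv ℝ c.γ η (c.R w).fst - (c.R w).snd) 0 := by
    intro w
    have h1 : HasDerivAt (fun t : ℝ => η + t • (c.R w).fst) (c.R w).fst 0 := by
      simpa using ((hasDerivAt_id (0 : ℝ)).smul_const (c.R w).fst).const_add η
    have h2 := c.hasFDerivAt_γ hc hη
    have h3 : HasDerivAt (fun t : ℝ => c.γ (η + t • (c.R w).fst)) (fderiv ℝ c.γ η (c.R w).fst) 0 := by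
      refine HasFDerivAt.comp_hasDerivAt (0 : ℝ) ?_ h1
      simpa using h2
    have h4 : HasDerivAt (fun t : ℝ => c.γ η + t * (c.R w).snd) ((c.R w).snd) 0 := by
      simpa using ((hasDerivAt_id (0 : ℝ)).mul_const (c.R w).snd).const_add (c.γ η)
    exact h3.sub h4
  have hco : ∀ (w : E n) (t : ℝ), c.coord (c.param η + t • w) =
      WithLp.toLp 2 (η + t • (c.R w).fst, c.γ η + t * (c.R w).snd) := by
    intro w t
    rw [coord_add, param_eq, coord_pt, map_smul]
    rfl
  have hd := c.dens_pos η
  refine ⟨c.norm_normal η, fun w hw => ?_, fun w hw => ?_⟩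
  · rw [inner_normal] at hw
    have hw' : 0 < fderiv ℝ c.γ η (c.R w).fst - (c.R w).snd := by
      by_contra! h
      have : 0 ≤ (c.dens η)⁻¹ * ((c.R w).snd - fderiv ℝ c.γ η (c.R w).fst) :=
        mul_nonneg (inv_nonneg.mpr hd.le) (by linarith)
      linarith
    have hs := (hder w).tendsto_slope_zero_right
    filter_upwards [hcyl w, hs.eventually (lt_mem_nhds hw'), self_mem_nhdsWithin] with t ht hst ht0
    have ht0' : 0 < t := ht0
    rw [c.mem_iff_coord ht, hco]
    simp only [zero_add, zero_smul, add_zero, zero_mul, sub_self, sub_zero, smul_eq_mul] at hst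
    have := (mul_pos_iff_of_pos_left (inv_pos.mpr ht0')).mp hst
    change c.γ η + t * (c.R w).snd < c.γ (η + t • (c.R w).fst)
    linarith
  · rw [inner_normal] at hw
    have hw' : fderiv ℝ c.γ η (c.R w).fst - (c.R w).snd < 0 := by
      by_contra! h
      have : (c.dens η)⁻¹ * ((c.R w).snd - fderiv ℝ c.γ η (c.R w).fst) ≤ 0 :=
        mul_nonpos_of_nonneg_of_nonpos (inv_nonneg.mpr hd.le) (by linarith)
      linarith
    have hs := (hder w).tendsto_slope_zero_right
    filter_upwards [hcyl w, hs.eventually (gt_mem_nhds hw'), self_mem_nhdsWithin] with t ht hst ht0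
    have ht0' : 0 < t := ht0
    rw [c.mem_closure_iff hc ht, hco, not_le]
    simp only [zero_add, zero_smul, add_zero, zero_mul, sub_self, sub_zero, smul_eq_mul] at hst
    have := (smul_neg_iff_of_pos_left (inv_pos.mpr ht0')).mp hst
    change c.γ (η + t • (c.R w).fst) < c.γ η + t * (c.R w).snd
    linarith

end CoordCylinder

/-! ### Uniqueness and continuity of the outer normal -/

/-- If `v ≠ v'`, the direction `w = v' - v` satisfies `w·v < 0 < w·v'`, so the same short ray would
lie both in `Ω` and outside its closure. -/
theorem IsOuterUnitNormal.unique {n : ℕ} {Ω : Set (E n)} {x v v' : E n}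
    (h : IsOuterUnitNormal Ω x v) (h' : IsOuterUnitNormal Ω x v') : v = v' := by
  by_contra hne
  have hlt : inner ℝ v v' < 1 := (inner_lt_one_iff_real_of_norm_eq_one h.1 h'.1).mpr hne
  have h1 : inner ℝ (v' - v) v < 0 := by
    rw [inner_sub_left, real_inner_self_eq_norm_sq, h.1, real_inner_comm]; linarith
  have h2 : 0 < inner ℝ (v' - v) v' := by
    rw [inner_sub_left, real_inner_self_eq_norm_sq, h'.1]; linarith
  obtain ⟨t, ht1, ht2⟩ := ((h.2.1 _ h1).and (h'.2.2 _ h2)).exists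
  exact ht2 (subset_closure ht1)

theorem IsOuterUnitNormal.outerNormal_eq {n : ℕ} {Ω : Set (E n)} {x v : E n}
    (h : IsOuterUnitNormal Ω x v) : outerNormal Ω x = v := by
  have hex : ∃ v, IsOuterUnitNormal Ω x v := ⟨v, h⟩
  rw [outerNormal, dif_pos hex]
  exact hex.choose_spec.unique h

namespace CoordCylinder

variable {n : ℕ} {Ω : Set (E n)} {p : E n} (c : CoordCylinder Ω p)

theorem outerNormal_param (hc : c.IsC11) {η : E (n - 1)}
    (hη : η ∈ Metric.ball (0 : E (n - 1)) c.r) : outerNormal Ω (c.param η) = c.normal η :=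
  (c.isOuterUnitNormal hc hη).outerNormal_eq

theorem continuousOn_fderiv_γ (hc : c.IsC11) : ContinuousOn (fderiv ℝ c.γ) (Metric.ball 0 c.r) := by
  obtain ⟨K, hK⟩ := hc.2
  exact hK.continuousOn

theorem continuousOn_dens (hc : c.IsC11) : ContinuousOn c.dens (Metric.ball 0 c.r) := by
  have := c.continuousOn_fderiv_γ hc
  unfold dens
  fun_prop

theorem continuousOn_normal (hc : c.IsC11) : ContinuousOn c.normal (Metric.ball 0 c.r) := by
  have h1 := c.continuousOn_fderiv_γ hc
  unfold normal
  refine ((c.continuousOn_dens hc).inv₀ fun η _ => (c.dens_pos η).ne').smul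
    (c.R.symm.continuous.comp_continuousOn ((WithLp.prod_continuous_toLp 2 _ _).comp_continuousOn ?_))
  exact (((LinearIsometryEquiv.continuous _).comp_continuousOn h1).neg).prodMk continuousOn_const

theorem exists_norm_fderiv_γ_le (hc : c.IsC11) :
    ∃ M : ℝ, 0 ≤ M ∧ ∀ η ∈ Metric.ball (0 : E (n - 1)) c.r, ‖fderiv ℝ c.γ η‖ ≤ M := by
  obtain ⟨K, hK⟩ := hc.2
  refine ⟨K * c.r + ‖fderiv ℝ c.γ 0‖, by have := c.r_pos; positivity, fun η hη => ?_⟩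
  have h1 := hK.dist_le_mul η hη 0 c.zero_mem_ball
  have h2 : dist η 0 ≤ c.r := (Metric.mem_ball.mp hη).le
  rw [dist_eq_norm] at h1
  have h3 := norm_le_norm_sub_add (fderiv ℝ c.γ η) (fderiv ℝ c.γ 0)
  have h4 : (K : ℝ) * dist η 0 ≤ K * c.r := by gcongr
  linarith

end CoordCylinder

theorem isOuterUnitNormal_outerNormal {n : ℕ} {Ω : Set (E n)} (hΩ : IsC11Domain Ω)
    {x : E n} (hx : x ∈ frontier Ω) : IsOuterUnitNormal Ω x (outerNormal Ω x) := by
  obtain ⟨c, hc⟩ := hΩ x hx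
  have := c.isOuterUnitNormal hc c.zero_mem_ball
  rw [c.param_zero] at this
  rwa [this.outerNormal_eq]

theorem continuousOn_outerNormal {n : ℕ} {Ω : Set (E n)} (hΩo : IsOpen Ω) (hΩ : IsC11Domain Ω) :
    ContinuousOn (outerNormal Ω) (frontier Ω) := by
  intro x hx
  obtain ⟨c, hc⟩ := hΩ x hx
  have h1 : ContinuousAt (fun z => c.normal (c.coord z).fst) x :=
    ContinuousAt.comp (f := fun z => (c.coord z).fst)
      ((c.continuousOn_normal hc).continuousAt (Metric.isOpen_ball.mem_nhds c.center_mem_cyl.1))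
      c.continuous_fst.continuousAt
  have h2 : ∀ z ∈ frontier Ω ∩ c.cyl, c.normal (c.coord z).fst = outerNormal Ω z := by
    rintro z ⟨hz, hzc⟩
    rw [← c.outerNormal_param hc hzc.1, c.param_eq, ← (c.mem_frontier_iff hΩo hc hzc).mp hz,
      c.pt_coord]
  refine (h1.continuousWithinAt (s := frontier Ω)).congr_of_eventuallyEq ?_
    (h2 x ⟨hx, c.center_mem_cyl⟩).symm
  filter_upwards [self_mem_nhdsWithin, mem_nhdsWithin_of_mem_nhds (c.isOpen_cyl.mem_nhds c.center_mem_cyl)]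
    with z hz hzc using (h2 z ⟨hz, hzc⟩).symm

end DoubleLayer

namespace DoubleLayer

open MeasureTheory Set Filter Topology

/-! ### The surface measure in a cylinder -/

theorem measurableSet_inter_preimage_of_continuousOn {X Y : Type*} [TopologicalSpace X]
    [MeasurableSpace X] [OpensMeasurableSpace X] [TopologicalSpace Y] [MeasurableSpace Y]
    [BorelSpace Y] {f : X → Y} {s : Set X} (hf : ContinuousOn f s) (hs : MeasurableSet s)
    {B : Set Y} (hB : MeasurableSet B) : MeasurableSet (s ∩ f ⁻¹' B) := by
  have h1 : MeasurableSet (s.domRestrict f ⁻¹' B) :=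
    (continuousOn_iff_continuous_domRestrict.mp hf).measurable hB
  have h2 : s ∩ f ⁻¹' B = Subtype.val '' (s.domRestrict f ⁻¹' B) := by
    ext x; simp [Set.domRestrict, and_comm]
  rw [h2]
  exact hs.subtype_image h1

namespace CoordCylinder

variable {n : ℕ} {Ω : Set (E n)} {p : E n} (c : CoordCylinder Ω p)

theorem surfaceMeasure_image (hc : c.IsC11) {A : Set (E (n - 1))} (hA : MeasurableSet A)
    (hAb : A ⊆ Metric.ball 0 c.r) :
    surfaceMeasure n (c.param '' A) = ∫⁻ η in A, ENNReal.ofReal (c.dens η) := by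
  obtain ⟨K, hK⟩ := hc.2
  exact area_graph Metric.isOpen_ball (convex_ball _ _) hc.1 hK
    (fun η _ η' _ => c.dist_param η η') hA hAb

theorem aemeasurable_param (hc : c.IsC11) :
    AEMeasurable c.param (volume.restrict (Metric.ball 0 c.r)) :=
  (c.continuousOn_param hc).aemeasurable Metric.isOpen_ball.measurableSet

/-- The part of the boundary in the cylinder is the image of the ball under `param`, so the area
formula identifies the two measures set by set. Surface integrals thereby become weighted integrals
over a ball. -/
theorem surfaceMeasure_restrict (hΩ : IsOpen Ω) (hc : c.IsC11) :
    (surfaceMeasure n).restrict (frontier Ω ∩ c.cyl) =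
      ((volume.restrict (Metric.ball 0 c.r)).withDensity
        fun η => ((c.dens η).toNNReal : ENNReal)).map c.param := by
  have hm : AEMeasurable c.param ((volume.restrict (Metric.ball 0 c.r)).withDensity
      fun η => ((c.dens η).toNNReal : ENNReal)) :=
    (c.aemeasurable_param hc).mono_ac (withDensity_absolutelyContinuous _ _)
  ext B hB
  have hBm : MeasurableSet (Metric.ball 0 c.r ∩ c.param ⁻¹' B) :=
    measurableSet_inter_preimage_of_continuousOn (c.continuousOn_param hc)
      Metric.isOpen_ball.measurableSet hB
  rw [Measure.map_apply_of_aemeasurable hm hB, Measure.restrict_apply hB,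
    c.frontier_inter_cyl hΩ hc, inter_comm, ← image_inter_preimage,
    c.surfaceMeasure_image hc hBm inter_subset_left]
  rw [withDensity_apply', Measure.restrict_restrict' Metric.isOpen_ball.measurableSet, inter_comm]
  rfl

theorem integral_frontier_cyl (hΩ : IsOpen Ω) (hc : c.IsC11) {F : Type*} [NormedAddCommGroup F]
    [NormedSpace ℝ F] {g : E n → F}
    (hg : AEStronglyMeasurable g ((surfaceMeasure n).restrict (frontier Ω ∩ c.cyl))) :
    ∫ y in frontier Ω ∩ c.cyl, g y ∂(surfaceMeasure n) =
      ∫ η in Metric.ball 0 c.r, c.dens η • g (c.param η) := by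
  have hd : AEMeasurable (fun η => (c.dens η).toNNReal) (volume.restrict (Metric.ball 0 c.r)) :=
    ((c.continuousOn_dens hc).aemeasurable Metric.isOpen_ball.measurableSet).real_toNNReal
  rw [c.surfaceMeasure_restrict hΩ hc] at hg ⊢
  rw [integral_map ((c.aemeasurable_param hc).mono_ac (withDensity_absolutelyContinuous _ _)) hg,
    integral_withDensity_eq_integral_smul₀ hd]
  congr 1 with η
  rw [NNReal.smul_def, Real.coe_toNNReal _ (c.dens_pos η).le]

theorem integrableOn_frontier_cyl (hΩ : IsOpen Ω) (hc : c.IsC11) {F : Type*} [NormedAddCommGroup F]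
    [NormedSpace ℝ F] {g : E n → F}
    (hg : AEStronglyMeasurable g ((surfaceMeasure n).restrict (frontier Ω ∩ c.cyl))) :
    IntegrableOn g (frontier Ω ∩ c.cyl) (surfaceMeasure n) ↔
      IntegrableOn (fun η => c.dens η • g (c.param η)) (Metric.ball 0 c.r) := by
  have hd : AEMeasurable (fun η => (c.dens η).toNNReal) (volume.restrict (Metric.ball 0 c.r)) :=
    ((c.continuousOn_dens hc).aemeasurable Metric.isOpen_ball.measurableSet).real_toNNReal
  rw [IntegrableOn]
  rw [c.surfaceMeasure_restrict hΩ hc] at hg ⊢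
  rw [integrable_map_measure hg ((c.aemeasurable_param hc).mono_ac
    (withDensity_absolutelyContinuous _ _)), integrable_withDensity_iff_integrable_smul₀ hd]
  rw [IntegrableOn]
  congr! 2 with η
  simp only [NNReal.smul_def, Real.coe_toNNReal _ (c.dens_pos _).le, Function.comp]

theorem integrableOn_dens (hc : c.IsC11) : IntegrableOn c.dens (Metric.ball 0 c.r) := by
  obtain ⟨M, hM0, hM⟩ := c.exists_norm_fderiv_γ_le hc
  refine IntegrableOn.of_bound measure_ball_lt_top
    ((c.continuousOn_dens hc).aestronglyMeasurable Metric.isOpen_ball.measurableSet)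
    √(1 + M ^ 2) ?_
  filter_upwards [ae_restrict_mem Metric.isOpen_ball.measurableSet] with η hη
  rw [Real.norm_of_nonneg (c.dens_pos η).le]
  have := hM η hη
  unfold dens
  gcongr

theorem surfaceMeasure_cyl_lt_top (hΩ : IsOpen Ω) (hc : c.IsC11) :
    surfaceMeasure n (frontier Ω ∩ c.cyl) < ⊤ := by
  rw [c.frontier_inter_cyl hΩ hc, c.surfaceMeasure_image hc Metric.isOpen_ball.measurableSet subset_rfl]
  exact (c.integrableOn_dens hc).lintegral_lt_top

theorem measurePreserving_pt :
    MeasurePreserving (fun q : E (n - 1) × ℝ => c.pt q.1 q.2) (volume : Measure (E (n - 1) × ℝ))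
      (volume : Measure (E n)) := by
  have h1 : MeasurePreserving (WithLp.toLp 2 : E (n - 1) × ℝ → WithLp 2 (E (n - 1) × ℝ)) :=
    WithLp.volume_preserving_toLp _ _
  exact (measurePreserving_add_left volume p).comp (c.R.symm.measurePreserving.comp h1)

end CoordCylinder

/-! ### Finiteness and singular estimates on the boundary -/

theorem surfaceMeasure_frontier_lt_top {n : ℕ} {Ω : Set (E n)} (hΩo : IsOpen Ω)
    (hΩb : Bornology.IsBounded Ω) (hΩ : IsC11Domain Ω) : surfaceMeasure n (frontier Ω) < ⊤ := by
  have hK : IsCompact (frontier Ω) :=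
    Metric.isCompact_of_isClosed_isBounded isClosed_frontier (hΩb.closure.subset frontier_subset_closure)
  refine hK.measure_lt_top_of_nhdsWithin fun x hx => ?_
  obtain ⟨c, hc⟩ := hΩ x hx
  refine ⟨frontier Ω ∩ c.cyl, ?_, c.surfaceMeasure_cyl_lt_top hΩo hc⟩
  exact inter_mem_nhdsWithin _ (c.isOpen_cyl.mem_nhds c.center_mem_cyl)

/-- In a cylinder centred at `x`, the product is the remainder of the first order Taylor expansion
of `γ` at `η`, evaluated at `0`, up to sign and division by the density; a Lipschitz gradient makes
it quadratic. Outside the cylinder `|x - y| ≥ ρ`, and Cauchy-Schwarz suffices with constant `ρ⁻¹`.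
The constant may depend on `x`, since it only serves integrability at a fixed `x`. -/
theorem exists_abs_inner_outerNormal_le {n : ℕ} {Ω : Set (E n)} (hΩo : IsOpen Ω)
    (hΩ : IsC11Domain Ω) {x : E n} (hx : x ∈ frontier Ω) :
    ∃ C : ℝ, 0 ≤ C ∧ ∀ y ∈ frontier Ω, |inner ℝ (x - y) (outerNormal Ω y)| ≤ C * ‖x - y‖ ^ 2 := by
  obtain ⟨c, hc⟩ := hΩ x hx
  obtain ⟨K, hK⟩ := hc.2
  obtain ⟨ρ, hρ, hball⟩ := Metric.isOpen_iff.mp c.isOpen_cyl x c.center_mem_cyl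
  refine ⟨max K ρ⁻¹, le_max_of_le_left K.2, fun y hy => ?_⟩
  by_cases hyc : y ∈ c.cyl
  · obtain ⟨η, hη, rfl⟩ : y ∈ c.param '' Metric.ball 0 c.r := by
      rw [← c.frontier_inter_cyl hΩo hc]; exact ⟨hy, hyc⟩
    rw [c.outerNormal_param hc hη, c.inner_normal]
    have hR : c.R (x - c.param η) = WithLp.toLp 2 (-η, -c.γ η) := by
      rw [CoordCylinder.param, sub_add_cancel_left, map_neg, LinearIsometryEquiv.apply_symm_apply]
      rfl
    rw [hR]
    change |(c.dens η)⁻¹ * (-c.γ η - fderiv ℝ c.γ η (-η))| ≤ _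
    have hseg : ∀ z ∈ segment ℝ (0 : E (n - 1)) η, z ∈ Metric.ball (0 : E (n - 1)) c.r ∧
        dist z η ≤ ‖η‖ := by
      intro z hz
      refine ⟨(convex_ball _ _).segment_subset c.zero_mem_ball hη hz, ?_⟩
      obtain ⟨a, b, ha, hb, hab, rfl⟩ := hz
      rw [smul_zero, zero_add, dist_eq_norm, show b • η - η = -(a • η) by
        rw [← eq_sub_iff_add_eq] at hab; rw [hab, sub_smul, one_smul]; abel, norm_neg, norm_smul,
        Real.norm_of_nonneg ha]
      nlinarith [norm_nonneg η]
    have h1 : ‖c.γ 0 - c.γ η - fderiv ℝ c.γ η (0 - η)‖ ≤ K * ‖η‖ * ‖0 - η‖ := by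
      refine (convex_segment (0 : E (n - 1)) η).norm_image_sub_le_of_norm_hasFDerivWithin_le'
        (f' := fderiv ℝ c.γ)
        (fun z hz => (c.hasFDerivAt_γ hc (hseg z hz).1).hasFDerivWithinAt) (fun z hz => ?_)
        (right_mem_segment _ _ _) (left_mem_segment _ _ _)
      rw [← dist_eq_norm]
      refine (hK.dist_le_mul z (hseg z hz).1 η hη).trans ?_
      gcongr
      exact (hseg z hz).2
    rw [c.γ_zero, zero_sub, zero_sub, norm_neg, Real.norm_eq_abs] at h1
    have h2 : ‖η‖ ≤ ‖x - c.param η‖ := by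
      rw [← c.R.norm_map, hR, WithLp.prod_norm_eq_of_L2]
      refine Real.le_sqrt_of_sq_le ?_
      simp
      positivity
    rw [abs_mul, abs_inv, abs_of_pos (c.dens_pos η)]
    have h3 : (c.dens η)⁻¹ ≤ 1 := inv_le_one_of_one_le₀ (c.one_le_dens η)
    calc _ ≤ 1 * (K * ‖η‖ * ‖η‖) := by gcongr
      _ ≤ K * ‖x - c.param η‖ ^ 2 := by
        rw [one_mul, mul_assoc, ← sq]
        gcongr
      _ ≤ _ := by gcongr; exact le_max_left _ _
  · have h1 : ρ ≤ ‖x - y‖ := by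
      by_contra! h
      refine hyc (hball ?_)
      rwa [Metric.mem_ball, dist_comm, dist_eq_norm]
    have h2 : |inner ℝ (x - y) (outerNormal Ω y)| ≤ ‖x - y‖ := by
      have := abs_real_inner_le_norm (x - y) (outerNormal Ω y)
      rwa [(isOuterUnitNormal_outerNormal hΩ hy).1, mul_one] at this
    calc _ ≤ _ := h2
      _ = ρ⁻¹ * (ρ * ‖x - y‖) := by field_simp
      _ ≤ ρ⁻¹ * (‖x - y‖ * ‖x - y‖) := by gcongr
      _ ≤ _ := by rw [← sq]; gcongr; exact le_max_right _ _

/-- Near `x` the projection of the graph to its base does not increase distances, so the integrand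
is dominated by a multiple of `‖η‖^{-s}` in dimension `n - 1 > s`. Far from `x` it is bounded and
the measure is finite. -/
theorem integrableOn_norm_rpow_frontier {n : ℕ} (hn : 2 ≤ n) {Ω : Set (E n)} (hΩo : IsOpen Ω)
    (hΩb : Bornology.IsBounded Ω) (hΩ : IsC11Domain Ω) {x : E n} (hx : x ∈ frontier Ω) {s : ℝ}
    (hs0 : 0 ≤ s) (hs : s < (n : ℝ) - 1) :
    IntegrableOn (fun y => ‖x - y‖ ^ (-s)) (frontier Ω) (surfaceMeasure n) := by
  obtain ⟨c, hc⟩ := hΩ x hx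
  obtain ⟨ρ, hρ, hball⟩ := Metric.isOpen_iff.mp c.isOpen_cyl x c.center_mem_cyl
  have hmeas : Measurable (fun y : E n => ‖x - y‖ ^ (-s)) := by fun_prop
  have hfm : MeasurableSet (frontier Ω) := isClosed_frontier.measurableSet
  rw [← inter_union_sdiff (frontier Ω) c.cyl]
  refine IntegrableOn.union ?_ ?_
  · rw [c.integrableOn_frontier_cyl hΩo hc hmeas.aestronglyMeasurable]
    obtain ⟨M, hM0, hM⟩ := c.exists_norm_fderiv_γ_le hc
    have hfr : Module.finrank ℝ (E (n - 1)) = n - 1 := by simp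
    have hae : AEStronglyMeasurable (fun η => c.dens η • ‖x - c.param η‖ ^ (-s))
        (volume.restrict (Metric.ball 0 c.r)) := by
      refine AEStronglyMeasurable.smul
        ((c.continuousOn_dens hc).aestronglyMeasurable Metric.isOpen_ball.measurableSet) ?_
      exact (hmeas.comp_aemeasurable (c.aemeasurable_param hc)).aestronglyMeasurable
    have := integrableOn_ball_of_norm_le_rpow (μ := (volume : Measure (E (n - 1))))
      (f := (Metric.ball 0 c.r).indicator fun η => c.dens η • ‖x - c.param η‖ ^ (-s)) (r := c.r)
      (C := √(1 + M ^ 2)) (α := s)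
      (by rw [hfr]; omega) (by rw [hfr, Nat.cast_sub (by omega)]; simpa using hs) ?_ ?_
    · exact (this.congr_fun (fun η hη => indicator_of_mem hη _) Metric.isOpen_ball.measurableSet)
    · have hne : ∀ᵐ η : E (n - 1) ∂(volume.restrict (Metric.ball 0 c.r)), η ≠ 0 := by
        have : Nontrivial (E (n - 1)) := Module.nontrivial_of_finrank_pos (R := ℝ) (by rw [hfr]; omega)
        exact ae_restrict_of_ae (Measure.ae_ne volume 0)
      filter_upwards [hne, ae_restrict_mem Metric.isOpen_ball.measurableSet] with η h0 hη
      rw [indicator_of_mem hη, norm_smul, Real.norm_of_nonneg (c.dens_pos η).le,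
        Real.norm_of_nonneg (by positivity)]
      have h1 : c.dens η ≤ √(1 + M ^ 2) := by
        have := hM η hη
        unfold CoordCylinder.dens
        gcongr
      have h2 : ‖η‖ ≤ ‖x - c.param η‖ := by
        have := c.dist_param 0 η
        rw [c.param_zero, dist_eq_norm] at this
        rw [this]
        refine Real.le_sqrt_of_sq_le ?_
        simp
        positivity
      have h3 : ‖x - c.param η‖ ^ (-s) ≤ ‖η‖ ^ (-s) :=
        Real.rpow_le_rpow_of_nonpos (norm_pos_iff.mpr h0) h2 (by linarith)
      gcongr
    · rwa [aestronglyMeasurable_indicator_iff Metric.isOpen_ball.measurableSet]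
  · refine IntegrableOn.of_bound ?_ hmeas.aestronglyMeasurable (ρ ^ (-s)) ?_
    · exact ((measure_mono sdiff_subset).trans_lt (surfaceMeasure_frontier_lt_top hΩo hΩb hΩ))
    · filter_upwards [ae_restrict_mem (hfm.diff c.isOpen_cyl.measurableSet)] with y hy
      have h1 : ρ ≤ ‖x - y‖ := by
        by_contra! h
        refine hy.2 (hball ?_)
        rwa [Metric.mem_ball, dist_comm, dist_eq_norm]
      rw [Real.norm_of_nonneg (by positivity)]
      exact Real.rpow_le_rpow_of_nonpos hρ h1 (by linarith)

end DoubleLayer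

namespace DoubleLayer

open MeasureTheory Set Filter Topology

/-! ### The divergence theorem -/

/-- This is integration by parts against the constant function `1`. -/
theorem integral_fderiv_eq_zero {V : Type*} [NormedAddCommGroup V] [NormedSpace ℝ V]
    [FiniteDimensional ℝ V] [MeasurableSpace V] [BorelSpace V] (μ : Measure V) [μ.IsAddHaarMeasure]
    {H : V → ℂ} (hH : Differentiable ℝ H) (w : V) (hi : Integrable H μ)
    (hi' : Integrable (fun x => fderiv ℝ H x w) μ) : ∫ x, fderiv ℝ H x w ∂μ = 0 := by
  have := integral_mul_fderiv_eq_neg_fderiv_mul_of_integrable (μ := μ) (𝕜 := ℂ) (f := fun _ : V => (1 : ℂ))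
    (g := H) (v := w) (by simp) (by simpa using hi') (by simpa using hi)
    (fun x _ => differentiableAt_const _) (fun x _ => hH x)
  simpa using this

/-! ### The divergence theorem on a hypograph -/

section Shear

/-- The shear `(η, s) ↦ (η, s + γ η)` flattens the hypograph. As `γ` and `a` are controlled only on
`U`, continuity at the other points comes from the vanishing of `f` near the corresponding fibres.
-/
theorem continuous_shear {V : Type*} [NormedAddCommGroup V] {f : V × ℝ → ℂ} (hf : Continuous f) (hfc : HasCompactSupport f) {U : Set V}
    (hU : IsOpen U) (hfU : ∀ q ∈ tsupport f, q.1 ∈ U) {γ : V → ℝ} (hγ : ContinuousOn γ U)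
    {a : V → ℂ} (ha : ContinuousOn a U) :
    Continuous (fun q : V × ℝ => f (q.1, q.2 + γ q.1) * a q.1) ∧
      HasCompactSupport (fun q : V × ℝ => f (q.1, q.2 + γ q.1) * a q.1) := by
  have hK : IsCompact (Prod.fst '' tsupport f) := hfc.isCompact.image continuous_fst
  constructor
  · rw [continuous_iff_continuousAt]
    intro q
    by_cases hq : q.1 ∈ U
    · have h1 : ContinuousAt (fun q : V × ℝ => γ q.1) q :=
        (hγ.continuousAt (hU.mem_nhds hq)).comp continuous_fst.continuousAt
      have h2 : ContinuousAt (fun q : V × ℝ => a q.1) q :=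
        (ha.continuousAt (hU.mem_nhds hq)).comp continuous_fst.continuousAt
      refine ContinuousAt.mul ?_ h2
      exact hf.continuousAt.comp (continuous_fst.continuousAt.prodMk
        (continuous_snd.continuousAt.add h1))
    · have h1 : q.1 ∉ Prod.fst '' tsupport f := by
        rintro ⟨q', hq', he⟩
        exact hq (he ▸ hfU q' hq')
      have h2 : ∀ᶠ q' in 𝓝 q, f (q'.1, q'.2 + γ q'.1) * a q'.1 = 0 := by
        filter_upwards [continuous_fst.continuousAt.eventually (hK.isClosed.isOpen_compl.mem_nhds h1)]
          with q' hq'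
        rw [image_eq_zero_of_notMem_tsupport (f := f), zero_mul]
        exact fun h => hq' ⟨_, h, rfl⟩
      exact continuousAt_const.congr (f := fun _ => (0 : ℂ)) (h2.mono fun _ h => h.symm)
  · have hc : ContinuousOn (fun q : V × ℝ => (q.1, q.2 - γ q.1)) (tsupport f) :=
      continuousOn_fst.prodMk (continuousOn_snd.sub (hγ.comp continuousOn_fst hfU))
    refine HasCompactSupport.intro (hfc.isCompact.image_of_continuousOn hc) fun q hq => ?_
    rw [image_eq_zero_of_notMem_tsupport (f := f), zero_mul]
    exact fun h => hq ⟨_, h, by simp⟩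

/-- After the substitution `t = s + γ η` the derivative of `G` along `(w, τ)` splits in two. `P1` is
the derivative along `w`, at fixed `s`, of the sheared function, and integrates to zero over `V`.
`P2` is `τ - γ'(η)w` times the vertical derivative, and its integral over `s ≤ 0` is the boundary
value. -/
theorem integral_hypograph {V : Type*} [NormedAddCommGroup V] [NormedSpace ℝ V] [FiniteDimensional ℝ V] [MeasureSpace V] [BorelSpace V]
    [(volume : Measure V).IsAddHaarMeasure] {G : V × ℝ → ℂ} (hG : ContDiff ℝ 1 G)
    (hGc : HasCompactSupport G) {U : Set V} (hU : IsOpen U) (hGU : ∀ q ∈ tsupport G, q.1 ∈ U)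
    {γ : V → ℝ} (hγ : DifferentiableOn ℝ γ U) (hγ' : ContinuousOn (fderiv ℝ γ) U) (w : V) (τ : ℝ) :
    ∫ η, ∫ t in Iio (γ η), fderiv ℝ G (η, t) (w, τ) =
      ∫ η, G (η, γ η) * ((τ - fderiv ℝ γ η w : ℝ) : ℂ) := by
  have hd : ∀ q, HasFDerivAt G (fderiv ℝ G q) q := fun q =>
    (hG.differentiable one_ne_zero q).hasFDerivAt
  have hc : ∀ v : V × ℝ, Continuous (fun q => fderiv ℝ G q v) := fun v =>
    (hG.continuous_fderiv one_ne_zero).clm_apply continuous_const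
  have hcs : ∀ v : V × ℝ, HasCompactSupport (fun q => fderiv ℝ G q v) := fun v =>
    hGc.fderiv_apply (𝕜 := ℝ) v
  have hcU : ∀ v : V × ℝ, ∀ q ∈ tsupport (fun q => fderiv ℝ G q v), q.1 ∈ U := fun v q hq =>
    hGU q (tsupport_fderiv_apply_subset ℝ v hq)
  have hγc := hγ.continuousOn
  have haw : ContinuousOn (fun η => ((fderiv ℝ γ η w : ℝ) : ℂ)) U :=
    Complex.continuous_ofReal.comp_continuousOn (hγ'.clm_apply continuousOn_const)
  have haτ : ContinuousOn (fun η => ((τ - fderiv ℝ γ η w : ℝ) : ℂ)) U :=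
    Complex.continuous_ofReal.comp_continuousOn
      (continuousOn_const.sub (hγ'.clm_apply continuousOn_const))
  obtain ⟨c1, s1⟩ := continuous_shear (hc (w, 0)) (hcs _) hU (hcU _) hγc
    (continuousOn_const (c := (1 : ℂ)))
  obtain ⟨c2, s2⟩ := continuous_shear (hc (0, 1)) (hcs _) hU (hcU _) hγc haw
  obtain ⟨c3, s3⟩ := continuous_shear (hc (0, 1)) (hcs _) hU (hcU _) hγc haτ
  obtain ⟨c4, s4⟩ := continuous_shear hG.continuous hGc hU hGU hγc (continuousOn_const (c := (1 : ℂ)))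
  set P1 : V × ℝ → ℂ := fun q => fderiv ℝ G (q.1, q.2 + γ q.1) (w, 0) * 1 +
    fderiv ℝ G (q.1, q.2 + γ q.1) (0, 1) * ((fderiv ℝ γ q.1 w : ℝ) : ℂ) with hP1
  set P2 : V × ℝ → ℂ := fun q =>
    fderiv ℝ G (q.1, q.2 + γ q.1) (0, 1) * ((τ - fderiv ℝ γ q.1 w : ℝ) : ℂ) with hP2
  have cP1 : Continuous P1 := c1.add c2
  have sP1 : HasCompactSupport P1 := s1.add s2
  have hslice : ∀ (P : V × ℝ → ℂ), Continuous P → HasCompactSupport P → ∀ η,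
      Continuous (fun s => P (η, s)) ∧ HasCompactSupport (fun s => P (η, s)) := by
    intro P hP hPc η
    refine ⟨hP.comp (continuous_const.prodMk continuous_id), ?_⟩
    refine HasCompactSupport.intro (hPc.isCompact.image continuous_snd) fun s hs => ?_
    exact image_eq_zero_of_notMem_tsupport fun h => hs ⟨_, h, rfl⟩
  have hslice' : ∀ (P : V × ℝ → ℂ), Continuous P → HasCompactSupport P → ∀ s,
      Continuous (fun η => P (η, s)) ∧ HasCompactSupport (fun η => P (η, s)) := by
    intro P hP hPc s
    refine ⟨hP.comp (continuous_id.prodMk continuous_const), ?_⟩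
    refine HasCompactSupport.intro (hPc.isCompact.image continuous_fst) fun s hs => ?_
    exact image_eq_zero_of_notMem_tsupport fun h => hs ⟨_, h, rfl⟩
  have hint : ∀ (P : V × ℝ → ℂ), Continuous P → HasCompactSupport P →
      Integrable P (volume.prod (volume.restrict (Iic (0 : ℝ)))) := by
    intro P hP hPc
    have : Integrable P (volume.prod volume) := hP.integrable_of_hasCompactSupport hPc
    refine this.mono_measure ?_
    exact Measure.prod_mono le_rfl Measure.restrict_le_self
  have hshift : ∀ η, ∫ t in Iio (γ η), fderiv ℝ G (η, t) (w, τ) =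
      ∫ s in Iic (0 : ℝ), (P1 (η, s) + P2 (η, s)) := by
    intro η
    rw [integral_Iic_eq_integral_Iio, ← integral_indicator measurableSet_Iio,
      ← integral_indicator measurableSet_Iio,
      ← integral_add_right_eq_self (μ := volume) (fun t => (Iio (γ η)).indicator _ t) (γ η)]
    congr 1 with s
    have hmem : s + γ η ∈ Iio (γ η) ↔ s ∈ Iio (0 : ℝ) := by simp
    by_cases h : s ∈ Iio (0 : ℝ)
    · rw [indicator_of_mem (hmem.mpr h), indicator_of_mem h, hP1, hP2]
      have : ((w, τ) : V × ℝ) = (w, 0) + τ • (0, 1) := by simp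
      rw [this, map_add, map_smul, Complex.real_smul]
      push_cast
      ring
    · rw [indicator_of_notMem (fun h' => h (hmem.mp h')), indicator_of_notMem h]
  have hP1z : ∀ s, ∫ η, P1 (η, s) = 0 := by
    intro s
    classical
    set H : V → ℂ := fun η => G (η, s + γ η) with hH
    -- Off `U` the function `γ` need not be differentiable, but there `H` vanishes in a
    -- neighbourhood, whence the two cases.
    have hHd : ∀ η, HasFDerivAt H (if η ∈ U then (fderiv ℝ G (η, s + γ η)).comp
        ((ContinuousLinearMap.id ℝ V).prod (fderiv ℝ γ η)) else 0) η := by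
      intro η
      by_cases hη : η ∈ U
      · rw [if_pos hη]
        have h1 : HasFDerivAt γ (fderiv ℝ γ η) η :=
          (hγ.differentiableAt (hU.mem_nhds hη)).hasFDerivAt
        exact (hd _).comp η ((hasFDerivAt_id η).prodMk (h1.const_add s))
      · rw [if_neg hη]
        have hK : IsCompact (Prod.fst '' tsupport G) := hGc.isCompact.image continuous_fst
        have h1 : η ∉ Prod.fst '' tsupport G := by
          rintro ⟨q', hq', he⟩
          exact hη (he ▸ hGU q' hq')
        refine (hasFDerivAt_const (0 : ℂ) η).congr_of_eventuallyEq ?_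
        filter_upwards [hK.isClosed.isOpen_compl.mem_nhds h1] with q' hq'
        exact image_eq_zero_of_notMem_tsupport (f := G) (x := (q', s + γ q')) fun h => hq' ⟨_, h, rfl⟩
    have hHP : ∀ η, fderiv ℝ H η w = P1 (η, s) := by
      intro η
      rw [(hHd η).fderiv]
      by_cases hη : η ∈ U
      · rw [if_pos hη, hP1]
        have : ((w, fderiv ℝ γ η w) : V × ℝ) = (w, 0) + (fderiv ℝ γ η w) • (0, 1) := by simp
        simp only [ContinuousLinearMap.comp_apply, ContinuousLinearMap.prod_apply,
          ContinuousLinearMap.id_apply]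
        rw [this, map_add, map_smul, Complex.real_smul]
        ring
      · rw [if_neg hη]
        have hz : ∀ v, fderiv ℝ G (η, s + γ η) v = 0 := fun v =>
          image_eq_zero_of_notMem_tsupport (f := fun q => fderiv ℝ G q v) fun h => hη (hcU v _ h)
        simp [hP1, hz]
    have h0 := integral_fderiv_eq_zero volume (fun η => (hHd η).differentiableAt) w (H := H) ?_ ?_
    · rw [← h0]; exact integral_congr_ae (Eventually.of_forall fun η => (hHP η).symm)
    · obtain ⟨h1, h2⟩ := hslice' _ c4 s4 s
      simpa using h1.integrable_of_hasCompactSupport h2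
    · simp only [hHP]
      obtain ⟨h1, h2⟩ := hslice' _ cP1 sP1 s
      exact h1.integrable_of_hasCompactSupport h2
  have hP2z : ∀ η, ∫ s in Iic (0 : ℝ), P2 (η, s) = G (η, γ η) * ((τ - fderiv ℝ γ η w : ℝ) : ℂ) := by
    intro η
    change ∫ s in Iic (0 : ℝ), fderiv ℝ G (η, s + γ η) (0, 1) * ((τ - fderiv ℝ γ η w : ℝ) : ℂ) = _
    rw [integral_mul_const]
    congr 1
    have h1 : ContDiff ℝ 1 (fun s : ℝ => G (η, s + γ η)) :=
      hG.comp (contDiff_const.prodMk (contDiff_id.add contDiff_const))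
    have h2 : HasCompactSupport (fun s : ℝ => G (η, s + γ η)) := by
      refine HasCompactSupport.intro (K := (fun q : V × ℝ => q.2 - γ η) '' tsupport G)
        (hGc.isCompact.image (by fun_prop)) fun s hs => ?_
      exact image_eq_zero_of_notMem_tsupport fun h => hs ⟨_, h, by simp⟩
    have h3 := h2.integral_Iic_deriv_eq h1 0
    rw [zero_add] at h3
    rw [← h3]
    congr 1 with s
    have : HasDerivAt (fun s : ℝ => (η, s + γ η)) ((0 : V), (1 : ℝ)) s :=
      (hasDerivAt_const s η).prodMk ((hasDerivAt_id s).add_const _)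
    exact ((hd (η, s + γ η)).comp_hasDerivAt s this).deriv.symm
  simp_rw [hshift]
  have hadd : ∀ η, ∫ s in Iic (0 : ℝ), (P1 (η, s) + P2 (η, s)) =
      (∫ s in Iic (0 : ℝ), P1 (η, s)) + G (η, γ η) * ((τ - fderiv ℝ γ η w : ℝ) : ℂ) := by
    intro η
    rw [← hP2z, integral_add]
    · obtain ⟨h1, h2⟩ := hslice _ cP1 sP1 η
      exact (h1.integrable_of_hasCompactSupport h2).integrableOn
    · obtain ⟨h1, h2⟩ := hslice _ c3 s3 η
      exact (h1.integrable_of_hasCompactSupport h2).integrableOn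
  simp_rw [hadd]
  rw [integral_add, integral_integral_swap (f := fun η s => P1 (η, s)) (hint _ cP1 sP1)]
  · simp [hP1z]
  · exact (hint _ cP1 sP1).integral_prod_left
  · have := (hint _ c3 s3).integral_prod_left
    refine this.congr (Eventually.of_forall hP2z)

end Shear

/-! ### Localization of the divergence theorem -/

theorem continuousOn_mul_inner_outerNormal {n : ℕ} {Ω : Set (E n)} (hΩo : IsOpen Ω)
    (hΩ : IsC11Domain Ω) {g : E n → ℂ} (hg : ContinuousOn g (frontier Ω)) (e : E n) :
    ContinuousOn (fun y => g y * (inner ℝ e (outerNormal Ω y) : ℂ)) (frontier Ω) :=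
  hg.mul (Complex.continuous_ofReal.comp_continuousOn
    (continuousOn_const.inner (continuousOn_outerNormal hΩo hΩ)))

/-- In the coordinates of the cylinder this is `integral_hypograph`: the area density cancels the
normalizing factor of the unit normal, which leaves exactly `τ - γ'(η)w`. -/
theorem CoordCylinder.integral_fderiv {n : ℕ} {Ω : Set (E n)} {p : E n} (c : CoordCylinder Ω p)
    (hΩo : IsOpen Ω) (hΩ : IsC11Domain Ω) (hc : c.IsC11) {g : E n → ℂ} (hg : ContDiff ℝ 1 g)
    (hgc : HasCompactSupport g) (hgs : tsupport g ⊆ c.cyl) (e : E n) :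
    ∫ z in Ω, fderiv ℝ g z e =
      ∫ y in frontier Ω, g y * (inner ℝ e (outerNormal Ω y) : ℂ) ∂(surfaceMeasure n) := by
  set L : (E (n - 1) × ℝ) ≃L[ℝ] E n := (WithLp.prodContinuousLinearEquiv 2 ℝ _ _).symm.trans
    c.R.symm.toContinuousLinearEquiv with hLdef
  have hL : ∀ q : E (n - 1) × ℝ, c.pt q.1 q.2 = p + L q := fun q => rfl
  set φ : (E (n - 1) × ℝ) ≃ₜ E n := L.toHomeomorph.trans (Homeomorph.addLeft p) with hφdef
  have hφ : ∀ q, φ q = c.pt q.1 q.2 := fun q => rfl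
  set G : E (n - 1) × ℝ → ℂ := g ∘ φ with hGdef
  have hG : ContDiff ℝ 1 G := hg.comp (contDiff_const.add L.contDiff)
  have hGc : HasCompactSupport G := hgc.comp_homeomorph φ
  have hGs : ∀ q ∈ tsupport G, q.1 ∈ Metric.ball (0 : E (n - 1)) c.r := by
    intro q hq
    rw [hGdef, tsupport_comp_eq_preimage] at hq
    have := hgs hq
    rw [hφ, c.mem_cyl_pt] at this
    exact this.1
  set w := (c.R e).fst with hw
  set τ := (c.R e).snd with hτ
  have hLe : L (w, τ) = e := by
    change c.R.symm (c.R e) = e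
    simp
  have hder : ∀ q, fderiv ℝ G q (w, τ) = fderiv ℝ g (φ q) e := by
    intro q
    have h1 : HasFDerivAt (fun q => p + L q) (L : (E (n - 1) × ℝ) →L[ℝ] E n) q :=
      L.hasFDerivAt.const_add p
    have h2 : HasFDerivAt G ((fderiv ℝ g (φ q)).comp (L : (E (n - 1) × ℝ) →L[ℝ] E n)) q :=
      (hg.differentiable one_ne_zero _).hasFDerivAt.comp q h1
    rw [h2.fderiv, ContinuousLinearMap.comp_apply]
    exact congrArg _ hLe
  have hmain := integral_hypograph hG hGc Metric.isOpen_ball hGs hc.1 (c.continuousOn_fderiv_γ hc) w τ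
  have hlhs : ∫ z in Ω, fderiv ℝ g z e = ∫ η, ∫ t in Iio (c.γ η), fderiv ℝ G (η, t) (w, τ) := by
    have hcont : Continuous (fun z => fderiv ℝ g z e) :=
      (hg.continuous_fderiv one_ne_zero).clm_apply continuous_const
    have hi : Integrable (Ω.indicator fun z => fderiv ℝ g z e) volume :=
      (hcont.integrable_of_hasCompactSupport (hgc.fderiv_apply (𝕜 := ℝ) e)).indicator
        hΩo.measurableSet
    have hmp : MeasurePreserving φ (volume : Measure (E (n - 1) × ℝ)) volume := c.measurePreserving_pt
    rw [← integral_indicator hΩo.measurableSet, ← hmp.integral_comp φ.measurableEmbedding,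
      Measure.volume_eq_prod, integral_prod]
    · congr 1 with η
      rw [← integral_indicator measurableSet_Iio]
      congr 1 with t
      classical
      by_cases hz : φ (η, t) ∈ tsupport g
      · have hcyl := hgs hz
        have h1 := c.mem_iff_coord hcyl
        rw [hφ, c.coord_pt] at h1
        have h2 : φ (η, t) ∈ Ω ↔ t ∈ Iio (c.γ η) := h1
        by_cases h : φ (η, t) ∈ Ω
        · rw [indicator_of_mem h, indicator_of_mem (h2.mp h), hder]
        · rw [indicator_of_notMem h, indicator_of_notMem fun h' => h (h2.mpr h')]
      · have h0 : fderiv ℝ g (φ (η, t)) e = 0 := by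
          rw [image_eq_zero_of_notMem_tsupport (f := fderiv ℝ g)
            fun h => hz (tsupport_fderiv_subset ℝ h)]
          rfl
        rw [indicator_apply, indicator_apply, hder, h0, ite_self, ite_self]
    · have := (hmp.integrable_comp_emb φ.measurableEmbedding).mpr hi
      exact this
  rw [hlhs, hmain]
  have hfm : MeasurableSet (frontier Ω) := isClosed_frontier.measurableSet
  have hcn := continuousOn_mul_inner_outerNormal hΩo hΩ (hg.continuous.continuousOn) e
  rw [setIntegral_eq_of_subset_of_forall_sdiff_eq_zero (s := frontier Ω ∩ c.cyl) hfm inter_subset_left,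
    c.integral_frontier_cyl hΩo hc ((hcn.mono inter_subset_left).aestronglyMeasurable
      (hfm.inter c.isOpen_cyl.measurableSet)),
    ← setIntegral_eq_integral_of_forall_compl_eq_zero (s := Metric.ball 0 c.r)]
  · refine setIntegral_congr_fun Metric.isOpen_ball.measurableSet fun η hη => ?_
    have hd : (c.dens η : ℂ) ≠ 0 := by exact_mod_cast (c.dens_pos η).ne'
    change G (η, c.γ η) * _ = c.dens η • (g (c.param η) * _)
    rw [c.outerNormal_param hc hη, c.inner_normal, Complex.real_smul]
    change g (c.param η) * _ = _
    push_cast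
    field_simp
    rfl
  · intro η hη
    rw [image_eq_zero_of_notMem_tsupport (f := G) (x := (η, c.γ η)) fun h => hη (hGs (η, c.γ η) h),
      zero_mul]
  · intro y hy
    rw [image_eq_zero_of_notMem_tsupport (f := g) (x := y) fun h => hy.2 ⟨hy.1, hgs h⟩, zero_mul]

/-- Both sides vanish: the left one as the integral over the whole space of a compactly supported
derivative, the right one because `g` is zero on the boundary. -/
theorem integral_fderiv_of_tsupport_subset {n : ℕ} {Ω : Set (E n)} (hΩo : IsOpen Ω) {g : E n → ℂ}
    (hg : ContDiff ℝ 1 g) (hgc : HasCompactSupport g) (hgs : tsupport g ⊆ Ω) (e : E n) :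
    ∫ z in Ω, fderiv ℝ g z e =
      ∫ y in frontier Ω, g y * (inner ℝ e (outerNormal Ω y) : ℂ) ∂(surfaceMeasure n) := by
  rw [setIntegral_eq_integral_of_forall_compl_eq_zero, integral_fderiv_eq_zero volume
    (hg.differentiable one_ne_zero) e (hg.continuous.integrable_of_hasCompactSupport hgc)
    (((hg.continuous_fderiv one_ne_zero).clm_apply continuous_const).integrable_of_hasCompactSupport
      (hgc.fderiv_apply (𝕜 := ℝ) e)), setIntegral_eq_zero_of_forall_eq_zero]
  · intro y hy
    rw [hΩo.frontier_eq] at hy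
    rw [image_eq_zero_of_notMem_tsupport (f := g) fun h => hy.2 (hgs h), zero_mul]
  · intro z hz
    rw [image_eq_zero_of_notMem_tsupport (f := fderiv ℝ g)
      fun h => hz (hgs (tsupport_fderiv_subset ℝ h))]
    rfl

/-- The divergence theorem on a bounded open set of class `C^{1,1}`. -/
theorem integral_fderiv_eq_integral_frontier {n : ℕ} {Ω : Set (E n)} (hΩo : IsOpen Ω)
    (hΩb : Bornology.IsBounded Ω) (hΩ : IsC11Domain Ω) {g : E n → ℂ} (hg : ContDiff ℝ 1 g) (e : E n) :
    ∫ z in Ω, fderiv ℝ g z e =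
      ∫ y in frontier Ω, g y * (inner ℝ e (outerNormal Ω y) : ℂ) ∂(surfaceMeasure n) := by
  have hK : IsCompact (closure Ω) :=
    Metric.isCompact_of_isClosed_isBounded isClosed_closure hΩb.closure
  have hloc : ∀ x ∈ closure Ω, ∃ U : Set (E n), IsOpen U ∧ x ∈ U ∧ Bornology.IsBounded U ∧
      ∀ g : E n → ℂ, ContDiff ℝ 1 g → tsupport g ⊆ U → ∫ z in Ω, fderiv ℝ g z e =
        ∫ y in frontier Ω, g y * (inner ℝ e (outerNormal Ω y) : ℂ) ∂(surfaceMeasure n) := by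
    intro x hx
    have hcpt : ∀ (V : Set (E n)) (g : E n → ℂ), tsupport g ⊆ V ∩ Metric.ball x 1 →
        HasCompactSupport g := fun V g hgs =>
      Metric.isCompact_of_isClosed_isBounded (isClosed_tsupport g)
        (Metric.isBounded_ball.subset (hgs.trans inter_subset_right))
    by_cases hxΩ : x ∈ Ω
    · refine ⟨Ω ∩ Metric.ball x 1, hΩo.inter Metric.isOpen_ball, ⟨hxΩ, Metric.mem_ball_self one_pos⟩,
        Metric.isBounded_ball.subset inter_subset_right, fun g hg hgs => ?_⟩
      exact integral_fderiv_of_tsupport_subset hΩo hg (hcpt _ g hgs) (hgs.trans inter_subset_left) e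
    · have hxf : x ∈ frontier Ω := by rw [hΩo.frontier_eq]; exact ⟨hx, hxΩ⟩
      obtain ⟨c, hc⟩ := hΩ x hxf
      refine ⟨c.cyl ∩ Metric.ball x 1, c.isOpen_cyl.inter Metric.isOpen_ball,
        ⟨c.center_mem_cyl, Metric.mem_ball_self one_pos⟩,
        Metric.isBounded_ball.subset inter_subset_right, fun g hg hgs => ?_⟩
      exact c.integral_fderiv hΩo hΩ hc hg (hcpt _ g hgs) (hgs.trans inter_subset_left) e
  choose! U hUo hxU hUb hU using hloc
  obtain ⟨t, htc⟩ := hK.elim_nhds_subcover' (fun x _ => U x)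
    fun x hx => (hUo x hx).mem_nhds (hxU x hx)
  obtain ⟨f, hf⟩ := SmoothPartitionOfUnity.exists_isSubordinate (modelWithCornersSelf ℝ (E n))
    (isClosed_closure (s := Ω)) (fun i : t => U i.1) (fun i => hUo _ i.1.2)
    (by
      intro x hx
      obtain ⟨i, hi, hxi⟩ := mem_iUnion₂.mp (htc hx)
      exact mem_iUnion.mpr ⟨⟨i, hi⟩, hxi⟩)
  -- The partition sums to one only on `closure Ω`. This suffices: it contains a neighbourhood of
  -- each point of `Ω`, where derivatives are compared, and the boundary, where only values are.
  have hsum : ∀ x ∈ closure Ω, ∑ i : t, f i x = 1 := fun x hx => by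
    rw [← f.sum_eq_one hx, finsum_eq_sum_of_fintype]
  set gi : t → E n → ℂ := fun i x => (f i x : ℂ) * g x with hgi
  have hfi : ∀ i, ContDiff ℝ 1 (fun x => ((f i x : ℝ) : ℂ)) := fun i =>
    Complex.ofRealCLM.contDiff.comp ((f i).contMDiff.contDiff.of_le (by simp))
  have hgid : ∀ i, ContDiff ℝ 1 (gi i) := fun i => (hfi i).mul hg
  have hgis : ∀ i, tsupport (gi i) ⊆ U i.1 := fun i => by
    refine (closure_mono ?_).trans (hf i)
    intro x hx h0
    exact hx (by simp only [hgi, h0, Complex.ofReal_zero, zero_mul])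
  have hgic : ∀ i, HasCompactSupport (gi i) := fun i =>
    Metric.isCompact_of_isClosed_isBounded (isClosed_tsupport _)
      ((hUb _ i.1.2).subset (hgis i))
  have hfin := surfaceMeasure_frontier_lt_top hΩo hΩb hΩ
  have hKf : IsCompact (frontier Ω) := hK.of_isClosed_subset isClosed_frontier frontier_subset_closure
  have h1 : ∫ z in Ω, fderiv ℝ g z e = ∫ z in Ω, ∑ i, fderiv ℝ (gi i) z e := by
    refine setIntegral_congr_fun hΩo.measurableSet fun z hz => ?_
    have hev : g =ᶠ[𝓝 z] fun x => ∑ i, gi i x := by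
      filter_upwards [hΩo.mem_nhds hz] with x hx
      simp only [hgi, ← Finset.sum_mul]
      rw [← Complex.ofReal_sum, hsum x (subset_closure hx), Complex.ofReal_one, one_mul]
    change fderiv ℝ g z e = ∑ i, fderiv ℝ (gi i) z e
    rw [hev.fderiv_eq, fderiv_fun_sum fun i _ => (hgid i).differentiable one_ne_zero z,
      sum_apply]
  have h2 : ∫ y in frontier Ω, g y * (inner ℝ e (outerNormal Ω y) : ℂ) ∂(surfaceMeasure n) =
      ∫ y in frontier Ω, ∑ i, gi i y * (inner ℝ e (outerNormal Ω y) : ℂ) ∂(surfaceMeasure n) := by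
    refine setIntegral_congr_fun isClosed_frontier.measurableSet fun y hy => ?_
    rw [← Finset.sum_mul]
    congr 1
    simp only [hgi, ← Finset.sum_mul]
    rw [← Complex.ofReal_sum, hsum y (frontier_subset_closure hy), Complex.ofReal_one, one_mul]
  rw [h1, h2, integral_finsetSum, integral_finsetSum]
  · exact Finset.sum_congr rfl fun i _ => hU _ i.1.2 _ (hgid i) (hgis i)
  · intro i _
    have hco := continuousOn_mul_inner_outerNormal hΩo hΩ (hgid i).continuous.continuousOn e
    obtain ⟨C, hC⟩ := hKf.exists_bound_of_continuousOn hco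
    refine IntegrableOn.of_bound hfin (hco.aestronglyMeasurable isClosed_frontier.measurableSet) C ?_
    filter_upwards [ae_restrict_mem isClosed_frontier.measurableSet] with y hy using hC y hy
  · intro i _
    exact ((((hgid i).continuous_fderiv one_ne_zero).clm_apply
      continuous_const).integrable_of_hasCompactSupport ((hgic i).fderiv_apply (𝕜 := ℝ) e)).integrableOn

end DoubleLayer

namespace DoubleLayer

open MeasureTheory Set Filter Topology

/-! ### The heat kernel of the operator -/

/-- The constant is the minimum of the quadratic form on the unit sphere, extended by homogeneity.
The sphere is empty only in dimension `0`, which is treated apart. -/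
theorem exists_pos_mul_norm_sq_le {n : ℕ} (B : Matrix (Fin n) (Fin n) ℝ) (hB : B.PosDef) :
    ∃ m : ℝ, 0 < m ∧ ∀ x : E n, m * ‖x‖ ^ 2 ≤ ∑ j, ∑ k, B j k * x k * x j := by
  set Q : E n → ℝ := fun x => ∑ j, ∑ k, B j k * x k * x j with hQ
  have hQc : Continuous Q := by fun_prop
  have hpos : ∀ x : E n, x ≠ 0 → 0 < Q x := by
    intro x hx
    have hx' : WithLp.ofLp x ≠ 0 := fun h => hx (by ext i; exact congrFun h i)
    have := hB.dotProduct_mulVec_pos hx'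
    simp only [dotProduct, Matrix.mulVec, star_trivial] at this
    refine this.trans_eq (Finset.sum_congr rfl fun j _ => ?_)
    rw [Finset.mul_sum]
    exact Finset.sum_congr rfl fun k _ => by ring
  have hhom : ∀ (r : ℝ) (x : E n), Q (r • x) = r ^ 2 * Q x := by
    intro r x
    simp only [hQ, PiLp.smul_apply, smul_eq_mul, Finset.mul_sum]
    exact Finset.sum_congr rfl fun j _ => Finset.sum_congr rfl fun k _ => by ring
  rcases (Metric.sphere (0 : E n) 1).eq_empty_or_nonempty with he | hne
  · refine ⟨1, one_pos, fun x => ?_⟩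
    by_cases hx : x = 0
    · simp [hx]
    · exfalso
      have : ‖x‖⁻¹ • x ∈ Metric.sphere (0 : E n) 1 := by
        rw [mem_sphere_zero_iff_norm, norm_smul, norm_inv, norm_norm,
          inv_mul_cancel₀ (norm_ne_zero_iff.mpr hx)]
      rw [he] at this
      exact this
  · obtain ⟨x0, hx0, hmin⟩ := (isCompact_sphere (0 : E n) 1).exists_isMinOn hne hQc.continuousOn
    have hx0' : x0 ≠ 0 := by
      rintro rfl
      simp at hx0
    refine ⟨Q x0, hpos x0 hx0', fun x => ?_⟩
    by_cases hx : x = 0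
    · simp [hx]
    · have hn : ‖x‖ ≠ 0 := norm_ne_zero_iff.mpr hx
      have hs : ‖x‖⁻¹ • x ∈ Metric.sphere (0 : E n) 1 := by
        rw [mem_sphere_zero_iff_norm, norm_smul, norm_inv, norm_norm, inv_mul_cancel₀ hn]
      have h1 : Q x0 ≤ Q (‖x‖⁻¹ • x) := hmin hs
      rw [hhom] at h1
      have h2 : 0 < ‖x‖ ^ 2 := by positivity
      calc Q x0 * ‖x‖ ^ 2 ≤ (‖x‖⁻¹ ^ 2 * Q x) * ‖x‖ ^ 2 := by gcongr
        _ = Q x := by field_simp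

/-- The inverse of the principal part, with a lower bound for its quadratic form. -/
structure HeatData {n : ℕ} (a : Coeffs n) where
  B : Matrix (Fin n) (Fin n) ℝ
  symm : ∀ j k, B j k = B k j
  mul_eq : ∀ l k, ∑ j, a.a2 l j * (B j k : ℂ) = if l = k then 1 else 0
  m : ℝ
  m_pos : 0 < m
  le_quad : ∀ x : E n, 4 * m * ‖x‖ ^ 2 ≤ ∑ j, ∑ k, B j k * x k * x j

theorem exists_heatData {n : ℕ} (a : Coeffs n) (ha : a.IsElliptic) (har : a.HasRealPrincipalPart) :
    Nonempty (HeatData a) := by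
  set A : Matrix (Fin n) (Fin n) ℝ := fun l j => (a.a2 l j).re with hA
  have hAc : ∀ l j, a.a2 l j = (A l j : ℂ) := fun l j =>
    Complex.ext rfl (by rw [har l j, Complex.ofReal_im])
  have hAs : A.IsHermitian := by
    ext l j
    change (a.a2 j l).re = (a.a2 l j).re
    rw [a.symm.apply]
  have hpd : A.PosDef := by
    obtain ⟨c, hc, hell⟩ := ha
    refine Matrix.posDef_iff_dotProduct_mulVec.mpr ⟨hAs, fun x hx => ?_⟩
    set y : E n := WithLp.toLp 2 x with hy
    have hy0 : y ≠ 0 := fun h => hx (by ext i; exact congrArg (fun z : E n => z i) h)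
    have hn : ‖y‖ ≠ 0 := norm_ne_zero_iff.mpr hy0
    have h1 := hell (‖y‖⁻¹ • y) (by rw [norm_smul, norm_inv, norm_norm, inv_mul_cancel₀ hn])
    have h2 : (∑ l, ∑ j, a.a2 l j * (((‖y‖⁻¹ • y) l : ℝ) : ℂ) * (((‖y‖⁻¹ • y) j : ℝ) : ℂ)).re =
        ‖y‖⁻¹ ^ 2 * (star x ⬝ᵥ A.mulVec x) := by
      simp only [hAc, ← Complex.ofReal_mul, ← Complex.ofReal_sum, Complex.ofReal_re,
        PiLp.smul_apply, smul_eq_mul, dotProduct, Matrix.mulVec, star_trivial, Finset.mul_sum]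
      exact Finset.sum_congr rfl fun j _ => Finset.sum_congr rfl fun k _ => by
        change _ * (_ * x j) * (_ * x k) = _
        ring
    rw [h2] at h1
    have h3 : 0 < ‖y‖⁻¹ ^ 2 := by positivity
    exact pos_of_mul_pos_right (hc.trans_le h1) h3.le
  obtain ⟨m, hm, hle⟩ := exists_pos_mul_norm_sq_le A⁻¹ hpd.inv
  -- The quarter fits the normalization `4 m ‖x‖² ≤ q x`, chosen so that `q x / (4t) ≥ m ‖x‖² / t`.
  refine ⟨⟨A⁻¹, fun j k => ?_, fun l k => ?_, m / 4, by positivity, fun x => ?_⟩⟩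
  · have := hpd.inv.isHermitian.apply k j
    simpa using this
  · have h1 : A * A⁻¹ = 1 := Matrix.mul_nonsing_inv _ ((Matrix.isUnit_iff_isUnit_det _).mp hpd.isUnit)
    have h2 := congrFun (congrFun h1 l) k
    rw [Matrix.mul_apply, Matrix.one_apply] at h2
    simp only [hAc]
    rw [← Complex.ofReal_one, ← Complex.ofReal_zero, ← apply_ite Complex.ofReal, ← h2]
    push_cast
    rfl
  · rw [show 4 * (m / 4) = m by ring]
    exact hle x

namespace HeatData

variable {n : ℕ} {a : Coeffs n} (D : HeatData a)

/-- The components of the exponential correction absorbing the first order terms. -/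
def β (j : Fin n) : ℂ := (1 / 2) * ∑ k, (D.B j k : ℂ) * a.a1 k

/-- The components of `x ↦ B x`. -/
def Bl (j : Fin n) : E n →L[ℝ] ℝ := ∑ k, D.B j k • EuclideanSpace.proj k

/-- The complex valued coordinate functions. -/
def coordC (j : Fin n) : E n →L[ℝ] ℂ := Complex.ofRealCLM.comp (EuclideanSpace.proj j)

/-- The linear form `x ↦ β ⬝ x`. -/
def bl : E n →L[ℝ] ℂ := ∑ j, D.β j • coordC j

/-- The bilinear form `(x, y) ↦ B x ⬝ y`. -/
def BL : E n →L[ℝ] E n →L[ℝ] ℂ := ∑ j, (D.Bl j).smulRight (coordC j)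

/-- Conjugating the operator with `exp(-β·x)`, where `Aβ = a⁽¹⁾/2`, removes the first order terms
and leaves `κ` as zero order coefficient. -/
def κ : ℂ := a.a0 - (1 / 2) * ∑ j, D.β j * a.a1 j

theorem Bl_apply (j : Fin n) (x : E n) : D.Bl j x = ∑ k, D.B j k * x k := by
  simp [Bl, sum_apply]

@[simp] theorem coordC_apply (j : Fin n) (x : E n) : coordC j x = (x j : ℂ) := rfl

theorem bl_apply (x : E n) : D.bl x = ∑ j, D.β j * (x j : ℂ) := by
  simp [bl, sum_apply]

theorem BL_apply (x y : E n) : D.BL x y = ∑ j, (D.Bl j x : ℂ) * (y j : ℂ) := by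
  simp [BL, sum_apply]

theorem BL_comm (x y : E n) : D.BL x y = D.BL y x := by
  simp only [BL_apply, Bl_apply]
  push_cast
  simp only [Finset.sum_mul]
  rw [Finset.sum_comm]
  refine Finset.sum_congr rfl fun j _ => Finset.sum_congr rfl fun k _ => ?_
  rw [D.symm]
  ring

/-- The quadratic form `q`. -/
def q (x : E n) : ℝ := (D.BL x x).re

theorem q_eq (x : E n) : D.q x = ∑ j, ∑ k, D.B j k * x k * x j := by
  simp only [q, BL_apply, Bl_apply]
  push_cast
  simp [Finset.sum_mul]

theorem ofReal_q (x : E n) : (D.q x : ℂ) = D.BL x x := by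
  rw [q_eq]
  simp only [BL_apply, Bl_apply]
  push_cast
  simp [Finset.sum_mul]

theorem le_q (x : E n) : 4 * D.m * ‖x‖ ^ 2 ≤ D.q x := by
  rw [q_eq]; exact D.le_quad x

theorem continuous_q : Continuous D.q := by
  unfold q; fun_prop

/-- The normalizing constant `1 / ∫ exp(-q/4)`. -/
def c : ℝ := (∫ z : E n, Real.exp (-(D.q z / 4)))⁻¹

/-- The heat kernel. -/
def K (t : ℝ) (x : E n) : ℂ :=
  ((D.c * t ^ (-(n : ℝ) / 2) : ℝ) : ℂ) * Complex.exp (D.κ * t - D.bl x - D.BL x x / (4 * t))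

/-- The logarithmic derivative of the heat kernel. -/
def ℓ (t : ℝ) (x : E n) : E n →L[ℝ] ℂ := -D.bl - (2 * t)⁻¹ • D.BL x

theorem ℓ_apply (t : ℝ) (x v : E n) : D.ℓ t x v = -D.bl v - D.BL x v / (2 * t) := by
  simp [ℓ, div_eq_inv_mul]

theorem hasFDerivAt_K (t : ℝ) (x : E n) : HasFDerivAt (D.K t) (D.K t x • D.ℓ t x) x := by
  have h1 : HasFDerivAt (fun x => D.BL x x) (D.BL x + D.BL.flip x) x := by
    have := D.BL.hasFDerivAt_of_bilinear (hasFDerivAt_id x) (hasFDerivAt_id x)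
    refine this.congr_fderiv ?_
    ext v; simp
  have h2 : HasFDerivAt (fun x => D.κ * t - D.bl x - D.BL x x / (4 * t)) (D.ℓ t x) x := by
    have h3 := ((D.bl.hasFDerivAt (x := x)).const_sub (D.κ * t)).sub (h1.mul_const ((4 * (t : ℂ))⁻¹))
    simp only [← div_eq_mul_inv] at h3
    refine h3.congr_fderiv ?_
    ext v
    rw [ℓ_apply]
    simp only [sub_apply, neg_apply, smul_apply, add_apply,
      ContinuousLinearMap.flip_apply, smul_eq_mul]
    rw [D.BL_comm v x]
    by_cases ht : (t : ℂ) = 0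
    · simp [ht]
    · field_simp
      ring
  have h4 := (h2.cexp.const_mul ((D.c * t ^ (-(n : ℝ) / 2) : ℝ) : ℂ))
  refine h4.congr_fderiv ?_
  rw [smul_smul]
  rfl

theorem contDiff_K (t : ℝ) : ContDiff ℝ ∞ (D.K t) := by
  unfold K
  have h1 : ContDiff ℝ ∞ fun x => D.BL x x := D.BL.isBoundedBilinearMap.contDiff.comp
    (contDiff_id.prodMk contDiff_id)
  refine contDiff_const.mul (ContDiff.cexp ?_)
  refine (contDiff_const.sub D.bl.contDiff).sub ?_
  simp only [div_eq_mul_inv]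
  exact h1.mul contDiff_const

theorem fderiv_K (t : ℝ) : fderiv ℝ (D.K t) = fun x => D.K t x • D.ℓ t x :=
  funext fun x => (D.hasFDerivAt_K t x).fderiv

theorem hasFDerivAt_fderiv_K (t : ℝ) (x : E n) : HasFDerivAt (fderiv ℝ (D.K t))
    (D.K t x • (-((2 * t)⁻¹ • D.BL)) + (D.K t x • D.ℓ t x).smulRight (D.ℓ t x)) x := by
  rw [D.fderiv_K]
  have h1 : HasFDerivAt (D.ℓ t) (-((2 * t)⁻¹ • D.BL)) x := by
    have := ((D.BL.hasFDerivAt (x := x)).const_smul ((2 * t)⁻¹)).const_sub (-D.bl)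
    exact this
  exact (D.hasFDerivAt_K t x).smul h1

/-- The components of `ℓ`. -/
def lin (t : ℝ) (j : Fin n) (x : E n) : ℂ := -D.β j - (D.Bl j x : ℂ) / (2 * t)

theorem ℓ_single (t : ℝ) (x : E n) (j : Fin n) :
    D.ℓ t x (EuclideanSpace.single j 1) = D.lin t j x := by
  rw [ℓ_apply, bl_apply, BL_apply, lin]
  simp [PiLp.single_apply, apply_ite Complex.ofReal]

theorem pd_K (t : ℝ) (j : Fin n) (x : E n) : pd j (D.K t) x = D.K t x * D.lin t j x := by
  rw [pd, (D.hasFDerivAt_K t x).fderiv, ← D.ℓ_single]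
  rfl

theorem pd_pd_K (t : ℝ) (l j : Fin n) (x : E n) :
    pd l (fun z => pd j (D.K t) z) x =
      D.K t x * (D.lin t l x * D.lin t j x - (D.B j l : ℂ) / (2 * t)) := by
  have h1 : HasFDerivAt (fun z => pd j (D.K t) z)
      ((ContinuousLinearMap.apply ℝ ℂ (EuclideanSpace.single j (1 : ℝ))).comp
        (D.K t x • (-((2 * t)⁻¹ • D.BL)) + (D.K t x • D.ℓ t x).smulRight (D.ℓ t x))) x :=
    (ContinuousLinearMap.apply ℝ ℂ (EuclideanSpace.single j (1 : ℝ))).hasFDerivAt.comp x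
      (D.hasFDerivAt_fderiv_K t x)
  rw [pd, h1.fderiv]
  simp only [ContinuousLinearMap.comp_apply, ContinuousLinearMap.apply_apply, add_apply, smul_apply,
    neg_apply, ContinuousLinearMap.smulRight_apply, ℓ_single, BL_apply, Bl_apply, smul_eq_mul]
  simp [PiLp.single_apply, apply_ite Complex.ofReal]
  rw [← D.ℓ_single, ← D.ℓ_single]
  field_simp
  ring

/-- Because `AB = 1`, the conormal gradient `A∇K / K` contains the plain vector `x/(2t)`. The
conormal flux thus sees the Euclidean product `x·ν`, which is small on a `C^{1,1}` boundary. -/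
theorem sum_mul_lin (t : ℝ) (x : E n) (l : Fin n) :
    ∑ j, a.a2 l j * D.lin t j x = -(a.a1 l / 2) - (x l : ℂ) / (2 * t) := by
  have h1 : ∀ v : Fin n → ℂ, ∑ j, a.a2 l j * ∑ k, (D.B j k : ℂ) * v k = v l := by
    intro v
    simp only [Finset.mul_sum]
    rw [Finset.sum_comm]
    have : ∀ k, ∑ j, a.a2 l j * ((D.B j k : ℂ) * v k) = (if l = k then 1 else 0) * v k := by
      intro k
      rw [← D.mul_eq l k, Finset.sum_mul]
      exact Finset.sum_congr rfl fun j _ => by ring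
    simp [this]
  have h2 : ∀ j, a.a2 l j * D.lin t j x = -(1 / 2) * (a.a2 l j * ∑ k, (D.B j k : ℂ) * a.a1 k) -
      (2 * (t : ℂ))⁻¹ * (a.a2 l j * ∑ k, (D.B j k : ℂ) * (x k : ℂ)) := by
    intro j
    rw [lin, β, Bl_apply]
    push_cast
    ring
  simp only [h2]
  rw [Finset.sum_sub_distrib, ← Finset.mul_sum, ← Finset.mul_sum, h1, h1 fun k => (x k : ℂ)]
  ring

/-- `∂_t K`. -/
def Kt (t : ℝ) (x : E n) : ℂ :=
  D.K t x * (D.κ - n / (2 * t) + D.q x / (4 * t ^ 2))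

/-- This is the heat equation `P K = ∂_t K`. The trace of `AB` gives `-n/(2t)`, the square of the
linear part gives `q/(4t²)`, and the terms mixing `x` with `a⁽¹⁾` cancel by the choice of `β` and
the symmetry of `B`. -/
theorem op_K {t : ℝ} (ht : t ≠ 0) (x : E n) : a.op (D.K t) x = D.Kt t x := by
  have ht' : (t : ℂ) ≠ 0 := by exact_mod_cast ht
  have hdiff : ∀ j x, DifferentiableAt ℝ (fun z => pd j (D.K t) z) x := fun j x =>
    ((ContinuousLinearMap.apply ℝ ℂ (EuclideanSpace.single j (1 : ℝ))).hasFDerivAt.comp x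
      (D.hasFDerivAt_fderiv_K t x)).differentiableAt
  have h1 : ∀ l j, pd l (fun z => a.a2 l j * pd j (D.K t) z) x =
      D.K t x * (D.lin t l x * (a.a2 l j * D.lin t j x) - (a.a2 l j * D.B j l) / (2 * t)) := by
    intro l j
    have : pd l (fun z => a.a2 l j * pd j (D.K t) z) x = a.a2 l j * pd l (fun z => pd j (D.K t) z) x := by
      rw [pd, fderiv_const_mul (hdiff j x)]
      rfl
    rw [this, pd_pd_K]
    ring
  have h2 : ∑ l, ∑ j, a.a2 l j * (D.B j l : ℂ) = n := by
    simp [D.mul_eq]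
  have h3 : ∑ j, D.β j * (x j : ℂ) = (1 / 2) * ∑ l, (D.Bl l x : ℂ) * a.a1 l := by
    simp only [β, Bl_apply]
    push_cast
    simp only [Finset.sum_mul, Finset.mul_sum]
    rw [Finset.sum_comm]
    refine Finset.sum_congr rfl fun j _ => Finset.sum_congr rfl fun k _ => ?_
    rw [D.symm]
    ring
  have h4 : ∑ l, D.lin t l x * (-(a.a1 l / 2) - (x l : ℂ) / (2 * t)) + ∑ l, a.a1 l * D.lin t l x =
      -(1 / 2) * ∑ j, D.β j * a.a1 j + D.q x / (4 * t ^ 2) := by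
    rw [ofReal_q, BL_apply, ← Finset.sum_add_distrib]
    have : ∀ l, D.lin t l x * (-(a.a1 l / 2) - (x l : ℂ) / (2 * t)) + a.a1 l * D.lin t l x =
        -(1 / 2) * (D.β l * a.a1 l) + (1 / (2 * t)) * (D.β l * (x l : ℂ)) -
        (1 / (4 * t)) * ((D.Bl l x : ℂ) * a.a1 l) +
          (1 / (4 * t ^ 2)) * ((D.Bl l x : ℂ) * (x l : ℂ)) := by
      intro l
      rw [lin]
      field_simp
      ring
    simp only [this, Finset.sum_add_distrib, Finset.sum_sub_distrib, ← Finset.mul_sum]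
    rw [h3]
    field_simp
    ring
  have h5 : a.op (D.K t) x = D.K t x * ((∑ l, D.lin t l x * (-(a.a1 l / 2) - (x l : ℂ) / (2 * t)) +
      ∑ l, a.a1 l * D.lin t l x) - (∑ l, ∑ j, a.a2 l j * (D.B j l : ℂ)) / (2 * t) + a.a0) := by
    rw [Coeffs.op]
    simp only [h1]
    simp only [pd_K]
    have e1 : ∀ l, ∑ j, D.K t x * (D.lin t l x * (a.a2 l j * D.lin t j x) -
        (a.a2 l j * D.B j l) / (2 * t)) = D.K t x * (D.lin t l x *
          (-(a.a1 l / 2) - (x l : ℂ) / (2 * t))) -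
          D.K t x * ((∑ j, a.a2 l j * (D.B j l : ℂ)) / (2 * t)) := by
      intro l
      rw [← D.sum_mul_lin, ← Finset.mul_sum, Finset.sum_sub_distrib, ← Finset.mul_sum,
        ← Finset.sum_div]
      ring
    have e2 : ∀ l, a.a1 l * (D.K t x * D.lin t l x) = D.K t x * (a.a1 l * D.lin t l x) := fun l => by
      ring
    simp only [e1, e2, Finset.sum_sub_distrib, ← Finset.mul_sum, ← Finset.sum_div]
    ring
  rw [h5, h4, h2, Kt, κ]
  ring

theorem hasDerivAt_K {t : ℝ} (ht : 0 < t) (x : E n) :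
    HasDerivAt (fun t => D.K t x) (D.Kt t x) t := by
  have ht' : (t : ℂ) ≠ 0 := by exact_mod_cast ht.ne'
  have h1 : HasDerivAt (fun t : ℝ => D.c * t ^ (-(n : ℝ) / 2))
      (D.c * ((-(n : ℝ) / 2) * t ^ (-(n : ℝ) / 2 - 1))) t :=
    (Real.hasDerivAt_rpow_const (Or.inl ht.ne')).const_mul _
  have hid : HasDerivAt (fun t : ℝ => (t : ℂ)) 1 t := Complex.ofRealCLM.hasDerivAt
  have h2 : HasDerivAt (fun t : ℝ => D.κ * t - D.bl x - D.BL x x / (4 * t))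
      (D.κ + D.BL x x / (4 * t ^ 2)) t := by
    have := ((hid.const_mul D.κ).sub_const (D.bl x)).sub
      ((hasDerivAt_const t (D.BL x x)).div (hid.const_mul 4) (by simpa using ht'))
    refine this.congr_deriv ?_
    field_simp
    ring
  have h3 := h1.ofReal_comp.mul h2.cexp
  refine h3.congr_deriv ?_
  rw [Kt, K, ofReal_q, Real.rpow_sub_one ht.ne']
  push_cast
  field_simp
  ring

end HeatData

end DoubleLayer

namespace DoubleLayer

open MeasureTheory Set Filter Topology

/-! ### Gaussian bounds -/

/-- An unnormalized Gaussian at time `t`. -/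
def gauss (n : ℕ) (s t : ℝ) (x : E n) : ℝ := t ^ (-(n : ℝ) / 2) * Real.exp (-(s * (‖x‖ ^ 2 / t)))

theorem gauss_nonneg {n : ℕ} {s t : ℝ} (ht : 0 < t) (x : E n) : 0 ≤ gauss n s t x := by
  unfold gauss; positivity

theorem integrable_gauss {n : ℕ} {s t : ℝ} (hs : 0 < s) (ht : 0 < t) :
    Integrable (gauss n s t) := by
  unfold gauss
  refine Integrable.const_mul ?_ _
  have h := GaussianFourier.integrable_cexp_neg_mul_sq_norm_add (V := E n) (b := ((s / t : ℝ) : ℂ))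
    (by rw [Complex.ofReal_re]; positivity) 0 0
  refine h.norm.congr (Eventually.of_forall fun x => ?_)
  simp only [Complex.norm_exp, inner_zero_left]
  congr 1
  simp [← Complex.ofReal_pow]
  ring

theorem integral_gauss {n : ℕ} {s t : ℝ} (hs : 0 < s) (ht : 0 < t) :
    ∫ x, gauss n s t x = (Real.pi / s) ^ ((n : ℝ) / 2) := by
  unfold gauss
  rw [integral_const_mul]
  have h := GaussianFourier.integral_rexp_neg_mul_sq_norm (V := E n) (b := s / t) (by positivity)
  have h2 : ∀ x : E n, -(s * (‖x‖ ^ 2 / t)) = -(s / t) * ‖x‖ ^ 2 := fun x => by ring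
  simp only [h2]
  rw [h, finrank_euclideanSpace, Fintype.card_fin]
  have hpi := Real.pi_pos
  rw [show Real.pi / (s / t) = t * (Real.pi / s) by field_simp, Real.mul_rpow ht.le (by positivity),
    ← mul_assoc, ← Real.rpow_add ht]
  rw [show -(n : ℝ) / 2 + n / 2 = 0 by ring, Real.rpow_zero, one_mul]

/-- With `y = ‖x‖²/t` and `σ = n/2 - 3/4`, the power `t^{-n/2}` equals `t^{-3/4} ‖x‖^{-(n-3/2)}
y^σ`, and the exponential absorbs `y^σ`. The exponents are chosen so that `t^{-3/4}` is integrable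
on `(0,1]` and `n - 3/2 < n - 1` makes the other factor integrable on the boundary. -/
theorem exists_gauss_le {n : ℕ} (hn : 2 ≤ n) {s : ℝ} (hs : 0 < s) :
    ∃ C : ℝ, 0 ≤ C ∧ ∀ t : ℝ, 0 < t → ∀ x : E n, x ≠ 0 →
      gauss n s t x ≤ C * (t ^ (-(3 / 4) : ℝ) * ‖x‖ ^ (-((n : ℝ) - 3 / 2))) := by
  have hn' : (2 : ℝ) ≤ n := by exact_mod_cast hn
  set σ : ℝ := n / 2 - 3 / 4 with hσ
  have hσ0 : 0 < σ := by rw [hσ]; linarith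
  refine ⟨(σ / s) ^ σ, by positivity, fun t ht x hx => ?_⟩
  have hx' : 0 < ‖x‖ := norm_pos_iff.mpr hx
  set y := ‖x‖ ^ 2 / t with hy
  have hy0 : 0 < y := by positivity
  have h1 : y ^ σ ≤ (σ / s) ^ σ * Real.exp (s * y) := by
    have h2 : s * y / σ ≤ Real.exp (s * y / σ) := by
      have := Real.add_one_le_exp (s * y / σ); linarith
    have h3 : (s * y / σ) ^ σ ≤ Real.exp (s * y) := by
      calc _ ≤ Real.exp (s * y / σ) ^ σ := by gcongr
        _ = _ := by rw [← Real.exp_mul]; congr 1; field_simp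
    calc y ^ σ = (σ / s) ^ σ * (s * y / σ) ^ σ := by
          rw [← Real.mul_rpow (by positivity) (by positivity)]
          congr 1
          field_simp
      _ ≤ _ := by gcongr
  have h4 : t ^ (-(n : ℝ) / 2) = t ^ (-(3 / 4) : ℝ) * ‖x‖ ^ (-((n : ℝ) - 3 / 2)) * y ^ σ := by
    rw [hy, Real.div_rpow (by positivity) ht.le, ← Real.rpow_natCast ‖x‖ 2, ← Real.rpow_mul hx'.le]
    rw [div_eq_mul_inv _ (t ^ σ), ← Real.rpow_neg ht.le]
    have e1 : ‖x‖ ^ (-((n : ℝ) - 3 / 2)) * ‖x‖ ^ (((2 : ℕ) : ℝ) * σ) = 1 := by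
      rw [← Real.rpow_add hx', hσ]
      push_cast
      rw [show -((n : ℝ) - 3 / 2) + 2 * (n / 2 - 3 / 4) = 0 by ring, Real.rpow_zero]
    calc t ^ (-(n : ℝ) / 2) = t ^ (-(3 / 4) : ℝ) * t ^ (-σ) := by
          rw [← Real.rpow_add ht, hσ]; congr 1; ring
      _ = t ^ (-(3 / 4) : ℝ) * (‖x‖ ^ (-((n : ℝ) - 3 / 2)) * ‖x‖ ^ (((2 : ℕ) : ℝ) * σ)) * t ^ (-σ) := by
          rw [e1, mul_one]
      _ = _ := by ring
  unfold gauss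
  rw [h4]
  calc t ^ (-(3 / 4) : ℝ) * ‖x‖ ^ (-((n : ℝ) - 3 / 2)) * y ^ σ * Real.exp (-(s * y))
      ≤ t ^ (-(3 / 4) : ℝ) * ‖x‖ ^ (-((n : ℝ) - 3 / 2)) * ((σ / s) ^ σ * Real.exp (s * y)) *
        Real.exp (-(s * y)) := by gcongr
    _ = (σ / s) ^ σ * (t ^ (-(3 / 4) : ℝ) * ‖x‖ ^ (-((n : ℝ) - 3 / 2))) *
        (Real.exp (s * y) * Real.exp (-(s * y))) := by ring
    _ = _ := by rw [← Real.exp_add, add_neg_cancel, Real.exp_zero, mul_one]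

/-- Half of the exponential decay pays for the polynomial factor. -/
theorem one_add_mul_exp_le {m y : ℝ} (hm : 0 < m) (hy : 0 ≤ y) :
    (1 + y) * Real.exp (-(2 * m * y)) ≤ (1 + 1 / m) * Real.exp (-(m * y)) := by
  have h1 : 1 + y ≤ (1 + 1 / m) * Real.exp (m * y) := by
    have := Real.add_one_le_exp (m * y)
    calc 1 + y ≤ (1 + 1 / m) * (m * y + 1) := by
          have : (1 + 1 / m) * (m * y + 1) = 1 + y + m * y + 1 / m := by field_simp; ring
          rw [this]
          have : 0 ≤ m * y + 1 / m := by positivity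
          linarith
      _ ≤ _ := by gcongr
  calc _ ≤ ((1 + 1 / m) * Real.exp (m * y)) * Real.exp (-(2 * m * y)) := by gcongr
    _ = _ := by rw [mul_assoc, ← Real.exp_add]; congr 2; ring

namespace HeatData

variable {n : ℕ} {a : Coeffs n} (D : HeatData a)

/-- The Gaussian dominating the heat kernel. -/
def g (t : ℝ) (x : E n) : ℝ := gauss n (D.m / 4) t x

theorem g_nonneg {t : ℝ} (ht : 0 < t) (x : E n) : 0 ≤ D.g t x := gauss_nonneg ht x

theorem integrable_exp_q : Integrable fun z : E n => Real.exp (-(D.q z / 4)) := by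
  have h := integrable_gauss (n := n) (s := D.m) D.m_pos one_pos
  refine h.mono' (by have := D.continuous_q; fun_prop) (Eventually.of_forall fun z => ?_)
  rw [Real.norm_of_nonneg (Real.exp_nonneg _), gauss, Real.one_rpow, one_mul, Real.exp_le_exp]
  have := D.le_q z
  simp only [div_one]
  linarith

theorem integral_exp_q_pos : 0 < ∫ z : E n, Real.exp (-(D.q z / 4)) :=
  integral_exp_pos D.integrable_exp_q

theorem c_pos : 0 < D.c := inv_pos.mpr D.integral_exp_q_pos

theorem c_mul_integral : D.c * ∫ z : E n, Real.exp (-(D.q z / 4)) = 1 :=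
  inv_mul_cancel₀ D.integral_exp_q_pos.ne'

theorem norm_K {t : ℝ} (ht : 0 < t) (x : E n) : ‖D.K t x‖ =
    D.c * t ^ (-(n : ℝ) / 2) * Real.exp ((D.κ * t - D.bl x).re - D.q x / (4 * t)) := by
  have hc := D.c_pos
  rw [K, norm_mul, Complex.norm_exp, Complex.norm_real, Real.norm_of_nonneg (by positivity), ← ofReal_q]
  congr 2
  rw [Complex.sub_re]
  congr 1
  rw [show (4 * (t : ℂ)) = ((4 * t : ℝ) : ℂ) by push_cast; ring, ← Complex.ofReal_div,
    Complex.ofReal_re]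

/-- Put `y = ‖x‖²/t`. The quadratic form provides decay `m y`; the linear term `β·x` costs at most a
constant plus `m y/2`, since `‖x‖² ≤ y` for `t ≤ 1`; half of the remainder pays for `1 + y`. This
leaves the rate `m/4` used in `g`. -/
theorem exists_one_add_mul_norm_K_le :
    ∃ C : ℝ, 0 ≤ C ∧ ∀ t ∈ Ioc (0 : ℝ) 1, ∀ x : E n,
      (1 + ‖x‖ ^ 2 / t) * ‖D.K t x‖ ≤ C * D.g t x := by
  have hm := D.m_pos
  have hc := D.c_pos
  refine ⟨D.c * Real.exp (‖D.κ‖ + ‖D.bl‖ ^ 2 / (2 * D.m)) * (1 + 1 / (D.m / 4)), by positivity,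
    fun t ht x => ?_⟩
  have ht0 := ht.1
  set y := ‖x‖ ^ 2 / t with hy
  have hy0 : 0 ≤ y := by positivity
  have hxy : ‖x‖ ^ 2 ≤ y := by rw [hy, le_div_iff₀ ht0]; nlinarith [ht.2, sq_nonneg ‖x‖]
  have hexp : (D.κ * t - D.bl x).re - D.q x / (4 * t) ≤
      (‖D.κ‖ + ‖D.bl‖ ^ 2 / (2 * D.m)) + -(2 * (D.m / 4) * y) := by
    have h1 : (D.κ * t - D.bl x).re ≤ ‖D.κ‖ + ‖D.bl‖ * ‖x‖ := by
      calc _ ≤ ‖D.κ * t - D.bl x‖ := Complex.re_le_norm _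
        _ ≤ ‖D.κ * t‖ + ‖D.bl x‖ := norm_sub_le _ _
        _ ≤ ‖D.κ‖ + ‖D.bl‖ * ‖x‖ := by
          gcongr
          · rw [norm_mul, Complex.norm_real, Real.norm_of_nonneg ht0.le]
            exact mul_le_of_le_one_right (norm_nonneg _) ht.2
          · exact D.bl.le_opNorm x
    have h2 : ‖D.bl‖ * ‖x‖ ≤ ‖D.bl‖ ^ 2 / (2 * D.m) + D.m / 2 * ‖x‖ ^ 2 := by
      have : 0 ≤ (‖D.bl‖ - D.m * ‖x‖) ^ 2 / (2 * D.m) := by positivity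
      have e : (‖D.bl‖ - D.m * ‖x‖) ^ 2 / (2 * D.m) =
        ‖D.bl‖ ^ 2 / (2 * D.m) + D.m / 2 * ‖x‖ ^ 2 - ‖D.bl‖ * ‖x‖ := by field_simp; ring
      linarith
    have h3 : D.m * y ≤ D.q x / (4 * t) := by
      rw [hy, le_div_iff₀ (by positivity)]
      have := D.le_q x
      calc D.m * (‖x‖ ^ 2 / t) * (4 * t) = 4 * D.m * ‖x‖ ^ 2 := by field_simp
        _ ≤ _ := this
    have h4 : D.m / 2 * ‖x‖ ^ 2 ≤ D.m / 2 * y := by gcongr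
    linarith
  rw [D.norm_K ht0]
  calc (1 + y) * (D.c * t ^ (-(n : ℝ) / 2) * Real.exp ((D.κ * t - D.bl x).re - D.q x / (4 * t)))
      ≤ (1 + y) * (D.c * t ^ (-(n : ℝ) / 2) *
        Real.exp ((‖D.κ‖ + ‖D.bl‖ ^ 2 / (2 * D.m)) + -(2 * (D.m / 4) * y))) := by gcongr
    _ = D.c * Real.exp (‖D.κ‖ + ‖D.bl‖ ^ 2 / (2 * D.m)) * t ^ (-(n : ℝ) / 2) *
        ((1 + y) * Real.exp (-(2 * (D.m / 4) * y))) := by rw [Real.exp_add]; ring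
    _ ≤ D.c * Real.exp (‖D.κ‖ + ‖D.bl‖ ^ 2 / (2 * D.m)) * t ^ (-(n : ℝ) / 2) *
        ((1 + 1 / (D.m / 4)) * Real.exp (-(D.m / 4 * y))) :=
          mul_le_mul_of_nonneg_left (one_add_mul_exp_le (by positivity) hy0) (by positivity)
    _ = _ := by rw [g, gauss]; ring

theorem norm_ℓ_le {t : ℝ} (ht : t ∈ Ioc (0 : ℝ) 1) (x : E n) :
    ‖D.ℓ t x‖ ≤ (‖D.bl‖ + ‖D.BL‖) * ((√t)⁻¹ * (1 + ‖x‖ / √t)) := by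
  have ht0 := ht.1
  have hs : 0 < √t := Real.sqrt_pos.mpr ht0
  have hs1 : 1 ≤ (√t)⁻¹ := (one_le_inv₀ hs).mpr (Real.sqrt_le_one.mpr ht.2)
  have hss : √t * √t = t := Real.mul_self_sqrt ht0.le
  have h1 : ‖D.ℓ t x‖ ≤ ‖D.bl‖ + (2 * t)⁻¹ * (‖D.BL‖ * ‖x‖) := by
    rw [ℓ]
    refine (norm_sub_le _ _).trans ?_
    rw [norm_neg, norm_smul, Real.norm_of_nonneg (by positivity)]
    gcongr
    exact D.BL.le_opNorm x
  have h2 : (2 * t)⁻¹ * (‖D.BL‖ * ‖x‖) ≤ ‖D.BL‖ * ((√t)⁻¹ * (‖x‖ / √t)) := by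
    have : (√t)⁻¹ * (‖x‖ / √t) = t⁻¹ * ‖x‖ := by
      calc _ = (√t * √t)⁻¹ * ‖x‖ := by rw [mul_inv]; ring
        _ = _ := by rw [hss]
    rw [this, mul_inv]
    have h3 : 0 ≤ t⁻¹ * (‖D.BL‖ * ‖x‖) := by positivity
    nlinarith
  have h3 : ‖D.bl‖ ≤ ‖D.bl‖ * ((√t)⁻¹ * (1 + ‖x‖ / √t)) := by
    refine le_mul_of_one_le_right (norm_nonneg _) ?_
    have : 1 ≤ 1 + ‖x‖ / √t := by
      have : 0 ≤ ‖x‖ / √t := by positivity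
      linarith
    nlinarith
  have h4 : ‖D.BL‖ * ((√t)⁻¹ * (‖x‖ / √t)) ≤ ‖D.BL‖ * ((√t)⁻¹ * (1 + ‖x‖ / √t)) := by
    gcongr; linarith
  calc _ ≤ _ := h1
    _ ≤ _ := by rw [add_mul]; linarith

theorem norm_ℓ_le' {t : ℝ} (ht : t ∈ Ioc (0 : ℝ) 1) (x : E n) :
    ‖D.ℓ t x‖ ≤ (‖D.bl‖ + ‖D.BL‖) * ((√t)⁻¹ * (2 * (1 + ‖x‖ ^ 2 / t))) ∧
    ‖D.ℓ t x‖ ^ 2 ≤ (‖D.bl‖ + ‖D.BL‖) ^ 2 * (t⁻¹ * (2 * (1 + ‖x‖ ^ 2 / t))) := by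
  have ht0 := ht.1
  have hss : √t ^ 2 = t := Real.sq_sqrt ht0.le
  have hℓ := D.norm_ℓ_le ht x
  have hu2 : ‖x‖ ^ 2 / t = (‖x‖ / √t) ^ 2 := by rw [div_pow, hss]
  rw [hu2]
  generalize ‖x‖ / √t = u at hℓ
  constructor
  · refine hℓ.trans ?_
    gcongr
    nlinarith [sq_nonneg (u - 1)]
  · calc ‖D.ℓ t x‖ ^ 2 ≤ ((‖D.bl‖ + ‖D.BL‖) * ((√t)⁻¹ * (1 + u))) ^ 2 := by gcongr
      _ = (‖D.bl‖ + ‖D.BL‖) ^ 2 * (t⁻¹ * (1 + u) ^ 2) := by rw [mul_pow, mul_pow, inv_pow, hss]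
      _ ≤ _ := by gcongr; nlinarith [sq_nonneg (u - 1)]

theorem norm_fderiv_K_le {t : ℝ} (ht : t ∈ Ioc (0 : ℝ) 1) (x : E n) :
    ‖fderiv ℝ (D.K t) x‖ ≤
      (2 * (‖D.bl‖ + ‖D.BL‖)) * ((√t)⁻¹ * ((1 + ‖x‖ ^ 2 / t) * ‖D.K t x‖)) := by
  rw [D.fderiv_K]
  calc ‖D.K t x • D.ℓ t x‖ = ‖D.K t x‖ * ‖D.ℓ t x‖ := norm_smul _ _
    _ ≤ ‖D.K t x‖ * ((‖D.bl‖ + ‖D.BL‖) * ((√t)⁻¹ * (2 * (1 + ‖x‖ ^ 2 / t)))) :=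
      mul_le_mul_of_nonneg_left (D.norm_ℓ_le' ht x).1 (norm_nonneg _)
    _ = _ := by ring

theorem norm_fderiv_fderiv_K_le {t : ℝ} (ht : t ∈ Ioc (0 : ℝ) 1) (x : E n) :
    ‖fderiv ℝ (fderiv ℝ (D.K t)) x‖ ≤
      (2 * (‖D.bl‖ + ‖D.BL‖) ^ 2 + ‖D.BL‖) * (t⁻¹ * ((1 + ‖x‖ ^ 2 / t) * ‖D.K t x‖)) := by
  have ht0 := ht.1
  rw [(D.hasFDerivAt_fderiv_K t x).fderiv]
  have e1 : ‖D.K t x • (-((2 * t)⁻¹ • D.BL)) + (D.K t x • D.ℓ t x).smulRight (D.ℓ t x)‖ ≤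
      ‖D.K t x‖ * (t⁻¹ * ‖D.BL‖) + ‖D.K t x‖ * ‖D.ℓ t x‖ ^ 2 := by
    refine ContinuousLinearMap.opNorm_le_bound _ (by positivity) fun v => ?_
    simp only [add_apply, smul_apply, neg_apply, ContinuousLinearMap.smulRight_apply, smul_eq_mul]
    have f1 : ‖D.K t x • -((2 * t)⁻¹ • D.BL v)‖ ≤ ‖D.K t x‖ * (t⁻¹ * ‖D.BL‖) * ‖v‖ := by
      rw [norm_smul, norm_neg, norm_smul, Real.norm_of_nonneg (by positivity)]
      calc ‖D.K t x‖ * ((2 * t)⁻¹ * ‖D.BL v‖) ≤ ‖D.K t x‖ * (t⁻¹ * (‖D.BL‖ * ‖v‖)) := by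
            refine mul_le_mul_of_nonneg_left (mul_le_mul ?_ (D.BL.le_opNorm v) (norm_nonneg _)
              (by positivity)) (norm_nonneg _)
            exact inv_anti₀ ht0 (by linarith)
        _ = _ := by ring
    have f2 : ‖(D.K t x * D.ℓ t x v) • D.ℓ t x‖ ≤ ‖D.K t x‖ * ‖D.ℓ t x‖ ^ 2 * ‖v‖ := by
      rw [norm_smul, norm_mul]
      calc ‖D.K t x‖ * ‖D.ℓ t x v‖ * ‖D.ℓ t x‖ ≤ ‖D.K t x‖ * (‖D.ℓ t x‖ * ‖v‖) * ‖D.ℓ t x‖ := by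
            gcongr
            exact (D.ℓ t x).le_opNorm v
        _ = _ := by ring
    refine (norm_add_le _ _).trans ?_
    rw [add_mul]
    exact add_le_add f1 f2
  have h2 := mul_le_mul_of_nonneg_left (D.norm_ℓ_le' ht x).2 (norm_nonneg (D.K t x))
  have h3 : 0 ≤ ‖D.K t x‖ * (t⁻¹ * ‖D.BL‖) * (‖x‖ ^ 2 / t) := by positivity
  calc _ ≤ _ := e1
    _ ≤ ‖D.K t x‖ * (t⁻¹ * ‖D.BL‖) +
        ‖D.K t x‖ * ((‖D.bl‖ + ‖D.BL‖) ^ 2 * (t⁻¹ * (2 * (1 + ‖x‖ ^ 2 / t)))) +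
        ‖D.K t x‖ * (t⁻¹ * ‖D.BL‖) * (‖x‖ ^ 2 / t) := by linarith
    _ = _ := by ring

theorem norm_Kt_le {t : ℝ} (ht : t ∈ Ioc (0 : ℝ) 1) (x : E n) :
    ‖D.Kt t x‖ ≤ (‖D.κ‖ + n + ‖D.BL‖) * (t⁻¹ * ((1 + ‖x‖ ^ 2 / t) * ‖D.K t x‖)) := by
  have ht0 := ht.1
  have ht1 : 1 ≤ t⁻¹ := (one_le_inv₀ ht0).mpr ht.2
  rw [Kt, norm_mul]
  have e1 : ‖D.κ - n / (2 * t) + D.q x / (4 * t ^ 2)‖ ≤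
      ‖D.κ‖ + n / (2 * t) + |D.q x| / (4 * t ^ 2) := by
    refine (norm_add_le _ _).trans (add_le_add ((norm_sub_le _ _).trans (add_le_add le_rfl ?_)) ?_)
    · rw [norm_div, norm_mul, Complex.norm_natCast, Complex.norm_ofNat, Complex.norm_real,
        Real.norm_of_nonneg ht0.le]
    · rw [norm_div, norm_mul, norm_pow, Complex.norm_ofNat, Complex.norm_real, Complex.norm_real,
        Real.norm_of_nonneg ht0.le, Real.norm_eq_abs]
  have e2 : |D.q x| ≤ ‖D.BL‖ * ‖x‖ ^ 2 := by
    calc |D.q x| ≤ ‖D.BL x x‖ := Complex.abs_re_le_norm _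
      _ ≤ ‖D.BL‖ * ‖x‖ * ‖x‖ := D.BL.le_opNorm₂ x x
      _ = _ := by ring
  have f1 : |D.q x| / (4 * t ^ 2) ≤ ‖D.BL‖ * (t⁻¹ * (‖x‖ ^ 2 / t)) := by
    rw [div_le_iff₀ (by positivity)]
    have f0 : 0 ≤ ‖D.BL‖ * ‖x‖ ^ 2 := by positivity
    calc |D.q x| ≤ ‖D.BL‖ * ‖x‖ ^ 2 := e2
      _ ≤ 4 * (‖D.BL‖ * ‖x‖ ^ 2) := by linarith
      _ = _ := by field_simp
  have f2 : (n : ℝ) / (2 * t) ≤ n * t⁻¹ := by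
    rw [div_eq_mul_inv]
    exact mul_le_mul_of_nonneg_left (inv_anti₀ ht0 (by linarith)) (Nat.cast_nonneg n)
  have f3 : ‖D.κ‖ ≤ ‖D.κ‖ * t⁻¹ := le_mul_of_one_le_right (norm_nonneg _) ht1
  have f4 : 0 ≤ (‖D.κ‖ + n) * (t⁻¹ * (‖x‖ ^ 2 / t)) + ‖D.BL‖ * t⁻¹ := by positivity
  have e3 : ‖D.κ - n / (2 * t) + D.q x / (4 * t ^ 2)‖ ≤
      (‖D.κ‖ + n + ‖D.BL‖) * (t⁻¹ * (1 + ‖x‖ ^ 2 / t)) := by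
    refine e1.trans ?_
    have : (‖D.κ‖ + n + ‖D.BL‖) * (t⁻¹ * (1 + ‖x‖ ^ 2 / t)) = ‖D.κ‖ * t⁻¹ + n * t⁻¹ +
      ‖D.BL‖ * (t⁻¹ * (‖x‖ ^ 2 / t)) + ((‖D.κ‖ + n) * (t⁻¹ * (‖x‖ ^ 2 / t)) + ‖D.BL‖ * t⁻¹) := by
        ring
    linarith
  calc _ ≤ ‖D.K t x‖ * ((‖D.κ‖ + n + ‖D.BL‖) * (t⁻¹ * (1 + ‖x‖ ^ 2 / t))) :=
        mul_le_mul_of_nonneg_left e3 (norm_nonneg _)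
    _ = _ := by ring

/-- Parabolic scaling: a space derivative costs `t^{-1/2}` and a time derivative `t⁻¹`. The
polynomial factors in `‖x‖²/t` are absorbed by passing to the wider Gaussian. -/
theorem exists_kernel_bounds :
    ∃ C : ℝ, 0 ≤ C ∧ ∀ t ∈ Ioc (0 : ℝ) 1, ∀ x : E n,
      (1 + ‖x‖ ^ 2 / t) * ‖D.K t x‖ ≤ C * D.g t x ∧
      ‖fderiv ℝ (D.K t) x‖ ≤ C * ((√t)⁻¹ * D.g t x) ∧
      ‖fderiv ℝ (fderiv ℝ (D.K t)) x‖ ≤ C * (t⁻¹ * D.g t x) ∧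
      ‖D.Kt t x‖ ≤ C * (t⁻¹ * D.g t x) := by
  obtain ⟨C, hC0, hC⟩ := D.exists_one_add_mul_norm_K_le
  set r1 := 2 * (‖D.bl‖ + ‖D.BL‖) with hr1
  set r2 := 2 * (‖D.bl‖ + ‖D.BL‖) ^ 2 + ‖D.BL‖ with hr2
  set r3 := ‖D.κ‖ + n + ‖D.BL‖ with hr3
  have p1 : 0 ≤ r1 := by positivity
  have p2 : 0 ≤ r2 := by positivity
  have p3 : 0 ≤ r3 := by positivity
  refine ⟨C * (1 + r1 + r2 + r3), by positivity, fun t ht x => ?_⟩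
  have hg := D.g_nonneg ht.1 x
  have h0 := hC t ht x
  have hfac : ∀ r : ℝ, 0 ≤ r → r ≤ 1 + r1 + r2 + r3 → ∀ w : ℝ, 0 ≤ w → ∀ y : ℝ,
      y ≤ r * (w * ((1 + ‖x‖ ^ 2 / t) * ‖D.K t x‖)) →
      y ≤ C * (1 + r1 + r2 + r3) * (w * D.g t x) := by
    intro r hr0 hr w hw y hy
    have : 0 ≤ w * (C * D.g t x) := by positivity
    calc y ≤ _ := hy
      _ ≤ r * (w * (C * D.g t x)) := by gcongr
      _ ≤ (1 + r1 + r2 + r3) * (w * (C * D.g t x)) := by gcongr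
      _ = _ := by ring
  have ht0 := ht.1
  refine ⟨?_, hfac r1 p1 (by linarith) _ (by positivity) _ (D.norm_fderiv_K_le ht x),
    hfac r2 p2 (by linarith) _ (by positivity) _ (D.norm_fderiv_fderiv_K_le ht x),
    hfac r3 p3 (by linarith) _ (by positivity) _ (D.norm_Kt_le ht x)⟩
  have := hfac 1 zero_le_one (by linarith) 1 zero_le_one _ (by rw [one_mul, one_mul])
  rwa [one_mul] at this

theorem continuousOn_uncurry_K :
    ContinuousOn (fun z : ℝ × E n => D.K z.1 z.2) (Ioi 0 ×ˢ univ) := by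
  unfold K
  have h1 : ContinuousOn (fun z : ℝ × E n => z.1 ^ (-(n : ℝ) / 2)) (Ioi 0 ×ˢ univ) :=
    continuousOn_fst.rpow_const fun z hz => Or.inl (ne_of_gt hz.1)
  have h2 : ∀ z ∈ (Ioi (0 : ℝ) ×ˢ (univ : Set (E n))), (4 * (z.1 : ℂ)) ≠ 0 := fun z hz => by
    have : z.1 ≠ 0 := ne_of_gt hz.1
    simpa using this
  refine ContinuousOn.mul (by fun_prop) (ContinuousOn.cexp (ContinuousOn.sub (by fun_prop) ?_))
  exact ContinuousOn.div (by fun_prop) (by fun_prop) h2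

theorem continuousOn_uncurry_Kt :
    ContinuousOn (fun z : ℝ × E n => D.Kt z.1 z.2) (Ioi 0 ×ˢ univ) := by
  unfold Kt
  have hne : ∀ z ∈ (Ioi (0 : ℝ) ×ˢ (univ : Set (E n))), (z.1 : ℂ) ≠ 0 := fun z hz => by
    have : z.1 ≠ 0 := ne_of_gt hz.1
    simpa using this
  have hq := D.continuous_q
  refine D.continuousOn_uncurry_K.mul (ContinuousOn.add (ContinuousOn.sub (by fun_prop) ?_) ?_)
  · exact ContinuousOn.div (by fun_prop) (by fun_prop) fun z hz => by simpa using hne z hz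
  · exact ContinuousOn.div (by fun_prop) (by fun_prop) fun z hz => by simpa using hne z hz

end HeatData

end DoubleLayer

namespace DoubleLayer

open MeasureTheory Set Filter Topology

/-! ### Time integrals of the heat kernel -/

theorem rpow_le_mul_exp {y σ s : ℝ} (hy : 0 < y) (hσ : 0 < σ) (hs : 0 < s) :
    y ^ σ ≤ (σ / s) ^ σ * Real.exp (s * y) := by
  have h2 : s * y / σ ≤ Real.exp (s * y / σ) := by
    have := Real.add_one_le_exp (s * y / σ); linarith
  have h3 : (s * y / σ) ^ σ ≤ Real.exp (s * y) := by
    calc _ ≤ Real.exp (s * y / σ) ^ σ := by gcongr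
      _ = _ := by rw [← Real.exp_mul]; congr 1; field_simp
  calc y ^ σ = (σ / s) ^ σ * (s * y / σ) ^ σ := by
        rw [← Real.mul_rpow (by positivity) (by positivity)]
        congr 1
        field_simp
    _ ≤ _ := by gcongr

theorem rpow_neg_mul_exp_le {p b t : ℝ} (hp : 0 < p) (hb : 0 < b) (ht : 0 < t) :
    t ^ (-p) * Real.exp (-(b / t)) ≤ (p / b) ^ p := by
  have h1 := rpow_le_mul_exp (y := t⁻¹) (inv_pos.mpr ht) hp hb
  rw [Real.inv_rpow ht.le, ← Real.rpow_neg ht.le] at h1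
  calc t ^ (-p) * Real.exp (-(b / t)) ≤ (p / b) ^ p * Real.exp (b * t⁻¹) * Real.exp (-(b / t)) := by
        gcongr
    _ = (p / b) ^ p := by
        rw [mul_assoc, ← Real.exp_add, div_eq_mul_inv b t, add_neg_cancel, Real.exp_zero, mul_one]

/-- The integrals `∫₀¹ t^{-s} e^{κt-ρ/(4t)} dt`. -/
def timeIntegral (κ : ℂ) (s ρ : ℝ) : ℂ :=
  ∫ t in Ioc (0 : ℝ) 1, ((t ^ (-s) * Real.exp (-(ρ / (4 * t))) : ℝ) : ℂ) * Complex.exp (κ * t)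

theorem norm_timeIntegrand_le (κ : ℂ) {s ρ b t : ℝ} (hs : 0 < s) (hb : 0 < b) (hρ : b ≤ ρ)
    (ht : t ∈ Ioc (0 : ℝ) 1) :
    ‖((t ^ (-s) * Real.exp (-(ρ / (4 * t))) : ℝ) : ℂ) * Complex.exp (κ * t)‖ ≤
      (s / (b / 4)) ^ s * Real.exp ‖κ‖ := by
  have ht0 := ht.1
  rw [norm_mul, Complex.norm_real, Complex.norm_exp, Real.norm_of_nonneg (by positivity)]
  have h1 : t ^ (-s) * Real.exp (-(ρ / (4 * t))) ≤ (s / (b / 4)) ^ s := by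
    refine le_trans ?_ (rpow_neg_mul_exp_le (b := b / 4) hs (by positivity) ht0)
    have h : b / 4 / t ≤ ρ / (4 * t) := by rw [div_div]; gcongr
    exact mul_le_mul_of_nonneg_left (Real.exp_le_exp.mpr (neg_le_neg h)) (by positivity)
  have h2 : (κ * t).re ≤ ‖κ‖ := by
    refine (Complex.re_le_norm _).trans ?_
    rw [norm_mul, Complex.norm_real, Real.norm_of_nonneg ht0.le]
    exact mul_le_of_le_one_right (norm_nonneg _) ht.2
  gcongr

theorem aestronglyMeasurable_timeIntegrand (κ : ℂ) (s ρ : ℝ) :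
    AEStronglyMeasurable (fun t : ℝ => ((t ^ (-s) * Real.exp (-(ρ / (4 * t))) : ℝ) : ℂ) *
      Complex.exp (κ * t)) (volume.restrict (Ioc (0 : ℝ) 1)) := by
  have : Measurable (fun t : ℝ => ((t ^ (-s) * Real.exp (-(ρ / (4 * t))) : ℝ) : ℂ) *
      Complex.exp (κ * t)) := by fun_prop
  exact this.aestronglyMeasurable

/-- Differentiation in `ρ` brings down `-1/(4t)`, which raises `s` by one. The family is closed
under differentiation, and smoothness follows by an induction in which `s` varies. -/
theorem hasDerivAt_timeIntegral (κ : ℂ) {s ρ : ℝ} (hs : 0 < s) (hρ : 0 < ρ) :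
    HasDerivAt (timeIntegral κ s) (-(1 / 4) * timeIntegral κ (s + 1) ρ) ρ := by
  have hfin : IsFiniteMeasure (volume.restrict (Ioc (0 : ℝ) 1)) := ⟨by simp⟩
  have h := hasDerivAt_integral_of_dominated_loc_of_deriv_le (μ := volume.restrict (Ioc (0 : ℝ) 1))
    (𝕜 := ℝ) (F := fun ρ t => ((t ^ (-s) * Real.exp (-(ρ / (4 * t))) : ℝ) : ℂ) * Complex.exp (κ * t))
    (F' := fun ρ t => -(1 / 4) * (((t ^ (-(s + 1)) * Real.exp (-(ρ / (4 * t))) : ℝ) : ℂ) *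
      Complex.exp (κ * t))) (x₀ := ρ) (s := Ioi (ρ / 2))
    (bound := fun _ => ((s + 1) / (ρ / 2 / 4)) ^ (s + 1) * Real.exp ‖κ‖)
    (Ioi_mem_nhds (by linarith))
    (Eventually.of_forall fun _ => aestronglyMeasurable_timeIntegrand κ s _) ?_
    ((aestronglyMeasurable_timeIntegrand κ (s + 1) ρ).const_mul _) ?_ (integrable_const _) ?_
  · have := h.2
    rwa [integral_const_mul] at this
  · refine IntegrableOn.of_bound (by simp) (aestronglyMeasurable_timeIntegrand κ s _)
      ((s / (ρ / 4)) ^ s * Real.exp ‖κ‖) ?_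
    filter_upwards [ae_restrict_mem measurableSet_Ioc] with t ht
    exact norm_timeIntegrand_le κ hs hρ le_rfl ht
  · filter_upwards [ae_restrict_mem measurableSet_Ioc] with t ht r hr
    have := norm_timeIntegrand_le κ (s := s + 1) (by linarith) (b := ρ / 2) (by linarith)
      (le_of_lt hr) ht
    rw [norm_mul]
    refine le_trans (mul_le_of_le_one_left (norm_nonneg _) ?_) this
    norm_num
  · filter_upwards [ae_restrict_mem measurableSet_Ioc] with t ht r hr
    have ht0 := ht.1
    have h1 : HasDerivAt (fun r : ℝ => t ^ (-s) * Real.exp (-(r / (4 * t))))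
        (t ^ (-s) * (Real.exp (-(r / (4 * t))) * (-(1 / (4 * t))))) r :=
      ((((hasDerivAt_id r).div_const (4 * t)).neg).exp).const_mul _
    refine (h1.ofReal_comp.mul_const _).congr_deriv ?_
    rw [neg_add, Real.rpow_add ht0, Real.rpow_neg_one]
    push_cast
    have : (t : ℂ) ≠ 0 := by exact_mod_cast ht0.ne'
    field_simp

theorem contDiffOn_timeIntegral (κ : ℂ) {s : ℝ} (hs : 0 < s) :
    ContDiffOn ℝ ∞ (timeIntegral κ s) (Ioi 0) := by
  rw [contDiffOn_infty]
  intro k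
  induction k generalizing s with
  | zero =>
    simp only [Nat.cast_zero, contDiffOn_zero]
    exact fun ρ hρ => (hasDerivAt_timeIntegral κ hs hρ).continuousAt.continuousWithinAt
  | succ k ih =>
    rw [Nat.cast_add, Nat.cast_one, contDiffOn_succ_iff_deriv_of_isOpen isOpen_Ioi]
    refine ⟨fun ρ hρ => (hasDerivAt_timeIntegral κ hs hρ).differentiableAt.differentiableWithinAt,
      fun h => by simp at h, ?_⟩
    refine ((contDiffOn_const (c := (-(1 / 4) : ℂ))).mul (ih (s := s + 1) (by linarith))).congr
      fun ρ hρ => ?_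
    exact (hasDerivAt_timeIntegral κ hs hρ).deriv

/-! ### The time integral of the heat kernel away from the origin -/

namespace HeatData

variable {n : ℕ} {a : Coeffs n} (D : HeatData a)

/-- The parametrix `-∫₀¹ K_t dt`. -/
def par (x : E n) : ℂ := -∫ t in Ioc (0 : ℝ) 1, D.K t x

theorem q_pos {x : E n} (hx : x ≠ 0) : 0 < D.q x := by
  have h1 := D.le_q x
  have h2 := D.m_pos
  have h3 : 0 < ‖x‖ := norm_pos_iff.mpr hx
  have : 0 < 4 * D.m * ‖x‖ ^ 2 := by positivity
  linarith

/-- The dependence on `x` is through a smooth exponential and through `q x`, positive off the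
origin. Smoothness of `par` is thus reduced to that of a function of one variable on `(0, ∞)`. -/
theorem par_eq (x : E n) :
    D.par x = -(D.c * Complex.exp (-D.bl x) * timeIntegral D.κ (n / 2) (D.q x)) := by
  rw [par, timeIntegral, ← integral_const_mul]
  congr 1
  refine setIntegral_congr_fun measurableSet_Ioc fun t ht => ?_
  have ht0 : (t : ℂ) ≠ 0 := by exact_mod_cast ht.1.ne'
  simp only [K]
  rw [← ofReal_q, show D.κ * t - D.bl x - (D.q x : ℂ) / (4 * t) =
    -D.bl x + (((-(D.q x / (4 * t)) : ℝ) : ℂ) + D.κ * t) by push_cast; ring, Complex.exp_add,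
    Complex.exp_add, ← Complex.ofReal_exp, neg_div]
  push_cast
  ring

theorem contDiffOn_par (hn : 1 ≤ n) : ContDiffOn ℝ ∞ D.par {0}ᶜ := by
  have hn' : (0 : ℝ) < n / 2 := by
    have : (1 : ℝ) ≤ n := by exact_mod_cast hn
    linarith
  have h1 : ContDiff ℝ ∞ D.q := by
    have : ContDiff ℝ ∞ fun x => D.BL x x := D.BL.isBoundedBilinearMap.contDiff.comp
      (contDiff_id.prodMk contDiff_id)
    exact Complex.reCLM.contDiff.comp this
  have h2 : ContDiffOn ℝ ∞ (fun x => timeIntegral D.κ (n / 2) (D.q x)) {0}ᶜ :=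
    (contDiffOn_timeIntegral D.κ hn').comp h1.contDiffOn fun x hx => D.q_pos hx
  have h3 : ContDiff ℝ ∞ (fun x => (D.c : ℂ) * Complex.exp (-D.bl x)) :=
    contDiff_const.mul D.bl.contDiff.neg.cexp
  exact ((h3.contDiffOn.mul h2).neg).congr fun x _ => D.par_eq x

theorem continuousOn_K_time (x : E n) : ContinuousOn (fun t => D.K t x) (Ioi 0) :=
  D.continuousOn_uncurry_K.comp (f := fun t : ℝ => (t, x))
    (continuousOn_id.prodMk continuousOn_const) fun _ ht => ⟨ht, mem_univ _⟩

theorem continuousOn_ℓ_time (x : E n) : ContinuousOn (fun t => D.ℓ t x) (Ioi 0) := by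
  unfold ℓ
  refine continuousOn_const.sub (ContinuousOn.smul ((continuousOn_const.mul continuousOn_id).inv₀ ?_)
    continuousOn_const)
  intro t ht
  have : t ≠ 0 := ne_of_gt ht
  simpa using this

theorem aestronglyMeasurable_time {F : Type*} [NormedAddCommGroup F] {f : ℝ → F}
    (hf : ContinuousOn f (Ioi 0)) : AEStronglyMeasurable f (volume.restrict (Ioc (0 : ℝ) 1)) :=
  (hf.mono fun _ ht => ht.1).aestronglyMeasurable measurableSet_Ioc

/-- Away from the origin the Gaussian beats every negative power of `t`. This gives bounds uniform
in time for differentiating `par` under the integral. -/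
theorem g_le_of_le (hn : 1 ≤ n) {t r : ℝ} {x : E n} (ht : 0 < t) (hr : 0 < r) (hx : r ≤ ‖x‖) :
    (√t)⁻¹ * D.g t x ≤ (((n : ℝ) + 1) / 2 / (D.m / 4 * r ^ 2)) ^ (((n : ℝ) + 1) / 2) := by
  have hm := D.m_pos
  have h := rpow_neg_mul_exp_le (p := ((n : ℝ) + 1) / 2) (b := D.m / 4 * r ^ 2) (t := t)
    (by positivity) (by positivity) ht
  refine le_trans ?_ h
  have e1 : (√t)⁻¹ * t ^ (-(n : ℝ) / 2) = t ^ (-(((n : ℝ) + 1) / 2)) := by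
    rw [Real.sqrt_eq_rpow, ← Real.rpow_neg ht.le, ← Real.rpow_add ht]
    congr 1; ring
  rw [g, gauss, ← mul_assoc, e1, mul_div_assoc (D.m / 4)]
  gcongr

theorem integrableOn_K_time (hn : 1 ≤ n) {x : E n} (hx : x ≠ 0) :
    IntegrableOn (fun t => D.K t x) (Ioc 0 1) := by
  obtain ⟨C, hC0, hC⟩ := D.exists_kernel_bounds
  have hx' : 0 < ‖x‖ := norm_pos_iff.mpr hx
  refine IntegrableOn.of_bound (by simp) (aestronglyMeasurable_time (D.continuousOn_K_time x))
    (C * (((n : ℝ) + 1) / 2 / (D.m / 4 * ‖x‖ ^ 2)) ^ (((n : ℝ) + 1) / 2)) ?_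
  filter_upwards [ae_restrict_mem measurableSet_Ioc] with t ht
  have h1 := (hC t ht x).1
  have ht0 := ht.1
  have hg := D.g_nonneg ht0 x
  have h2 : ‖D.K t x‖ ≤ (1 + ‖x‖ ^ 2 / t) * ‖D.K t x‖ := by
    refine le_mul_of_one_le_left (norm_nonneg _) ?_
    have : 0 ≤ ‖x‖ ^ 2 / t := by positivity
    linarith
  have h3 : D.g t x ≤ (√t)⁻¹ * D.g t x := by
    refine le_mul_of_one_le_left hg ?_
    exact (one_le_inv₀ (Real.sqrt_pos.mpr ht0)).mpr (Real.sqrt_le_one.mpr ht.2)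
  calc _ ≤ _ := h2.trans h1
    _ ≤ C * ((√t)⁻¹ * D.g t x) := by gcongr
    _ ≤ _ := by gcongr; exact D.g_le_of_le hn ht0 hx' le_rfl

theorem integrableOn_fderiv_K_time (hn : 1 ≤ n) {x : E n} (hx : x ≠ 0) :
    IntegrableOn (fun t => fderiv ℝ (D.K t) x) (Ioc 0 1) := by
  obtain ⟨C, hC0, hC⟩ := D.exists_kernel_bounds
  have hx' : 0 < ‖x‖ := norm_pos_iff.mpr hx
  refine IntegrableOn.of_bound (by simp) (aestronglyMeasurable_time ?_)
    (C * (((n : ℝ) + 1) / 2 / (D.m / 4 * ‖x‖ ^ 2)) ^ (((n : ℝ) + 1) / 2)) ?_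
  · simp only [fderiv_K]
    exact (D.continuousOn_K_time x).smul (D.continuousOn_ℓ_time x)
  filter_upwards [ae_restrict_mem measurableSet_Ioc] with t ht
  refine ((hC t ht x).2.1).trans ?_
  gcongr
  exact D.g_le_of_le hn ht.1 hx' le_rfl

theorem hasFDerivAt_par (hn : 1 ≤ n) {x : E n} (hx : x ≠ 0) :
    HasFDerivAt D.par (-∫ t in Ioc (0 : ℝ) 1, fderiv ℝ (D.K t) x) x := by
  obtain ⟨C, hC0, hC⟩ := D.exists_kernel_bounds
  have hx' : 0 < ‖x‖ := norm_pos_iff.mpr hx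
  have hfin : IsFiniteMeasure (volume.restrict (Ioc (0 : ℝ) 1)) := ⟨by simp⟩
  refine HasFDerivAt.neg ?_
  refine hasFDerivAt_integral_of_dominated_of_fderiv_le (μ := volume.restrict (Ioc (0 : ℝ) 1))
    (F := fun x t => D.K t x) (F' := fun x t => fderiv ℝ (D.K t) x) (s := Metric.ball x (‖x‖ / 2))
    (bound := fun _ => C * (((n : ℝ) + 1) / 2 / (D.m / 4 * (‖x‖ / 2) ^ 2)) ^ (((n : ℝ) + 1) / 2))
    (Metric.ball_mem_nhds x (by positivity))
    (Eventually.of_forall fun y => aestronglyMeasurable_time (D.continuousOn_K_time y))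
    (D.integrableOn_K_time hn hx) (D.integrableOn_fderiv_K_time hn hx).1 ?_ (integrable_const _) ?_
  · filter_upwards [ae_restrict_mem measurableSet_Ioc] with t ht y hy
    refine ((hC t ht y).2.1).trans ?_
    gcongr
    refine D.g_le_of_le hn ht.1 (by positivity) ?_
    have h1 : ‖x - y‖ < ‖x‖ / 2 := by rw [← dist_eq_norm, dist_comm]; exact hy
    have h2 := norm_sub_norm_le x y
    linarith
  · exact Eventually.of_forall fun t y _ => by
      rw [(D.hasFDerivAt_K t y).fderiv]; exact D.hasFDerivAt_K t y

theorem pd_par (hn : 1 ≤ n) {x : E n} (hx : x ≠ 0) (j : Fin n) :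
    pd j D.par x = -∫ t in Ioc (0 : ℝ) 1, pd j (D.K t) x := by
  rw [pd, (D.hasFDerivAt_par hn hx).fderiv, neg_apply,
    ContinuousLinearMap.integral_apply (D.integrableOn_fderiv_K_time hn hx)]
  rfl

end HeatData

end DoubleLayer

namespace DoubleLayer

open MeasureTheory Set Filter Topology

/-! ### The heat kernel as an approximate identity -/

theorem ae_inner_ne_zero {n : ℕ} {v : E n} (hv : v ≠ 0) : ∀ᵐ ζ : E n, inner ℝ ζ v ≠ 0 := by
  have h := Measure.addHaar_submodule volume (LinearMap.ker (innerSL ℝ v).toLinearMap) ?_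
  · rw [ae_iff]
    refine (congrArg volume ?_).trans h
    ext ζ
    simp [real_inner_comm]
  · intro htop
    have : v ∈ LinearMap.ker (innerSL ℝ v).toLinearMap := htop ▸ Submodule.mem_top
    simp at this
    exact hv this

namespace HeatData

variable {n : ℕ} {a : Coeffs n} (D : HeatData a)

theorem integrable_g {t : ℝ} (ht : 0 < t) : Integrable (D.g t) :=
  integrable_gauss (by have := D.m_pos; positivity) ht

/-- The total mass of the dominating Gaussian. -/
def mass : ℝ := (Real.pi / (D.m / 4)) ^ ((n : ℝ) / 2)

theorem integral_g {t : ℝ} (ht : 0 < t) : ∫ x, D.g t x = D.mass :=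
  integral_gauss (by have := D.m_pos; positivity) ht

theorem mass_nonneg : 0 ≤ D.mass := by
  have := D.m_pos
  have := Real.pi_pos
  unfold mass; positivity

/-- The mass of `g t` does not depend on `t`, so only the weight `w` has to be integrable in time.
-/
theorem integrable_prod_of_le_g {I : Set ℝ} (hI : MeasurableSet I) (hI0 : I ⊆ Ioi 0) {F : Type*}
    [NormedAddCommGroup F] {f : ℝ × E n → F}
    (hf : AEStronglyMeasurable f ((volume.restrict I).prod volume)) {w : ℝ → ℝ}
    (hw : IntegrableOn w I) (hle : ∀ t ∈ I, ∀ x, ‖f (t, x)‖ ≤ w t * D.g t x) :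
    Integrable f ((volume.restrict I).prod volume) := by
  rw [integrable_prod_iff hf]
  constructor
  · filter_upwards [hf.prodMk_left, ae_restrict_mem hI] with t ht htI
    exact ((D.integrable_g (hI0 htI)).const_mul (w t)).mono' ht (Eventually.of_forall (hle t htI))
  · refine (hw.mul_const D.mass).mono' hf.norm.integral_prod_right' ?_
    filter_upwards [hf.prodMk_left, ae_restrict_mem hI] with t ht htI
    rw [Real.norm_of_nonneg (integral_nonneg fun _ => norm_nonneg _), ← D.integral_g (hI0 htI),
      ← integral_const_mul]
    exact integral_mono_of_nonneg (Eventually.of_forall fun _ => norm_nonneg _)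
      ((D.integrable_g (hI0 htI)).const_mul (w t)) (Eventually.of_forall (hle t htI))

theorem aestronglyMeasurable_prod {F : Type*} [NormedAddCommGroup F] {I : Set ℝ}
    (hI : MeasurableSet I) (hI0 : I ⊆ Ioi 0) {f : ℝ × E n → F}
    (hf : ContinuousOn f (Ioi 0 ×ˢ univ)) :
    AEStronglyMeasurable f ((volume.restrict I).prod volume) := by
  have h : ContinuousOn f (I ×ˢ univ) := hf.mono (prod_mono hI0 subset_rfl)
  have := h.aestronglyMeasurable (μ := (volume : Measure ℝ).prod (volume : Measure (E n)))
    (hI.prod MeasurableSet.univ)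
  rwa [← Measure.prod_restrict, Measure.restrict_univ] at this

theorem exists_norm_K_le : ∃ C : ℝ, 0 ≤ C ∧ ∀ t ∈ Ioc (0 : ℝ) 1, ∀ x : E n,
    ‖D.K t x‖ ≤ C * D.g t x := by
  obtain ⟨C, hC0, hC⟩ := D.exists_kernel_bounds
  refine ⟨C, hC0, fun t ht x => le_trans ?_ (hC t ht x).1⟩
  refine le_mul_of_one_le_left (norm_nonneg _) ?_
  have ht0 := ht.1
  have : 0 ≤ ‖x‖ ^ 2 / t := by positivity
  linarith

theorem integrable_K {t : ℝ} (ht : t ∈ Ioc (0 : ℝ) 1) : Integrable (D.K t) := by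
  obtain ⟨C, hC0, hC⟩ := D.exists_norm_K_le
  exact ((D.integrable_g ht.1).const_mul C).mono' (D.contDiff_K t).continuous.aestronglyMeasurable
    (Eventually.of_forall (hC t ht))

theorem integrable_uncurry_K :
    Integrable (fun z : ℝ × E n => D.K z.1 z.2) ((volume.restrict (Ioc (0 : ℝ) 1)).prod volume) := by
  obtain ⟨C, hC0, hC⟩ := D.exists_norm_K_le
  refine D.integrable_prod_of_le_g measurableSet_Ioc (fun t ht => ht.1)
    (aestronglyMeasurable_prod measurableSet_Ioc (fun t ht => ht.1) D.continuousOn_uncurry_K)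
    (w := fun _ => C) (integrableOn_const (by simp)) fun t ht x => hC t ht x

theorem integrable_par : Integrable D.par := by
  have := D.integrable_uncurry_K.integral_prod_right
  exact this.neg

/-- Under `x = √ε ζ` the kernel tends to the profile `c exp(-q/4)`, dominated by a fixed Gaussian.
Limits of `f` along almost every ray are enough, so `f` may be the indicator of a domain seen from a
boundary point. -/
theorem tendsto_integral_K {f f0 : E n → ℂ} {M : ℝ} (hfm : Measurable f) (hM : ∀ x, ‖f x‖ ≤ M)
    (hf0 : ∀ᵐ ζ : E n, Tendsto (fun ε : ℝ => f (√ε • ζ)) (𝓝[>] 0) (𝓝 (f0 ζ))) :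
    Tendsto (fun ε => ∫ x, D.K ε x * f x) (𝓝[>] 0)
      (𝓝 (∫ ζ, ((D.c * Real.exp (-(D.q ζ / 4)) : ℝ) : ℂ) * f0 ζ)) := by
  obtain ⟨C, hC0, hC⟩ := D.exists_norm_K_le
  have hM0 : 0 ≤ M := (norm_nonneg _).trans (hM 0)
  have hscale : ∀ ε : ℝ, 0 < ε → ∫ x, D.K ε x * f x =
      ∫ ζ, ((ε ^ ((n : ℝ) / 2) : ℝ) : ℂ) * D.K ε (√ε • ζ) * f (√ε • ζ) := by
    intro ε hε
    have hs : 0 < √ε := Real.sqrt_pos.mpr hε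
    have h := Measure.integral_comp_smul (volume : Measure (E n)) (fun x => D.K ε x * f x) √ε
    rw [finrank_euclideanSpace, Fintype.card_fin, abs_of_pos (by positivity)] at h
    have hp : √ε ^ n = ε ^ ((n : ℝ) / 2) := by
      rw [Real.sqrt_eq_rpow, ← Real.rpow_natCast, ← Real.rpow_mul hε.le]
      congr 1; ring
    simp only [mul_assoc]
    rw [integral_const_mul, h, hp, Complex.real_smul, ← mul_assoc, ← Complex.ofReal_mul,
      mul_inv_cancel₀ (by positivity), Complex.ofReal_one, one_mul]
  have hscaled : ∀ ε : ℝ, 0 < ε → ∀ ζ : E n, ((ε ^ ((n : ℝ) / 2) : ℝ) : ℂ) * D.K ε (√ε • ζ) =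
      D.c * Complex.exp (D.κ * ε - √ε * D.bl ζ - D.q ζ / 4) := by
    intro ε hε ζ
    have hε' : (ε : ℂ) ≠ 0 := by exact_mod_cast hε.ne'
    have hse : (√ε : ℂ) * √ε = ε := by rw [← Complex.ofReal_mul, Real.mul_self_sqrt hε.le]
    rw [K, ofReal_q]
    simp only [map_smul, smul_apply, Complex.real_smul]
    rw [← mul_assoc, ← Complex.ofReal_mul]
    congr 1
    · congr 1
      rw [mul_comm D.c, ← mul_assoc, ← Real.rpow_add hε, neg_div, add_neg_cancel, Real.rpow_zero,
        one_mul]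
    · congr 2
      rw [← mul_assoc, hse]
      field_simp
  have hev : ∀ᶠ ε : ℝ in 𝓝[>] 0, ε ∈ Ioc (0 : ℝ) 1 := Ioc_mem_nhdsGT one_pos
  have hgoal : Tendsto (fun ε : ℝ => ∫ ζ, ((ε ^ ((n : ℝ) / 2) : ℝ) : ℂ) * D.K ε (√ε • ζ) *
      f (√ε • ζ)) (𝓝[>] 0) (𝓝 (∫ ζ, ((D.c * Real.exp (-(D.q ζ / 4)) : ℝ) : ℂ) * f0 ζ)) := by
    refine tendsto_integral_filter_of_dominated_convergence (fun ζ => C * D.g 1 ζ * M) ?_ ?_ ?_ ?_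
    · refine Eventually.of_forall fun ε => ?_
      have h1 : Measurable fun ζ : E n => D.K ε (√ε • ζ) :=
        ((D.contDiff_K ε).continuous.comp (continuous_const_smul _)).measurable
      have h2 : Measurable fun ζ : E n => f (√ε • ζ) := hfm.comp (measurable_const_smul _)
      exact ((h1.const_mul _).mul h2).aestronglyMeasurable
    · filter_upwards [hev] with ε hε
      refine Eventually.of_forall fun ζ => ?_
      have hε0 := hε.1
      rw [norm_mul, norm_mul, Complex.norm_real, Real.norm_of_nonneg (by positivity)]
      have h1 := hC ε hε (√ε • ζ)
      have h2 : ε ^ ((n : ℝ) / 2) * D.g ε (√ε • ζ) = D.g 1 ζ := by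
        rw [g, g, gauss, gauss, norm_smul, Real.norm_of_nonneg (Real.sqrt_nonneg _), mul_pow,
          Real.sq_sqrt hε0.le, ← mul_assoc, ← Real.rpow_add hε0, neg_div, add_neg_cancel,
          Real.rpow_zero, Real.one_rpow]
        congr 4
        field_simp
      have h3 : ε ^ ((n : ℝ) / 2) * ‖D.K ε (√ε • ζ)‖ ≤ C * D.g 1 ζ := by
        calc _ ≤ ε ^ ((n : ℝ) / 2) * (C * D.g ε (√ε • ζ)) := by gcongr
          _ = C * (ε ^ ((n : ℝ) / 2) * D.g ε (√ε • ζ)) := by ring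
          _ = _ := by rw [h2]
      exact mul_le_mul h3 (hM _) (norm_nonneg _) (mul_nonneg hC0 (D.g_nonneg one_pos ζ))
    · exact ((D.integrable_g one_pos).const_mul C).mul_const M
    · filter_upwards [hf0] with ζ hζ
      refine Tendsto.mul ?_ hζ
      have h1 : Tendsto (fun ε : ℝ => (D.c : ℂ) * Complex.exp (D.κ * ε - √ε * D.bl ζ - D.q ζ / 4))
          (𝓝 0) (𝓝 (D.c * Complex.exp (D.κ * (0 : ℝ) - √(0 : ℝ) * D.bl ζ - D.q ζ / 4))) := by
        have : Continuous (fun ε : ℝ => (D.c : ℂ) *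
          Complex.exp (D.κ * ε - √ε * D.bl ζ - D.q ζ / 4)) := by fun_prop
        exact this.tendsto 0
      have h2 : (D.c : ℂ) * Complex.exp (D.κ * (0 : ℝ) - √(0 : ℝ) * D.bl ζ - D.q ζ / 4) =
          ((D.c * Real.exp (-(D.q ζ / 4)) : ℝ) : ℂ) := by
        push_cast
        simp
      rw [h2] at h1
      refine (h1.mono_left nhdsWithin_le_nhds).congr' ?_
      filter_upwards [self_mem_nhdsWithin] with ε hε using (hscaled ε hε ζ).symm
  refine hgoal.congr' ?_
  filter_upwards [self_mem_nhdsWithin] with ε hε using (hscale ε hε).symm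

theorem integral_Kt_eq {f : E n → ℂ} {M : ℝ} (hfm : Measurable f) (hM : ∀ x, ‖f x‖ ≤ M) {ε : ℝ}
    (hε : ε ∈ Ioc (0 : ℝ) 1) :
    ∫ t in ε..1, (∫ x, D.Kt t x * f x) = (∫ x, D.K 1 x * f x) - ∫ x, D.K ε x * f x := by
  obtain ⟨C, hC0, hC⟩ := D.exists_kernel_bounds
  have hε0 := hε.1
  have hM0 : 0 ≤ M := (norm_nonneg _).trans (hM 0)
  have hI0 : Ioc ε 1 ⊆ Ioi 0 := fun t ht => hε.1.trans ht.1
  have hint : Integrable (fun z : ℝ × E n => D.Kt z.1 z.2 * f z.2)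
      ((volume.restrict (Ioc ε 1)).prod volume) := by
    refine D.integrable_prod_of_le_g measurableSet_Ioc hI0 ?_ (w := fun _ => C * ε⁻¹ * M)
      (integrableOn_const (by simp)) fun t ht x => ?_
    · exact (aestronglyMeasurable_prod measurableSet_Ioc hI0 D.continuousOn_uncurry_Kt).mul
        (hfm.comp measurable_snd).aestronglyMeasurable
    · have ht0 : 0 < t := hI0 ht
      have h1 := (hC t ⟨ht0, ht.2⟩ x).2.2.2
      have h2 : t⁻¹ ≤ ε⁻¹ := inv_anti₀ hε0 ht.1.le
      have hg := D.g_nonneg ht0 x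
      rw [norm_mul]
      calc ‖D.Kt t x‖ * ‖f x‖ ≤ (C * (ε⁻¹ * D.g t x)) * M := by
            refine mul_le_mul (h1.trans ?_) (hM x) (norm_nonneg _) (by positivity)
            gcongr
        _ = _ := by ring
  rw [intervalIntegral.integral_of_le hε.2, integral_integral_swap hint,
    ← integral_sub ((D.integrable_K ⟨one_pos, le_rfl⟩).mul_bdd hfm.aestronglyMeasurable
      (Eventually.of_forall hM)) ((D.integrable_K hε).mul_bdd hfm.aestronglyMeasurable
      (Eventually.of_forall hM))]
  congr 1 with x
  rw [integral_mul_const, ← sub_mul]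
  congr 1
  rw [← intervalIntegral.integral_of_le hε.2]
  refine intervalIntegral.integral_eq_sub_of_hasDerivAt (f := fun t => D.K t x) (fun t ht => ?_) ?_
  · rw [uIcc_of_le hε.2] at ht
    exact D.hasDerivAt_K (hε.1.trans_le ht.1) x
  · refine ContinuousOn.intervalIntegrable ?_
    refine D.continuousOn_uncurry_Kt.comp (f := fun t : ℝ => (t, x))
      (continuousOn_id.prodMk continuousOn_const) fun t ht => ⟨?_, mem_univ _⟩
    rw [uIcc_of_le hε.2] at ht
    exact hε.1.trans_le ht.1

/-- The fundamental theorem of calculus for `t ↦ ∫ K_t f` on `(0, 1]`. -/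
theorem integral_time_eq {f f0 : E n → ℂ} {M : ℝ} (hfm : Measurable f) (hM : ∀ x, ‖f x‖ ≤ M)
    (hf0 : ∀ᵐ ζ : E n, Tendsto (fun ε : ℝ => f (√ε • ζ)) (𝓝[>] 0) (𝓝 (f0 ζ))) {J : ℝ → ℂ}
    (hJ : IntegrableOn J (Ioc 0 1)) (hJf : ∀ t ∈ Ioc (0 : ℝ) 1, J t = ∫ x, D.Kt t x * f x) :
    ∫ t in Ioc (0 : ℝ) 1, J t = (∫ x, D.K 1 x * f x) -
      ∫ ζ, ((D.c * Real.exp (-(D.q ζ / 4)) : ℝ) : ℂ) * f0 ζ := by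
  -- Integrability of `J` up to `0` is a hypothesis because the bound for `Kt` is only of order
  -- `t⁻¹`; each application obtains it from another expression for `J`.
  have h1 : Tendsto (fun ε => ∫ t in ε..1, J t) (𝓝[>] 0) (𝓝 (∫ t in (0 : ℝ)..1, J t)) := by
    have hint : IntervalIntegrable J volume 0 1 := by
      rwa [intervalIntegrable_iff_integrableOn_Ioc_of_le zero_le_one]
    have h := intervalIntegral.continuousOn_primitive_interval' hint (right_mem_uIcc)
    have h2 := (h 0 left_mem_uIcc).tendsto
    rw [uIcc_of_le zero_le_one] at h2
    have h3 : Tendsto (fun ε => ∫ t in (1 : ℝ)..ε, J t) (𝓝[>] 0) (𝓝 (∫ t in (1 : ℝ)..0, J t)) := by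
      refine h2.mono_left ?_
      rw [nhdsWithin_le_iff]
      filter_upwards [Ioc_mem_nhdsGT (one_pos : (0 : ℝ) < 1)] with ε hε using ⟨hε.1.le, hε.2⟩
    rw [intervalIntegral.integral_symm]
    refine h3.neg.congr fun ε => ?_
    rw [← intervalIntegral.integral_symm]
  have h2 : Tendsto (fun ε => ∫ t in ε..1, J t) (𝓝[>] 0) (𝓝 ((∫ x, D.K 1 x * f x) -
      ∫ ζ, ((D.c * Real.exp (-(D.q ζ / 4)) : ℝ) : ℂ) * f0 ζ)) := by
    refine (tendsto_const_nhds.sub (D.tendsto_integral_K hfm hM hf0)).congr' ?_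
    filter_upwards [Ioc_mem_nhdsGT (one_pos : (0 : ℝ) < 1)] with ε hε
    rw [← D.integral_Kt_eq hfm hM hε]
    refine intervalIntegral.integral_congr_ae (Eventually.of_forall fun t ht => ?_)
    rw [uIoc_of_le hε.2] at ht
    exact (hJf t ⟨hε.1.trans ht.1, ht.2⟩).symm
  rw [← intervalIntegral.integral_of_le zero_le_one]
  exact tendsto_nhds_unique h1 h2

theorem integral_profile : ∫ ζ : E n, ((D.c * Real.exp (-(D.q ζ / 4)) : ℝ) : ℂ) = 1 := by
  rw [integral_complex_ofReal, integral_const_mul, D.c_mul_integral, Complex.ofReal_one]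

/-- The profile is even and has mass one, and the bounding hyperplane is a null set. This is the
source of the jump constant `1/2`. -/
theorem integral_profile_halfSpace {v : E n} (hv : v ≠ 0) :
    ∫ ζ : E n, ((D.c * Real.exp (-(D.q ζ / 4)) : ℝ) : ℂ) *
      {ζ | 0 < inner ℝ ζ v}.indicator (fun _ => (1 : ℂ)) ζ = 1 / 2 := by
  set p : E n → ℂ := fun ζ => ((D.c * Real.exp (-(D.q ζ / 4)) : ℝ) : ℂ) with hp
  have hpi : Integrable p := (D.integrable_exp_q.const_mul D.c).ofReal
  have hpe : ∀ ζ, p (-ζ) = p ζ := by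
    intro ζ
    simp [hp, q]
  have hH : MeasurableSet {ζ : E n | 0 < inner ℝ ζ v} :=
    (isOpen_lt continuous_const (by fun_prop)).measurableSet
  have hH' : MeasurableSet {ζ : E n | inner ℝ ζ v < 0} :=
    (isOpen_lt (by fun_prop) continuous_const).measurableSet
  have hsymm : ∫ ζ in {ζ : E n | inner ℝ ζ v < 0}, p ζ = ∫ ζ in {ζ : E n | 0 < inner ℝ ζ v}, p ζ := by
    rw [← integral_indicator hH, ← integral_indicator hH', ← integral_neg_eq_self]
    congr 1 with ζ
    simp only [indicator_apply, mem_ofPred_eq, inner_neg_left, hpe, neg_lt_zero]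
  have hsplit : ∫ ζ, p ζ = (∫ ζ in {ζ : E n | 0 < inner ℝ ζ v}, p ζ) +
      ∫ ζ in {ζ : E n | inner ℝ ζ v < 0}, p ζ := by
    rw [← integral_add_compl hH hpi]
    congr 1
    refine setIntegral_congr_set ?_
    filter_upwards [ae_inner_ne_zero hv] with ζ hζ
    refine propext ⟨fun h => lt_of_le_of_ne (not_lt.mp h) hζ, fun h => not_lt.mpr (le_of_lt h)⟩
  rw [hsymm, D.integral_profile] at hsplit
  have : ∫ ζ, p ζ * {ζ | 0 < inner ℝ ζ v}.indicator (fun _ => (1 : ℂ)) ζ =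
      ∫ ζ in {ζ : E n | 0 < inner ℝ ζ v}, p ζ := by
    rw [← integral_indicator hH]
    congr 1 with ζ
    by_cases h : ζ ∈ {ζ : E n | 0 < inner ℝ ζ v}
    · rw [indicator_of_mem h, indicator_of_mem h, mul_one]
    · rw [indicator_of_notMem h, indicator_of_notMem h, mul_zero]
  rw [this]
  linear_combination (1 / 2) * hsplit.symm

end HeatData

end DoubleLayer

namespace DoubleLayer

open MeasureTheory Set Filter Topology
open scoped Convolution

/-! ### Partial derivatives and the operator on smooth functions -/

section PartialDerivatives

variable {n : ℕ}

theorem pd_const_mul (j : Fin n) (c : ℂ) (u : E n → ℂ) :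
    pd j (fun z => c * u z) = fun x => c * pd j u x := by
  funext x
  have h : fderiv ℝ (c • u) = c • fderiv ℝ u := fderiv_const_smul_field c
  have h2 : (fun z => c * u z) = c • u := rfl
  rw [pd, h2, h]
  rfl

theorem Coeffs.op_eq (a : Coeffs n) (u : E n → ℂ) (x : E n) : a.op u x =
    (∑ l, ∑ j, a.a2 l j * pd l (pd j u) x) + (∑ l, a.a1 l * pd l u x) + a.a0 * u x := by
  simp only [Coeffs.op]
  congr 2
  refine Finset.sum_congr rfl fun l _ => Finset.sum_congr rfl fun j _ => ?_
  exact congrFun (pd_const_mul l (a.a2 l j) (pd j u)) x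

theorem contDiff_pd (j : Fin n) {u : E n → ℂ} (hu : ContDiff ℝ ∞ u) : ContDiff ℝ ∞ (pd j u) :=
  (hu.fderiv_right (m := ∞) (by simp)).clm_apply contDiff_const

theorem hasCompactSupport_pd (j : Fin n) {u : E n → ℂ} (hu : HasCompactSupport u) :
    HasCompactSupport (pd j u) :=
  (hu.fderiv ℝ).mono fun x hx => by
    intro h; apply hx; simp only [pd]; rw [h]; rfl

theorem pd_add (j : Fin n) {u v : E n → ℂ} (hu : Differentiable ℝ u) (hv : Differentiable ℝ v) :
    pd j (fun z => u z + v z) = fun x => pd j u x + pd j v x := by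
  funext x
  simp only [pd]
  rw [fderiv_fun_add (hu x) (hv x)]
  rfl

theorem pd_mul (j : Fin n) {u v : E n → ℂ} (hu : Differentiable ℝ u) (hv : Differentiable ℝ v) :
    pd j (fun z => u z * v z) = fun x => pd j u x * v x + u x * pd j v x := by
  funext x
  simp only [pd]
  rw [fderiv_fun_mul (hu x) (hv x)]
  simp only [add_apply, smul_apply, smul_eq_mul]
  ring

theorem pd_comp_add_right (j : Fin n) (u : E n → ℂ) (y : E n) :
    pd j (fun z => u (z + y)) = fun x => pd j u (x + y) := by
  funext x
  simp only [pd]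
  rw [fderiv_comp_add_right]

theorem Coeffs.op_comp_add_right (a : Coeffs n) (u : E n → ℂ) (x y : E n) :
    a.op (fun z => u (z + y)) x = a.op u (x + y) := by
  simp only [Coeffs.op_eq, pd_comp_add_right]

theorem Coeffs.contDiff_op (a : Coeffs n) {u : E n → ℂ} (hu : ContDiff ℝ ∞ u) :
    ContDiff ℝ ∞ (a.op u) := by
  have h : a.op u = fun x => (∑ l, ∑ j, a.a2 l j * pd l (pd j u) x) +
    (∑ l, a.a1 l * pd l u x) + a.a0 * u x := funext fun x => a.op_eq u x
  rw [h]
  refine ((ContDiff.sum fun l _ => ContDiff.sum fun j _ => ?_).add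
    (ContDiff.sum fun l _ => ?_)).add (contDiff_const.mul hu)
  · exact contDiff_const.mul (contDiff_pd l (contDiff_pd j hu))
  · exact contDiff_const.mul (contDiff_pd l hu)

theorem tsupport_pd_subset (j : Fin n) (u : E n → ℂ) : tsupport (pd j u) ⊆ tsupport u := by
  refine closure_minimal (fun x hx => ?_) isClosed_closure
  by_contra h
  have h1 : x ∉ tsupport (fderiv ℝ u) := fun h' => h (tsupport_fderiv_subset ℝ h')
  apply hx
  simp only [pd]
  rw [image_eq_zero_of_notMem_tsupport (f := fderiv ℝ u) (x := x) h1]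
  rfl

theorem Coeffs.hasCompactSupport_op (a : Coeffs n) {u : E n → ℂ} (hu : HasCompactSupport u) :
    HasCompactSupport (a.op u) := by
  refine HasCompactSupport.intro hu fun x hx => ?_
  have h0 : u x = 0 := image_eq_zero_of_notMem_tsupport (f := u) (x := x) hx
  have h1 : ∀ l, pd l u x = 0 := fun l =>
    image_eq_zero_of_notMem_tsupport (f := pd l u) (x := x) fun h => hx (tsupport_pd_subset l u h)
  have h2 : ∀ l j, pd l (pd j u) x = 0 := fun l j =>
    image_eq_zero_of_notMem_tsupport (f := pd l (pd j u)) (x := x) fun h =>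
      hx (tsupport_pd_subset j u (tsupport_pd_subset l _ h))
  simp [Coeffs.op_eq, h0, h1, h2]

/-- In the Leibniz rule the zero order term must be counted once, whence `- a₀ χ`, and the symmetry
of the matrix merges the two mixed sums. -/
theorem Coeffs.op_mul (a : Coeffs n) {χ φ : E n → ℂ} (hχ : ContDiff ℝ ∞ χ)
    (hφ : ContDiff ℝ ∞ φ) (x : E n) : a.op (fun z => χ z * φ z) x =
    χ x * a.op φ x + (a.op χ x - a.a0 * χ x) * φ x +
      2 * ∑ j, (∑ l, a.a2 l j * pd l χ x) * pd j φ x := by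
  have d : ∀ {u : E n → ℂ}, ContDiff ℝ ∞ u → Differentiable ℝ u := fun h =>
    h.differentiable (by simp)
  have h1 : ∀ j, pd j (fun z => χ z * φ z) = fun z => pd j χ z * φ z + χ z * pd j φ z :=
    fun j => pd_mul j (d hχ) (d hφ)
  have h2 : ∀ l j, pd l (pd j (fun z => χ z * φ z)) x = pd l (pd j χ) x * φ x +
      pd j χ x * pd l φ x + (pd l χ x * pd j φ x + χ x * pd l (pd j φ) x) := by
    intro l j
    rw [h1, pd_add l (u := fun z => pd j χ z * φ z) (v := fun z => χ z * pd j φ z)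
        ((d (contDiff_pd j hχ)).mul (d hφ)) ((d hχ).mul (d (contDiff_pd j hφ))),
      pd_mul l (d (contDiff_pd j hχ)) (d hφ), pd_mul l (d hχ) (d (contDiff_pd j hφ))]
  have h3 : ∑ l, ∑ j, a.a2 l j * (pd j χ x * pd l φ x) =
      ∑ l, ∑ j, a.a2 l j * (pd l χ x * pd j φ x) := by
    rw [Finset.sum_comm]
    refine Finset.sum_congr rfl fun l _ => Finset.sum_congr rfl fun j _ => ?_
    rw [a.symm.apply]
  have h4 : ∑ j, (∑ l, a.a2 l j * pd l χ x) * pd j φ x =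
      ∑ l, ∑ j, a.a2 l j * (pd l χ x * pd j φ x) := by
    rw [Finset.sum_comm]
    refine Finset.sum_congr rfl fun j _ => ?_
    rw [Finset.sum_mul]
    exact Finset.sum_congr rfl fun l _ => by ring
  rw [h4]
  simp only [Coeffs.op_eq, h2]
  simp only [h1]
  have h5 : ∑ l, ∑ j, a.a2 l j * (pd l (pd j χ) x * φ x + pd j χ x * pd l φ x +
      (pd l χ x * pd j φ x + χ x * pd l (pd j φ) x)) =
      (∑ l, ∑ j, a.a2 l j * pd l (pd j χ) x) * φ x + χ x * (∑ l, ∑ j, a.a2 l j * pd l (pd j φ) x) +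
      2 * ∑ l, ∑ j, a.a2 l j * (pd l χ x * pd j φ x) := by
    rw [two_mul]
    nth_rewrite 2 [← h3]
    simp only [Finset.sum_mul, Finset.mul_sum, ← Finset.sum_add_distrib]
    exact Finset.sum_congr rfl fun l _ => Finset.sum_congr rfl fun j _ => by ring
  have h6 : ∑ l, a.a1 l * (pd l χ x * φ x + χ x * pd l φ x) =
      (∑ l, a.a1 l * pd l χ x) * φ x + χ x * ∑ l, a.a1 l * pd l φ x := by
    simp only [Finset.sum_mul, Finset.mul_sum, ← Finset.sum_add_distrib]
    exact Finset.sum_congr rfl fun l _ => by ring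
  rw [h5, h6]
  ring

theorem integral_sum_add_sum_add {F2 : Fin n → Fin n → E n → ℂ} {F1 : Fin n → E n → ℂ}
    {F0 : E n → ℂ} (I2 : ∀ l j, Integrable (F2 l j)) (I1 : ∀ l, Integrable (F1 l))
    (I0 : Integrable F0) : ∫ x, (∑ l, ∑ j, F2 l j x) + (∑ l, F1 l x) + F0 x =
      (∑ l, ∑ j, ∫ x, F2 l j x) + (∑ l, ∫ x, F1 l x) + ∫ x, F0 x := by
  have J2 : ∀ l, Integrable fun x => ∑ j, F2 l j x := fun l =>
    integrable_finsetSum _ fun j _ => I2 l j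
  have J2' : Integrable fun x => ∑ l, ∑ j, F2 l j x := integrable_finsetSum _ fun l _ => J2 l
  have J1 : Integrable fun x => ∑ l, F1 l x := integrable_finsetSum _ fun l _ => I1 l
  have J21 : Integrable fun x => (∑ l, ∑ j, F2 l j x) + ∑ l, F1 l x := J2'.add J1
  rw [integral_add J21 I0, integral_add J2' J1, integral_finsetSum _ fun l _ => J2 l,
    integral_finsetSum _ fun l _ => I1 l]
  congr 2
  exact Finset.sum_congr rfl fun l _ => integral_finsetSum _ fun j _ => I2 l j

/-- Integration by parts against a compactly supported function. -/
theorem integral_mul_pd (j : Fin n) {u φ : E n → ℂ} (hu : ContDiff ℝ 1 u) (hφ : ContDiff ℝ 1 φ)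
    (hc : HasCompactSupport φ) : ∫ x, u x * pd j φ x = -∫ x, pd j u x * φ x := by
  have cu : Continuous fun x => pd j u x := (hu.continuous_fderiv (by simp)).clm_apply continuous_const
  have cφ : Continuous fun x => pd j φ x := (hφ.continuous_fderiv (by simp)).clm_apply continuous_const
  refine integral_mul_fderiv_eq_neg_fderiv_mul_of_integrable ?_ ?_ ?_
    (fun x _ => hu.differentiable (by simp) x) (fun x _ => hφ.differentiable (by simp) x)
  · exact (cu.mul hφ.continuous).integrable_of_hasCompactSupport hc.mul_left
  · exact (hu.continuous.mul cφ).integrable_of_hasCompactSupport (hasCompactSupport_pd j hc).mul_left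
  · exact (hu.continuous.mul hφ.continuous).integrable_of_hasCompactSupport hc.mul_left

theorem Coeffs.integral_mul_transpose_op (a : Coeffs n) {u φ : E n → ℂ} (hu : ContDiff ℝ ∞ u)
    (hφ : ContDiff ℝ ∞ φ) (hc : HasCompactSupport φ) :
    ∫ x, u x * a.transpose.op φ x = ∫ x, a.op u x * φ x := by
  have o : ∀ {v : E n → ℂ}, ContDiff ℝ ∞ v → ContDiff ℝ 1 v := fun h => h.of_le (by simp)
  have i : ∀ {v w : E n → ℂ}, ContDiff ℝ ∞ v → ContDiff ℝ ∞ w → HasCompactSupport w →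
      Integrable fun x => v x * w x := fun hv hw hcw =>
    (hv.continuous.mul hw.continuous).integrable_of_hasCompactSupport hcw.mul_left
  have h1 : ∀ l, ∫ x, u x * pd l φ x = -∫ x, pd l u x * φ x := fun l =>
    integral_mul_pd l (o hu) (o hφ) hc
  have h2 : ∀ l j, ∫ x, u x * pd l (pd j φ) x = ∫ x, pd j (pd l u) x * φ x := by
    intro l j
    rw [integral_mul_pd l (o hu) (o (contDiff_pd j hφ)) (hasCompactSupport_pd j hc),
      integral_mul_pd j (o (contDiff_pd l hu)) (o hφ) hc, neg_neg]
  have e1 : ∀ x, u x * a.transpose.op φ x = (∑ l, ∑ j, a.a2 l j * (u x * pd l (pd j φ) x)) +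
      (∑ l, -a.a1 l * (u x * pd l φ x)) + a.a0 * (u x * φ x) := by
    intro x
    simp only [Coeffs.op_eq, Coeffs.transpose, mul_add, Finset.mul_sum]
    refine congrArg₂ _ (congrArg₂ _ ?_ ?_) (by ring)
    · exact Finset.sum_congr rfl fun l _ => Finset.sum_congr rfl fun j _ => by ring
    · exact Finset.sum_congr rfl fun l _ => by ring
  have e2 : ∀ x, a.op u x * φ x = (∑ l, ∑ j, a.a2 l j * (pd j (pd l u) x * φ x)) +
      (∑ l, a.a1 l * (pd l u x * φ x)) + a.a0 * (u x * φ x) := by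
    intro x
    simp only [Coeffs.op_eq, add_mul, Finset.sum_mul, mul_assoc]
    congr 2
    rw [Finset.sum_comm]
    exact Finset.sum_congr rfl fun l _ => Finset.sum_congr rfl fun j _ => by rw [a.symm.apply]
  simp only [e1, e2]
  have I2 : ∀ l j, Integrable fun x => a.a2 l j * (u x * pd l (pd j φ) x) := fun l j =>
    (i hu (contDiff_pd l (contDiff_pd j hφ))
      (hasCompactSupport_pd l (hasCompactSupport_pd j hc))).const_mul _
  have I1 : ∀ l, Integrable fun x => -a.a1 l * (u x * pd l φ x) := fun l =>
    (i hu (contDiff_pd l hφ) (hasCompactSupport_pd l hc)).const_mul _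
  have I0 : Integrable fun x => a.a0 * (u x * φ x) := (i hu hφ hc).const_mul _
  have J2 : ∀ l j, Integrable fun x => a.a2 l j * (pd j (pd l u) x * φ x) := fun l j =>
    (i (contDiff_pd j (contDiff_pd l hu)) hφ hc).const_mul _
  have J1 : ∀ l, Integrable fun x => a.a1 l * (pd l u x * φ x) := fun l =>
    (i (contDiff_pd l hu) hφ hc).const_mul _
  rw [integral_sum_add_sum_add I2 I1 I0, integral_sum_add_sum_add J2 J1 I0]
  refine congrArg₂ _ (congrArg₂ _ ?_ ?_) rfl
  · refine Finset.sum_congr rfl fun l _ => Finset.sum_congr rfl fun j _ => ?_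
    rw [integral_const_mul, integral_const_mul, h2]
  · refine Finset.sum_congr rfl fun l _ => ?_
    rw [integral_const_mul, integral_const_mul, h1]
    ring

theorem pd_convolution (j : Fin n) {ρ φ : E n → ℂ} (hρ : LocallyIntegrable ρ)
    (hφ : ContDiff ℝ 1 φ) (hc : HasCompactSupport φ) :
    pd j (ρ ⋆[ContinuousLinearMap.mul ℝ ℂ] φ) = ρ ⋆[ContinuousLinearMap.mul ℝ ℂ] pd j φ := by
  funext x
  have h := hc.hasFDerivAt_convolution_right (ContinuousLinearMap.mul ℝ ℂ) hρ hφ x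
  simp only [pd]
  rw [h.fderiv, convolution_precompR_apply _ hρ (hc.fderiv ℝ) (hφ.continuous_fderiv (by simp))]
  rfl

/-- Constant coefficient operators commute with convolutions. -/
theorem Coeffs.op_convolution (a : Coeffs n) {ρ φ : E n → ℂ} (hρ : LocallyIntegrable ρ)
    (hφ : ContDiff ℝ ∞ φ) (hc : HasCompactSupport φ) (x : E n) :
    a.op (ρ ⋆[ContinuousLinearMap.mul ℝ ℂ] φ) x =
      (ρ ⋆[ContinuousLinearMap.mul ℝ ℂ] a.op φ) x := by
  have o : ∀ {v : E n → ℂ}, ContDiff ℝ ∞ v → ContDiff ℝ 1 v := fun h => h.of_le (by simp)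
  have i : ∀ {v : E n → ℂ}, ContDiff ℝ ∞ v → HasCompactSupport v → ∀ c : ℂ,
      Integrable fun y => c * (ρ y * v (x - y)) := fun {v} hv hcv c =>
    (hcv.convolutionExists_right (ContinuousLinearMap.mul ℝ ℂ) hρ hv.continuous x).const_mul c
  have e : ∀ y, ρ y * a.op φ (x - y) = (∑ l, ∑ j, a.a2 l j * (ρ y * pd l (pd j φ) (x - y))) +
      (∑ l, a.a1 l * (ρ y * pd l φ (x - y))) + a.a0 * (ρ y * φ (x - y)) := by
    intro y
    simp only [Coeffs.op_eq, mul_add, Finset.mul_sum]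
    refine congrArg₂ _ (congrArg₂ _ ?_ ?_) (by ring)
    · exact Finset.sum_congr rfl fun l _ => Finset.sum_congr rfl fun j _ => by ring
    · exact Finset.sum_congr rfl fun l _ => by ring
  have I2 := fun l j => i (contDiff_pd l (contDiff_pd j hφ))
    (hasCompactSupport_pd l (hasCompactSupport_pd j hc)) (a.a2 l j)
  have I1 := fun l => i (contDiff_pd l hφ) (hasCompactSupport_pd l hc) (a.a1 l)
  have I0 := i hφ hc a.a0
  have h2 : ∀ l j, pd l (pd j (ρ ⋆[ContinuousLinearMap.mul ℝ ℂ] φ)) =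
      ρ ⋆[ContinuousLinearMap.mul ℝ ℂ] pd l (pd j φ) := by
    intro l j
    rw [pd_convolution j hρ (o hφ) hc,
      pd_convolution l hρ (o (contDiff_pd j hφ)) (hasCompactSupport_pd j hc)]
  have h1 := fun l => pd_convolution l hρ (o hφ) hc
  rw [Coeffs.op_eq]
  simp only [h2]
  simp only [h1]
  simp only [convolution_def, ContinuousLinearMap.mul_apply', e]
  rw [integral_sum_add_sum_add I2 I1 I0]
  simp only [integral_const_mul]

end PartialDerivatives

end DoubleLayer

namespace DoubleLayer

open MeasureTheory Set Filter Topology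
open scoped Convolution Pointwise

/-! ### A fundamental solution is a parametrix up to a smooth function -/

section Parametrix

variable {n : ℕ}

theorem contDiff_mul_of_notMem_tsupport {v θ : E n → ℂ} (hv : ContDiffOn ℝ ∞ v {0}ᶜ)
    (hθ : ContDiff ℝ ∞ θ) (h0 : θ =ᶠ[𝓝 0] fun _ => 0) : ContDiff ℝ ∞ fun x => v x * θ x := by
  rw [contDiff_iff_contDiffAt]
  intro x
  by_cases hx : x = 0
  · subst hx
    refine (contDiffAt_const (c := (0 : ℂ))).congr_of_eventuallyEq ?_
    filter_upwards [h0] with y hy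
    rw [hy, mul_zero]
  · exact (hv.contDiffAt (isOpen_compl_singleton.mem_nhds hx)).mul hθ.contDiffAt

theorem pd_eventuallyEq (j : Fin n) {u v : E n → ℂ} {x : E n} (h : u =ᶠ[𝓝 x] v) :
    pd j u =ᶠ[𝓝 x] pd j v := by
  filter_upwards [h.fderiv (𝕜 := ℝ)] with y hy
  rw [pd, hy, pd]

theorem exists_cutoff (n : ℕ) : ∃ χ : E n → ℂ, ContDiff ℝ ∞ χ ∧ HasCompactSupport χ ∧
    χ =ᶠ[𝓝 0] fun _ => 1 := by
  let f : ContDiffBump (0 : E n) := ⟨1, 2, one_pos, one_lt_two⟩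
  refine ⟨fun x => (f x : ℂ), Complex.ofRealCLM.contDiff.comp f.contDiff,
    f.hasCompactSupport.comp_left Complex.ofReal_zero, ?_⟩
  filter_upwards [f.eventuallyEq_one] with x hx
  rw [hx]; simp

theorem pd_eventuallyEq_zero (j : Fin n) {u : E n → ℂ} {c : ℂ} {x : E n}
    (h : u =ᶠ[𝓝 x] fun _ => c) : pd j u =ᶠ[𝓝 x] fun _ => 0 := by
  refine (pd_eventuallyEq j h).trans (Eventually.of_forall fun y => ?_)
  simp [pd]

namespace HeatData

variable {a : Coeffs n} (D : HeatData a)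

/-- In the sense of distributions, `P par = -∫₀¹ ∂_t K_t dt = δ₀ - K_1`. -/
theorem integral_par_mul {φ : E n → ℂ} (hφ : ContDiff ℝ ∞ φ) (hc : HasCompactSupport φ) :
    ∫ x, D.par x * a.transpose.op φ x = φ 0 - ∫ x, D.K 1 x * φ x := by
  have hψ := (a.transpose.contDiff_op hφ).continuous
  obtain ⟨M, hM⟩ := hψ.bounded_above_of_compact_support (a.transpose.hasCompactSupport_op hc)
  obtain ⟨M', hM'⟩ := hφ.continuous.bounded_above_of_compact_support hc
  have hint : Integrable (fun z : ℝ × E n => D.K z.1 z.2 * a.transpose.op φ z.2)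
      ((volume.restrict (Ioc (0 : ℝ) 1)).prod volume) :=
    D.integrable_uncurry_K.mul_bdd (hψ.comp continuous_snd).aestronglyMeasurable
      (Eventually.of_forall fun z => hM z.2)
  have h1 : ∫ x, D.par x * a.transpose.op φ x =
      -∫ t in Ioc (0 : ℝ) 1, ∫ x, D.K t x * a.transpose.op φ x := by
    rw [integral_integral_swap hint, ← integral_neg]
    congr 1 with x
    rw [integral_mul_const, par, neg_mul]
  have h2 := D.integral_time_eq hφ.continuous.measurable hM' (f0 := fun _ => φ 0)
    (J := fun t => ∫ x, D.K t x * a.transpose.op φ x) ?_ hint.integral_prod_left ?_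
  · rw [h1, h2, integral_mul_const, D.integral_profile]
    ring
  · refine Eventually.of_forall fun ζ => ?_
    have h : Continuous fun ε : ℝ => φ (√ε • ζ) := hφ.continuous.comp (by fun_prop)
    have := (h.tendsto 0).mono_left (nhdsWithin_le_nhds (s := Ioi 0))
    simpa using this
  · intro t ht
    rw [a.integral_mul_transpose_op (D.contDiff_K t) hφ hc]
    congr 1 with x
    rw [D.op_K ht.1.ne']

/-- A truncation of `par` inverts the operator up to a smoothing one. -/
theorem exists_truncation (hn : 1 ≤ n) : ∃ χ h : E n → ℂ, ContDiff ℝ ∞ χ ∧ HasCompactSupport χ ∧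
    χ =ᶠ[𝓝 0] (fun _ => 1) ∧ ContDiff ℝ ∞ h ∧ HasCompactSupport h ∧
    ∀ φ : E n → ℂ, ContDiff ℝ ∞ φ → HasCompactSupport φ →
      ∫ x, (χ x * D.par x) * a.transpose.op φ x = φ 0 + ∫ x, h x * φ x := by
  obtain ⟨χ, hχ, hχc, hχ1⟩ := exists_cutoff n
  set b := a.transpose with hb
  set θ0 : E n → ℂ := fun x => b.op χ x - b.a0 * χ x with hθ0
  set θ : Fin n → E n → ℂ := fun j x => ∑ l, b.a2 l j * pd l χ x with hθ
  have hθ0s : ContDiff ℝ ∞ θ0 := (b.contDiff_op hχ).sub (contDiff_const.mul hχ)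
  have hθs : ∀ j, ContDiff ℝ ∞ (θ j) := fun j =>
    ContDiff.sum fun l _ => contDiff_const.mul (contDiff_pd l hχ)
  have hp : ∀ l, pd l χ =ᶠ[𝓝 0] fun _ => 0 := fun l => pd_eventuallyEq_zero l hχ1
  have hpp : ∀ l j, pd l (pd j χ) =ᶠ[𝓝 0] fun _ => 0 := fun l j => pd_eventuallyEq_zero l (hp j)
  have hθ00 : θ0 =ᶠ[𝓝 0] fun _ => 0 := by
    filter_upwards [eventually_all.mpr hp, eventually_all.mpr fun l => eventually_all.mpr (hpp l)]
      with x h1 h2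
    simp [hθ0, Coeffs.op_eq, h1, h2]
  have hθ_zero : ∀ j, θ j =ᶠ[𝓝 0] fun _ => 0 := fun j => by
    filter_upwards [eventually_all.mpr hp] with x h1
    simp [hθ, h1]
  have hη0 : ContDiff ℝ ∞ fun x => D.par x * θ0 x :=
    contDiff_mul_of_notMem_tsupport (D.contDiffOn_par hn) hθ0s hθ00
  have hη : ∀ j, ContDiff ℝ ∞ fun x => D.par x * θ j x := fun j =>
    contDiff_mul_of_notMem_tsupport (D.contDiffOn_par hn) (hθs j) (hθ_zero j)
  have hθ0c : HasCompactSupport θ0 := by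
    refine HasCompactSupport.intro ((b.hasCompactSupport_op hχc).union hχc) fun x hx => ?_
    rw [mem_union, not_or] at hx
    have h1 : b.op χ x = 0 := image_eq_zero_of_notMem_tsupport (f := b.op χ) (x := x) hx.1
    have h2 : χ x = 0 := image_eq_zero_of_notMem_tsupport (f := χ) (x := x) hx.2
    simp [hθ0, h1, h2]
  have hpz : ∀ l x, x ∉ tsupport χ → pd l χ x = 0 := fun l x hx =>
    image_eq_zero_of_notMem_tsupport (f := pd l χ) (x := x) fun h => hx (tsupport_pd_subset l χ h)
  have hθc : ∀ j, HasCompactSupport (θ j) := fun j =>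
    HasCompactSupport.intro hχc fun x hx => by simp [hθ, hpz _ x hx]
  have hηjc : ∀ j, HasCompactSupport fun x => D.par x * θ j x := fun j => (hθc j).mul_left
  -- Besides `-K_1 χ`, the function `h` collects the commutator of the transposed operator with `χ`,
  -- its first order part moved off `φ` by integration by parts. It is smooth because `θ0` and `θ j`
  -- vanish near the singularity of `par`.
  refine ⟨χ, fun x => -(D.K 1 x * χ x) - D.par x * θ0 x +
    2 * ∑ j, pd j (fun x => D.par x * θ j x) x, hχ, hχc, hχ1, ?_, ?_, ?_⟩
  · exact (((D.contDiff_K 1).mul hχ).neg.sub hη0).add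
      (contDiff_const.mul (ContDiff.sum fun j _ => contDiff_pd j (hη j)))
  · have hcomp : IsCompact (tsupport χ ∪ tsupport θ0 ∪ ⋃ j, tsupport (θ j)) :=
      (hχc.union hθ0c).union (isCompact_iUnion fun j => hθc j)
    refine HasCompactSupport.intro hcomp fun x hx => ?_
    simp only [mem_union, mem_iUnion, not_or, not_exists] at hx
    have h1 : χ x = 0 := image_eq_zero_of_notMem_tsupport (f := χ) (x := x) hx.1.1
    have h2 : θ0 x = 0 := image_eq_zero_of_notMem_tsupport (f := θ0) (x := x) hx.1.2
    have h3 : ∀ j, pd j (fun x => D.par x * θ j x) x = 0 := fun j =>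
      image_eq_zero_of_notMem_tsupport (f := pd j (fun x => D.par x * θ j x)) (x := x) fun h =>
        hx.2 j (tsupport_mul_subset_right (f := D.par) (g := θ j) (tsupport_pd_subset j _ h))
    simp [h1, h2, h3]
  · intro φ hφ hc
    have o : ∀ {v : E n → ℂ}, ContDiff ℝ ∞ v → ContDiff ℝ 1 v := fun h => h.of_le (by simp)
    have e : ∀ x, (χ x * D.par x) * b.op φ x = D.par x * b.op (fun z => χ z * φ z) x -
        (D.par x * θ0 x) * φ x - 2 * ∑ j, (D.par x * θ j x) * pd j φ x := by
      intro x
      rw [b.op_mul hχ hφ]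
      have : ∑ j, (D.par x * θ j x) * pd j φ x = D.par x * ∑ j, θ j x * pd j φ x := by
        rw [Finset.mul_sum]
        exact Finset.sum_congr rfl fun j _ => by ring
      rw [this]
      simp only [hθ0, hθ]
      ring
    have hχφ : ContDiff ℝ ∞ fun z => χ z * φ z := hχ.mul hφ
    have hχφc : HasCompactSupport fun z => χ z * φ z := hc.mul_left
    have hop := (b.contDiff_op hχφ).continuous
    obtain ⟨M, hM⟩ := hop.bounded_above_of_compact_support (b.hasCompactSupport_op hχφc)
    have I1 : Integrable fun x => D.par x * b.op (fun z => χ z * φ z) x :=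
      D.integrable_par.mul_bdd hop.aestronglyMeasurable (Eventually.of_forall hM)
    have i : ∀ {v w : E n → ℂ}, ContDiff ℝ ∞ v → ContDiff ℝ ∞ w → HasCompactSupport w →
        Integrable fun x => v x * w x := fun hv hw hcw =>
      (hv.continuous.mul hw.continuous).integrable_of_hasCompactSupport hcw.mul_left
    have I2 : Integrable fun x => (D.par x * θ0 x) * φ x := i hη0 hφ hc
    have I3 : ∀ j, Integrable fun x => (D.par x * θ j x) * pd j φ x := fun j =>
      i (hη j) (contDiff_pd j hφ) (hasCompactSupport_pd j hc)
    have I3s : Integrable fun x => ∑ j, (D.par x * θ j x) * pd j φ x :=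
      integrable_finsetSum _ fun j _ => I3 j
    have I12 : Integrable fun x => D.par x * b.op (fun z => χ z * φ z) x -
        (D.par x * θ0 x) * φ x := I1.sub I2
    have J1 : Integrable fun x => D.K 1 x * (χ x * φ x) := i (D.contDiff_K 1) hχφ hχφc
    have J1n : Integrable fun x => -(D.K 1 x * (χ x * φ x)) := J1.neg
    have J3 : ∀ j, Integrable fun x => pd j (fun x => D.par x * θ j x) x * φ x := fun j =>
      i (contDiff_pd j (hη j)) hφ hc
    have J3s : Integrable fun x => ∑ j, pd j (fun x => D.par x * θ j x) x * φ x :=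
      integrable_finsetSum _ fun j _ => J3 j
    have e' : ∀ x, (-(D.K 1 x * χ x) - D.par x * θ0 x +
        2 * ∑ j, pd j (fun x => D.par x * θ j x) x) * φ x = -(D.K 1 x * (χ x * φ x)) -
        (D.par x * θ0 x) * φ x + 2 * ∑ j, pd j (fun x => D.par x * θ j x) x * φ x := by
      intro x
      rw [← Finset.sum_mul]
      ring
    have J12 : Integrable fun x => -(D.K 1 x * (χ x * φ x)) - (D.par x * θ0 x) * φ x :=
      J1.neg.sub I2
    simp only [e, e']
    rw [integral_sub I12 (I3s.const_mul 2), integral_sub I1 I2, integral_const_mul,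
      integral_finsetSum _ fun j _ => I3 j, hb, D.integral_par_mul hχφ hχφc,
      integral_add J12 (J3s.const_mul 2), integral_sub J1n I2, integral_neg, integral_const_mul,
      integral_finsetSum _ fun j _ => J3 j]
    have h3 : ∀ j, ∫ x, (D.par x * θ j x) * pd j φ x =
        -∫ x, pd j (fun x => D.par x * θ j x) x * φ x := fun j =>
      integral_mul_pd j (o (hη j)) (o hφ) hc
    simp only [h3, Finset.sum_neg_distrib]
    rw [hχ1.self_of_nhds]
    ring

/-- The truncation `ρ = χ par` has compact support and satisfies `P ρ = δ₀ + h`. Testing `P S = δ₀`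
against the convolution of `φ` with the reflection of `ρ` gives `S + S ⋆ h = ρ` as distributions.
Here `S ⋆ h` is smooth, and so is `ρ - par` after redefinition at the origin, since `χ = 1` near it.
-/
theorem exists_contDiff_eq_par_add (hn : 1 ≤ n) {S : E n → ℂ} (hS : IsFundamentalSolution a S) :
    ∃ w : E n → ℂ, ContDiff ℝ ∞ w ∧ ∀ x, x ≠ 0 → S x = D.par x + w x := by
  obtain ⟨χ, h, hχ, hχc, hχ1, hh, hhc, hident⟩ := D.exists_truncation hn
  set ρ : E n → ℂ := fun x => χ x * D.par x with hρ
  obtain ⟨Mχ, hMχ⟩ := hχ.continuous.bounded_above_of_compact_support hχc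
  have hρi : Integrable ρ := D.integrable_par.bdd_mul hχ.continuous.aestronglyMeasurable
    (Eventually.of_forall hMχ)
  have hρc : HasCompactSupport ρ := hχc.mul_right
  have hρn : LocallyIntegrable fun x => ρ (-x) := hρi.comp_neg.locallyIntegrable
  have hρnc : HasCompactSupport fun x => ρ (-x) := hρc.comp_homeomorph (Homeomorph.neg (E n))
  set L := ContinuousLinearMap.mul ℝ ℂ with hL
  set v : E n → ℂ := S ⋆[L] h with hv
  have hvs : ContDiff ℝ ∞ v := hhc.contDiff_convolution_right L hS.locallyIntegrable hh
  obtain ⟨Mh, hMh⟩ := hh.continuous.bounded_above_of_compact_support hhc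
  have key : ∀ φ : E n → ℂ, ContDiff ℝ ∞ φ → HasCompactSupport φ →
      ∫ x, S x * φ x = ∫ x, (ρ x - v x) * φ x := by
    intro φ hφ hc
    set T : E n → ℂ := (fun x => ρ (-x)) ⋆[L] φ with hT
    have hTs : ContDiff ℝ ∞ T := hc.contDiff_convolution_right L hρn hφ
    have hTc : HasCompactSupport T := hρnc.convolution L hc
    have hconv : ∀ (f : E n → ℂ) (y : E n), ((fun x => ρ (-x)) ⋆[L] f) y = ∫ x, ρ x * f (x + y) := by
      intro f y
      rw [convolution_def, ← integral_neg_eq_self]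
      congr 1 with x
      simp [hL, add_comm]
    have hopT : ∀ y, a.transpose.op T y = φ y + ∫ z, h (z - y) * φ z := by
      intro y
      have hφy : ContDiff ℝ ∞ fun x => φ (x + y) := hφ.comp (contDiff_id.add contDiff_const)
      have hcy : HasCompactSupport fun x => φ (x + y) :=
        hc.comp_homeomorph (Homeomorph.addRight y)
      have h1 := hident _ hφy hcy
      rw [hT, a.transpose.op_convolution hρn hφ hc, hconv]
      simp only [Coeffs.op_comp_add_right, zero_add] at h1
      rw [h1, ← integral_add_right_eq_self (fun z => h (z - y) * φ z) y]
      simp only [add_sub_cancel_right]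
    have hmain := hS.integral_eq T hTs hTc
    rw [hT, hconv] at hmain
    simp only [add_zero] at hmain
    rw [← hT] at hmain
    simp only [hopT, mul_add] at hmain
    obtain ⟨Mφ, hMφ⟩ := hφ.continuous.bounded_above_of_compact_support hc
    -- As `S` is only locally integrable, Fubini is applied to its restriction to the compact set of
    -- those `y` that can contribute.
    set Z : Set (E n) := tsupport φ + -tsupport h with hZ
    have hZc : IsCompact Z := hc.isCompact.add hhc.isCompact.neg
    have hSZ : Integrable (Z.indicator S) :=
      (integrable_indicator_iff hZc.measurableSet).mpr (hS.locallyIntegrable.integrableOn_isCompact hZc)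
    have hφi : Integrable φ := hφ.continuous.integrable_of_hasCompactSupport hc
    have hzero : ∀ y z, S y * (h (z - y) * φ z) = Z.indicator S y * φ z * h (z - y) := by
      intro y z
      by_cases hy : y ∈ Z
      · rw [indicator_of_mem hy]; ring
      · rw [indicator_of_notMem hy, zero_mul, zero_mul]
        by_cases hz : z ∈ tsupport φ
        · have : z - y ∉ tsupport h := fun hzy => hy (by
            rw [hZ, Set.mem_add]
            exact ⟨z, hz, -(z - y), by simpa using hzy, by abel⟩)
          rw [image_eq_zero_of_notMem_tsupport (f := h) (x := z - y) this]; ring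
        · rw [image_eq_zero_of_notMem_tsupport (f := φ) (x := z) hz]; ring
    have hprod : Integrable (fun p : E n × E n => S p.1 * (h (p.2 - p.1) * φ p.2))
        (volume.prod volume) := by
      simp only [hzero]
      exact (hSZ.mul_prod hφi).mul_bdd
        (hh.continuous.comp (continuous_snd.sub continuous_fst)).aestronglyMeasurable
        (Eventually.of_forall fun p => hMh _)
    have hfub : ∫ y, S y * ∫ z, h (z - y) * φ z = ∫ z, v z * φ z := by
      simp only [← integral_const_mul]
      rw [integral_integral_swap hprod]
      congr 1 with z
      rw [hv, convolution_def, ← integral_mul_const]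
      congr 1 with y
      simp [hL, mul_assoc]
    have hSφ : Integrable fun x => S x * φ x := by
      have := hS.locallyIntegrable.integrable_smul_left_of_hasCompactSupport hφ.continuous hc
      simpa [mul_comm] using this
    have hSh : Integrable fun y => S y * ∫ z, h (z - y) * φ z := by
      have := hprod.integral_prod_left
      simpa only [integral_const_mul] using this
    rw [integral_add hSφ hSh, hfub] at hmain
    have hvφ : Integrable fun x => v x * φ x :=
      (hvs.continuous.mul hφ.continuous).integrable_of_hasCompactSupport hc.mul_left
    have hρφ : Integrable fun x => ρ x * φ x :=
      hρi.mul_bdd hφ.continuous.aestronglyMeasurable (Eventually.of_forall hMφ)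
    simp only [sub_mul]
    rw [integral_sub hρφ hvφ, ← hmain]
    ring
  have hae : ∀ᵐ x, S x = ρ x - v x := by
    refine ae_eq_of_integral_contDiff_smul_eq hS.locallyIntegrable
      (hρi.locallyIntegrable.sub hvs.continuous.locallyIntegrable) fun g hg hgc => ?_
    have := key (fun x => (g x : ℂ)) (Complex.ofRealCLM.contDiff.comp hg)
      (hgc.comp_left Complex.ofReal_zero)
    simpa only [Complex.real_smul, mul_comm] using this
  refine ⟨fun x => D.par x * (χ x - 1) - v x, (contDiff_mul_of_notMem_tsupport
    (D.contDiffOn_par hn) (hχ.sub contDiff_const) ?_).sub hvs, fun x hx => ?_⟩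
  · filter_upwards [hχ1] with x hx
    rw [hx, sub_self]
  · have heq := Measure.eqOn_open_of_ae_eq (ae_restrict_of_ae hae) isOpen_compl_singleton
      hS.continuousOn ((hχ.continuous.continuousOn.mul (D.contDiffOn_par hn).continuousOn).sub
        hvs.continuous.continuousOn) (show x ∈ ({0}ᶜ : Set (E n)) from hx)
    rw [heq]
    ring

end HeatData

end Parametrix

end DoubleLayer

namespace DoubleLayer

open MeasureTheory Set Filter Topology

/-! ### Conormal fluxes through the boundary -/

section Flux

variable {n : ℕ}

/-- The conormal flux `A∇k·ν + k a⁽¹⁾·ν` at `z`. -/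
def flux (a : Coeffs n) (k : E n → ℂ) (z ν : E n) : ℂ :=
  (∑ l, ∑ j, a.a2 j l * (ν l : ℂ) * pd j k z) + ∑ l, (ν l : ℂ) * a.a1 l * k z

theorem kernel_eq_neg_flux (Ω : Set (E n)) (a : Coeffs n) (S : E n → ℂ) (x y : E n) :
    kernel Ω a S x y = -flux a S (x - y) (outerNormal Ω y) := by
  rw [kernel, flux]
  ring

theorem flux_congr (a : Coeffs n) {k k' : E n → ℂ} {z : E n} (h : k =ᶠ[𝓝 z] k') (ν : E n) :
    flux a k z ν = flux a k' z ν := by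
  simp only [flux, (pd_eventuallyEq _ h).self_of_nhds, h.self_of_nhds]

theorem flux_add (a : Coeffs n) {u v : E n → ℂ} {z : E n} (hu : DifferentiableAt ℝ u z)
    (hv : DifferentiableAt ℝ v z) (ν : E n) :
    flux a (fun x => u x + v x) z ν = flux a u z ν + flux a v z ν := by
  have h : ∀ j, pd j (fun x => u x + v x) z = pd j u z + pd j v z := by
    intro j
    simp only [pd]
    rw [fderiv_fun_add hu hv]
    rfl
  simp only [flux, h, mul_add, Finset.sum_add_distrib]
  ring

theorem surfaceMeasure_singleton (hn : 2 ≤ n) (x : E n) : surfaceMeasure n {x} = 0 := by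
  have h : (0 : ℝ) < ((n - 1 : ℕ) : ℝ) := by
    have : 0 < n - 1 := by omega
    exact_mod_cast this
  have := Measure.nullSingletonClass_hausdorff (E n) h
  rw [surfaceMeasure, Measure.euclideanHausdorffMeasure]
  simp

theorem isFiniteMeasure_surfaceMeasure {Ω : Set (E n)} (hΩo : IsOpen Ω)
    (hΩb : Bornology.IsBounded Ω) (hΩ : IsC11Domain Ω) :
    IsFiniteMeasure ((surfaceMeasure n).restrict (frontier Ω)) :=
  ⟨by rw [Measure.restrict_apply_univ]; exact surfaceMeasure_frontier_lt_top hΩo hΩb hΩ⟩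

theorem isCompact_frontier {Ω : Set (E n)} (hΩb : Bornology.IsBounded Ω) :
    IsCompact (frontier Ω) :=
  Metric.isCompact_of_isClosed_isBounded isClosed_frontier
    (hΩb.closure.subset frontier_subset_closure)

theorem continuousOn_flux (a : Coeffs n) {k : E n → ℂ} (hk : ContDiff ℝ ∞ k) {Ω : Set (E n)}
    (hΩo : IsOpen Ω) (hΩ : IsC11Domain Ω) (x : E n) :
    ContinuousOn (fun y => flux a k (x - y) (outerNormal Ω y)) (frontier Ω) := by
  have hν : ∀ l, ContinuousOn (fun y => (outerNormal Ω y l : ℂ)) (frontier Ω) := fun l =>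
    Complex.continuous_ofReal.comp_continuousOn
      ((EuclideanSpace.proj (𝕜 := ℝ) l).continuous.comp_continuousOn (continuousOn_outerNormal hΩo hΩ))
  have hp : ∀ j, ContinuousOn (fun y => pd j k (x - y)) (frontier Ω) := fun j =>
    ((contDiff_pd j hk).continuous.comp (continuous_const.sub continuous_id)).continuousOn
  have hk' : ContinuousOn (fun y => k (x - y)) (frontier Ω) :=
    (hk.continuous.comp (continuous_const.sub continuous_id)).continuousOn
  exact (continuousOn_finsetSum _ fun l _ => continuousOn_finsetSum _ fun j _ =>
    (continuousOn_const.mul (hν l)).mul (hp j)).add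
    (continuousOn_finsetSum _ fun l _ => ((hν l).mul continuousOn_const).mul hk')

theorem integrableOn_frontier_of_continuousOn {Ω : Set (E n)} (hΩo : IsOpen Ω)
    (hΩb : Bornology.IsBounded Ω) (hΩ : IsC11Domain Ω) {f : E n → ℂ}
    (hf : ContinuousOn f (frontier Ω)) : IntegrableOn f (frontier Ω) (surfaceMeasure n) := by
  obtain ⟨M, hM⟩ := (isCompact_frontier hΩb).exists_bound_of_continuousOn hf
  exact IntegrableOn.of_bound (surfaceMeasure_frontier_lt_top hΩo hΩb hΩ)
    (hf.aestronglyMeasurable isClosed_frontier.measurableSet) M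
    ((ae_restrict_iff' isClosed_frontier.measurableSet).mpr (Eventually.of_forall hM))

/-- Gauss' theorem for a smooth kernel. -/
theorem integral_flux (a : Coeffs n) {k : E n → ℂ} (hk : ContDiff ℝ ∞ k) {Ω : Set (E n)}
    (hΩo : IsOpen Ω) (hΩb : Bornology.IsBounded Ω) (hΩ : IsC11Domain Ω) (x : E n) :
    ∫ y in frontier Ω, flux a k (x - y) (outerNormal Ω y) ∂(surfaceMeasure n) =
      -∫ y in Ω, (a.op k (x - y) - a.a0 * k (x - y)) := by
  -- `G` is the vector field `A∇k + k a⁽¹⁾`. Its divergence is `P k - a₀ k`, and the minus sign in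
  -- the statement comes from the reflection `y ↦ x - y`.
  set G : Fin n → E n → ℂ := fun l z => (∑ j, a.a2 l j * pd j k z) + a.a1 l * k z with hG
  have hGs : ∀ l, ContDiff ℝ ∞ (G l) := fun l =>
    (ContDiff.sum fun j _ => contDiff_const.mul (contDiff_pd j hk)).add (contDiff_const.mul hk)
  have hGx : ∀ l, ContDiff ℝ ∞ fun y => G l (x - y) := fun l =>
    (hGs l).comp (contDiff_const.sub contDiff_id)
  have e : ∀ y, flux a k (x - y) (outerNormal Ω y) =
      ∑ l, G l (x - y) * (inner ℝ (EuclideanSpace.single l (1 : ℝ)) (outerNormal Ω y) : ℂ) := by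
    intro y
    simp only [flux, hG, EuclideanSpace.inner_single_left, map_one, one_mul, add_mul,
      Finset.sum_add_distrib, Finset.sum_mul]
    congr 1
    · refine Finset.sum_congr rfl fun l _ => Finset.sum_congr rfl fun j _ => ?_
      rw [a.symm.apply]; ring
    · exact Finset.sum_congr rfl fun l _ => by ring
  have hd : ∀ l y, fderiv ℝ (fun y => G l (x - y)) y (EuclideanSpace.single l (1 : ℝ)) =
      -pd l (G l) (x - y) := by
    intro l y
    have h1 : HasFDerivAt (fun y : E n => x - y) (-ContinuousLinearMap.id ℝ (E n)) y :=
      (hasFDerivAt_id y).const_sub x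
    have h2 := (((hGs l).differentiable (by simp)) (x - y)).hasFDerivAt.comp y h1
    rw [show (fun y => G l (x - y)) = G l ∘ fun y => x - y from rfl, h2.fderiv]
    simp [pd]
  have hpG : ∀ l z, pd l (G l) z = (∑ j, a.a2 l j * pd l (pd j k) z) + a.a1 l * pd l k z := by
    intro l z
    have hj : ∀ j, DifferentiableAt ℝ (fun z => a.a2 l j * pd j k z) z := fun j =>
      ((contDiff_const.mul (contDiff_pd j hk)).differentiable (by simp)) z
    change fderiv ℝ (fun z => (∑ j, a.a2 l j * pd j k z) + a.a1 l * k z) z _ = _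
    rw [fderiv_fun_add (DifferentiableAt.fun_sum fun j _ => hj j)
      (((contDiff_const.mul hk).differentiable (by simp)) z), fderiv_fun_sum fun j _ => hj j]
    simp only [add_apply, sum_apply]
    congr 1
    · refine Finset.sum_congr rfl fun j _ => ?_
      exact congrFun (pd_const_mul l (a.a2 l j) (pd j k)) z
    · exact congrFun (pd_const_mul l (a.a1 l) k) z
  have hΩc : IsCompact (closure Ω) :=
    Metric.isCompact_of_isClosed_isBounded isClosed_closure hΩb.closure
  have hi : ∀ l, IntegrableOn (fun y => -pd l (G l) (x - y)) Ω := fun l =>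
    (((contDiff_pd l (hGs l)).continuous.comp (continuous_const.sub continuous_id)).neg.continuousOn
      |>.integrableOn_compact hΩc).mono_set subset_closure
  have hb : ∀ l, IntegrableOn (fun y => G l (x - y) *
      (inner ℝ (EuclideanSpace.single l (1 : ℝ)) (outerNormal Ω y) : ℂ)) (frontier Ω)
      (surfaceMeasure n) := fun l =>
    integrableOn_frontier_of_continuousOn hΩo hΩb hΩ
      ((hGx l).continuous.continuousOn.mul (Complex.continuous_ofReal.comp_continuousOn
        (continuousOn_const.inner (continuousOn_outerNormal hΩo hΩ))))
  simp only [e]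
  rw [integral_finsetSum _ fun l _ => hb l, ← integral_neg]
  have hsum : ∀ l, ∫ y in frontier Ω, G l (x - y) *
      (inner ℝ (EuclideanSpace.single l (1 : ℝ)) (outerNormal Ω y) : ℂ) ∂(surfaceMeasure n) =
      ∫ y in Ω, -pd l (G l) (x - y) := by
    intro l
    rw [← integral_fderiv_eq_integral_frontier hΩo hΩb hΩ ((hGx l).of_le (by simp))]
    simp only [hd]
  simp only [hsum]
  rw [← integral_finsetSum _ fun l _ => hi l]
  congr 1 with y
  simp only [hpG, Coeffs.op_eq, Finset.sum_neg_distrib, Finset.sum_add_distrib]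
  ring

namespace HeatData

variable {a : Coeffs n} (D : HeatData a)

/-- By `sum_mul_lin` the conormal derivative contributes `-a⁽¹⁾·ν/2 - z·ν/(2t)`, and the zero order
part of the flux adds `a⁽¹⁾·ν`. Only `z·ν` meets the factor `1/t`. -/
theorem flux_K (t : ℝ) (z ν : E n) : flux a (D.K t) z ν =
    D.K t z * ((1 / 2) * ∑ l, a.a1 l * (ν l : ℂ) - (inner ℝ z ν : ℂ) / (2 * t)) := by
  have h1 : ∀ l, ∑ j, a.a2 j l * (ν l : ℂ) * pd j (D.K t) z =
      D.K t z * (ν l : ℂ) * (-(a.a1 l / 2) - (z l : ℂ) / (2 * t)) := by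
    intro l
    rw [← D.sum_mul_lin, Finset.mul_sum]
    refine Finset.sum_congr rfl fun j _ => ?_
    rw [D.pd_K, a.symm.apply l j]
    ring
  have h2 : (inner ℝ z ν : ℂ) = ∑ l, (z l : ℂ) * (ν l : ℂ) := by
    rw [PiLp.inner_apply]
    push_cast
    exact Finset.sum_congr rfl fun l _ => by simp [mul_comm]
  rw [h2, Finset.sum_div, mul_sub, Finset.mul_sum, Finset.mul_sum, Finset.mul_sum, flux,
    ← Finset.sum_add_distrib, ← Finset.sum_sub_distrib]
  refine Finset.sum_congr rfl fun l _ => ?_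
  rw [h1]
  ring

theorem flux_par (hn : 1 ≤ n) {z : E n} (hz : z ≠ 0) (ν : E n) :
    flux a D.par z ν = -∫ t in Ioc (0 : ℝ) 1, flux a (D.K t) z ν := by
  have h1 : ∀ j, IntegrableOn (fun t => pd j (D.K t) z) (Ioc 0 1) := fun j =>
    (D.integrableOn_fderiv_K_time hn hz).apply_continuousLinearMap _
  have h0 := D.integrableOn_K_time hn hz
  have e : ∀ t, flux a (D.K t) z ν = (∑ l, ∑ j, a.a2 j l * (ν l : ℂ) * pd j (D.K t) z) +
      ∑ l, (ν l : ℂ) * a.a1 l * D.K t z := fun t => rfl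
  have I2 : ∀ l, IntegrableOn (fun t => ∑ j, a.a2 j l * (ν l : ℂ) * pd j (D.K t) z) (Ioc 0 1) :=
    fun l => integrable_finsetSum _ fun j _ => (h1 j).const_mul _
  have I1 : ∀ l, IntegrableOn (fun t => (ν l : ℂ) * a.a1 l * D.K t z) (Ioc 0 1) := fun l =>
    h0.const_mul _
  simp only [e]
  rw [integral_add (integrable_finsetSum _ fun l _ => I2 l) (integrable_finsetSum _ fun l _ => I1 l),
    integral_finsetSum _ fun l _ => I2 l, integral_finsetSum _ fun l _ => I1 l, neg_add, flux,
    ← Finset.sum_neg_distrib, ← Finset.sum_neg_distrib]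
  congr 1
  · refine Finset.sum_congr rfl fun l _ => ?_
    rw [integral_finsetSum _ fun j _ => (h1 j).const_mul _, ← Finset.sum_neg_distrib]
    refine Finset.sum_congr rfl fun j _ => ?_
    rw [integral_const_mul, D.pd_par hn hz]
    ring
  · refine Finset.sum_congr rfl fun l _ => ?_
    rw [integral_const_mul, par]
    ring

variable {Ω : Set (E n)}

/-- On the boundary `(x - y)·ν(y) = O(|x - y|²)`, so the singular term is of order `|x - y|²/t` and
is absorbed by the Gaussian. The flux is no worse than the kernel itself. -/
theorem exists_norm_flux_K_le (hΩo : IsOpen Ω) (hΩ : IsC11Domain Ω) {x : E n}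
    (hx : x ∈ frontier Ω) : ∃ C : ℝ, 0 ≤ C ∧ ∀ t ∈ Ioc (0 : ℝ) 1, ∀ y ∈ frontier Ω,
      ‖flux a (D.K t) (x - y) (outerNormal Ω y)‖ ≤ C * D.g t (x - y) := by
  obtain ⟨C, hC0, hC⟩ := exists_abs_inner_outerNormal_le hΩo hΩ hx
  obtain ⟨C', hC'0, hC'⟩ := D.exists_kernel_bounds
  have hA0 : 0 ≤ ∑ l, ‖a.a1 l‖ := Finset.sum_nonneg fun l _ => norm_nonneg _
  refine ⟨(∑ l, ‖a.a1 l‖ + C) * C', by positivity, fun t ht y hy => ?_⟩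
  have ht0 := ht.1
  have h1 : ‖∑ l, a.a1 l * (outerNormal Ω y l : ℂ)‖ ≤ ∑ l, ‖a.a1 l‖ := by
    refine norm_sum_le_of_le _ fun l _ => ?_
    rw [norm_mul, Complex.norm_real]
    refine mul_le_of_le_one_right (norm_nonneg _) ?_
    rw [← (isOuterUnitNormal_outerNormal hΩ hy).1]
    exact PiLp.norm_apply_le _ l
  have h2 : ‖(inner ℝ (x - y) (outerNormal Ω y) : ℂ) / (2 * t)‖ ≤ C * (‖x - y‖ ^ 2 / t) := by
    rw [norm_div, Complex.norm_real, norm_mul, Complex.norm_real, Real.norm_of_nonneg ht0.le,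
      Real.norm_eq_abs, Complex.norm_ofNat]
    have h3 := hC y hy
    calc |inner ℝ (x - y) (outerNormal Ω y)| / (2 * t) ≤ (C * ‖x - y‖ ^ 2) / (1 * t) := by
          gcongr; norm_num
      _ = _ := by ring
  rw [D.flux_K, norm_mul]
  have h4 : ‖(1 / 2) * ∑ l, a.a1 l * (outerNormal Ω y l : ℂ) -
      (inner ℝ (x - y) (outerNormal Ω y) : ℂ) / (2 * t)‖ ≤
      (∑ l, ‖a.a1 l‖ + C) * (1 + ‖x - y‖ ^ 2 / t) := by
    refine (norm_sub_le _ _).trans ?_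
    have h5 : ‖(1 / 2 : ℂ) * ∑ l, a.a1 l * (outerNormal Ω y l : ℂ)‖ ≤ ∑ l, ‖a.a1 l‖ := by
      rw [norm_mul]
      refine (mul_le_of_le_one_left (norm_nonneg _) ?_).trans h1
      norm_num
    have h6 : 0 ≤ ‖x - y‖ ^ 2 / t := by positivity
    nlinarith [mul_nonneg hA0 h6]
  calc ‖D.K t (x - y)‖ * _ ≤ ‖D.K t (x - y)‖ * ((∑ l, ‖a.a1 l‖ + C) * (1 + ‖x - y‖ ^ 2 / t)) := by
        gcongr
    _ = (∑ l, ‖a.a1 l‖ + C) * ((1 + ‖x - y‖ ^ 2 / t) * ‖D.K t (x - y)‖) := by ring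
    _ ≤ (∑ l, ‖a.a1 l‖ + C) * (C' * D.g t (x - y)) := by
        exact mul_le_mul_of_nonneg_left (hC' t ht (x - y)).1 (by positivity)
    _ = _ := by ring

theorem continuousOn_flux_K (hΩo : IsOpen Ω) (hΩ : IsC11Domain Ω) (x : E n) :
    ContinuousOn (fun p : ℝ × E n => flux a (D.K p.1) (x - p.2) (outerNormal Ω p.2))
      (Ioi 0 ×ˢ frontier Ω) := by
  simp only [flux_K]
  have hν : ContinuousOn (fun p : ℝ × E n => outerNormal Ω p.2) (Ioi 0 ×ˢ frontier Ω) :=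
    (continuousOn_outerNormal hΩo hΩ).comp continuousOn_snd fun p hp => hp.2
  have hνl : ∀ l, ContinuousOn (fun p : ℝ × E n => (outerNormal Ω p.2 l : ℂ))
      (Ioi 0 ×ˢ frontier Ω) := fun l => Complex.continuous_ofReal.comp_continuousOn
      ((EuclideanSpace.proj (𝕜 := ℝ) l).continuous.comp_continuousOn hν)
  have hz : ContinuousOn (fun p : ℝ × E n => x - p.2) (Ioi 0 ×ˢ frontier Ω) :=
    continuousOn_const.sub continuousOn_snd
  have hK : ContinuousOn (fun p : ℝ × E n => D.K p.1 (x - p.2)) (Ioi 0 ×ˢ frontier Ω) :=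
    D.continuousOn_uncurry_K.comp (f := fun p : ℝ × E n => (p.1, x - p.2))
      (continuousOn_fst.prodMk hz) fun p hp => ⟨hp.1, mem_univ _⟩
  refine hK.mul ((continuousOn_const.mul (continuousOn_finsetSum _ fun l _ =>
    continuousOn_const.mul (hνl l))).sub ((Complex.continuous_ofReal.comp_continuousOn
      (hz.inner hν)).div (continuousOn_const.mul
        (Complex.continuous_ofReal.comp_continuousOn continuousOn_fst)) fun p hp => ?_))
  have : p.1 ≠ 0 := ne_of_gt hp.1
  simpa using this

/-- This justifies exchanging the time and surface integrals, and also yields absolute convergence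
of the potential. The dominating function is a product of a function of `t` and one of `y`, by
`exists_gauss_le`. -/
theorem integrable_flux_K (hn : 2 ≤ n) (hΩo : IsOpen Ω) (hΩb : Bornology.IsBounded Ω)
    (hΩ : IsC11Domain Ω) {x : E n} (hx : x ∈ frontier Ω) :
    Integrable (fun p : ℝ × E n => flux a (D.K p.1) (x - p.2) (outerNormal Ω p.2))
      ((volume.restrict (Ioc (0 : ℝ) 1)).prod ((surfaceMeasure n).restrict (frontier Ω))) := by
  have := isFiniteMeasure_surfaceMeasure hΩo hΩb hΩ
  have hF : MeasurableSet (frontier Ω) := isClosed_frontier.measurableSet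
  obtain ⟨C, hC0, hC⟩ := D.exists_norm_flux_K_le hΩo hΩ hx
  obtain ⟨C', hC'0, hC'⟩ := exists_gauss_le hn (s := D.m / 4) (by have := D.m_pos; positivity)
  have hn' : (2 : ℝ) ≤ n := by exact_mod_cast hn
  have hint := integrableOn_norm_rpow_frontier hn hΩo hΩb hΩ hx (s := n - 3 / 2)
    (by linarith) (by linarith)
  have ht : IntegrableOn (fun t : ℝ => t ^ (-(3 / 4) : ℝ)) (Ioc 0 1) := by
    rw [← intervalIntegrable_iff_integrableOn_Ioc_of_le zero_le_one]
    exact intervalIntegral.intervalIntegrable_rpow' (by norm_num)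
  refine ((ht.mul_prod hint).const_mul (C * C')).mono' ?_ ?_
  · have h1 : ContinuousOn (fun p : ℝ × E n => flux a (D.K p.1) (x - p.2) (outerNormal Ω p.2))
        (Ioc 0 1 ×ˢ frontier Ω) :=
      (D.continuousOn_flux_K hΩo hΩ x).mono (prod_mono (fun t ht => ht.1) subset_rfl)
    have h2 := h1.aestronglyMeasurable (μ := (volume.restrict (Ioc (0 : ℝ) 1)).prod
      ((surfaceMeasure n).restrict (frontier Ω))) (measurableSet_Ioc.prod hF)
    rwa [← Measure.prod_restrict, Measure.restrict_restrict measurableSet_Ioc, inter_self,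
      Measure.restrict_restrict hF, inter_self] at h2
  · have hxn : ∀ᵐ y ∂(surfaceMeasure n).restrict (frontier Ω), y ≠ x := by
      refine ae_restrict_of_ae ?_
      rw [ae_iff]
      simpa using surfaceMeasure_singleton hn x
    filter_upwards [Measure.quasiMeasurePreserving_fst.ae (ae_restrict_mem measurableSet_Ioc),
      Measure.quasiMeasurePreserving_snd.ae (ae_restrict_mem hF),
      Measure.quasiMeasurePreserving_snd.ae hxn] with p hp1 hp2 hp3
    refine (hC p.1 hp1 p.2 hp2).trans ?_
    rw [mul_assoc]
    gcongr
    exact hC' p.1 hp1.1 _ (sub_ne_zero.mpr (Ne.symm hp3))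

end HeatData

end Flux

end DoubleLayer

namespace DoubleLayer

open MeasureTheory Set Filter Topology

/-! ### The double layer potential with density one -/

theorem integrableOn_comp_sub {n : ℕ} {Ω : Set (E n)} {F : Type*} [NormedAddCommGroup F]
    (hΩb : Bornology.IsBounded Ω) {f : E n → F} (hf : Continuous f)
    (x : E n) : IntegrableOn (fun y => f (x - y)) Ω :=
  ((hf.comp (continuous_const.sub continuous_id)).continuousOn.integrableOn_compact
    (Metric.isCompact_of_isClosed_isBounded isClosed_closure hΩb.closure)).mono_set subset_closure

theorem setIntegral_comp_sub {n : ℕ} {Ω : Set (E n)} (hΩo : IsOpen Ω) (f : E n → ℂ) (x : E n) :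
    ∫ y in Ω, f (x - y) = ∫ z, f z * Ω.indicator (fun _ => 1) (x - z) := by
  rw [← integral_indicator hΩo.measurableSet,
    ← integral_sub_left_eq_self (fun z => f z * Ω.indicator (fun _ => 1) (x - z)) volume x]
  congr 1 with y
  by_cases hy : y ∈ Ω <;> simp [hy]

namespace HeatData

variable {n : ℕ} {a : Coeffs n} (D : HeatData a) {Ω : Set (E n)} {S w : E n → ℂ}

theorem kernel_eq (hn : 2 ≤ n) (hw : ContDiff ℝ ∞ w) (hS : ∀ x, x ≠ 0 → S x = D.par x + w x)
    {x y : E n} (hxy : y ≠ x) : kernel Ω a S x y =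
      (∫ t in Ioc (0 : ℝ) 1, flux a (D.K t) (x - y) (outerNormal Ω y)) -
        flux a w (x - y) (outerNormal Ω y) := by
  have hn1 : 1 ≤ n := by omega
  have hz : x - y ≠ 0 := sub_ne_zero.mpr (Ne.symm hxy)
  have hev : S =ᶠ[𝓝 (x - y)] fun z => D.par z + w z := by
    filter_upwards [isOpen_compl_singleton.mem_nhds hz] with z hz using hS z hz
  rw [kernel_eq_neg_flux, flux_congr a hev, flux_add a (D.hasFDerivAt_par hn1 hz).differentiableAt
    (hw.differentiable (by simp) _), D.flux_par hn1 hz]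
  ring

theorem ae_kernel_eq (hn : 2 ≤ n) (hw : ContDiff ℝ ∞ w) (hS : ∀ x, x ≠ 0 → S x = D.par x + w x)
    (x : E n) : ∀ᵐ y ∂(surfaceMeasure n).restrict (frontier Ω), kernel Ω a S x y =
      (∫ t in Ioc (0 : ℝ) 1, flux a (D.K t) (x - y) (outerNormal Ω y)) -
        flux a w (x - y) (outerNormal Ω y) := by
  have hxn : ∀ᵐ y ∂(surfaceMeasure n), y ≠ x := by
    rw [ae_iff]
    simpa using surfaceMeasure_singleton hn x
  filter_upwards [ae_restrict_of_ae hxn] with y hy using D.kernel_eq hn hw hS hy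

theorem integrableOn_kernel (hn : 2 ≤ n) (hΩo : IsOpen Ω) (hΩb : Bornology.IsBounded Ω)
    (hΩ : IsC11Domain Ω) (hw : ContDiff ℝ ∞ w) (hS : ∀ x, x ≠ 0 → S x = D.par x + w x) {x : E n}
    (hx : x ∈ frontier Ω) : IntegrableOn (kernel Ω a S x) (frontier Ω) (surfaceMeasure n) := by
  have := isFiniteMeasure_surfaceMeasure hΩo hΩb hΩ
  have h1 := (D.integrable_flux_K hn hΩo hΩb hΩ hx).integral_prod_right
  have h2 := integrableOn_frontier_of_continuousOn hΩo hΩb hΩ (continuousOn_flux a hw hΩo hΩ x)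
  exact (h1.sub h2).congr ((D.ae_kernel_eq hn hw hS x).mono fun y hy => hy.symm)

theorem integrableOn_time_volume (hΩo : IsOpen Ω) (x : E n) :
    IntegrableOn (fun t => ∫ y in Ω, D.K t (x - y)) (Ioc 0 1) := by
  have h : Integrable (fun p : ℝ × E n => D.K p.1 p.2 * Ω.indicator (fun _ => (1 : ℂ)) (x - p.2))
      ((volume.restrict (Ioc (0 : ℝ) 1)).prod volume) := by
    refine D.integrable_uncurry_K.mul_bdd (c := 1) ?_ (Eventually.of_forall fun p => ?_)
    · exact ((measurable_const.indicator hΩo.measurableSet).comp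
        (measurable_const.sub measurable_snd)).aestronglyMeasurable
    · refine (norm_indicator_le_norm_self _ _).trans (by simp)
  simp only [setIntegral_comp_sub hΩo]
  exact h.integral_prod_left

/-- The definition of the outer normal by rays says that `Ω`, rescaled at `x`, tends to a half space
in every direction off the tangent hyperplane. -/
theorem tendsto_indicator_rescaled {x : E n} {ν : E n} (hν : IsOuterUnitNormal Ω x ν) {ζ : E n}
    (hζ : inner ℝ ζ ν ≠ 0) :
    Tendsto (fun ε : ℝ => Ω.indicator (fun _ => (1 : ℂ)) (x - √ε • ζ)) (𝓝[>] 0)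
      (𝓝 ({ζ | 0 < inner ℝ ζ ν}.indicator (fun _ => (1 : ℂ)) ζ)) := by
  have hs : Tendsto (fun ε : ℝ => √ε) (𝓝[>] 0) (𝓝[>] 0) := by
    refine tendsto_nhdsWithin_iff.mpr ⟨?_, ?_⟩
    · have := (Real.continuous_sqrt.tendsto 0).mono_left (nhdsWithin_le_nhds (s := Ioi 0))
      rwa [Real.sqrt_zero] at this
    · filter_upwards [self_mem_nhdsWithin] with ε hε using Real.sqrt_pos.mpr hε
  refine tendsto_const_nhds.congr' ?_
  rcases lt_or_gt_of_ne hζ with h | h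
  · filter_upwards [hs.eventually (hν.2.2 (-ζ) (by rw [inner_neg_left]; linarith))] with ε hε
    rw [smul_neg, ← sub_eq_add_neg] at hε
    rw [indicator_of_notMem fun h' => hε (subset_closure h'), indicator_of_notMem]
    exact not_lt.mpr h.le
  · filter_upwards [hs.eventually (hν.2.1 (-ζ) (by rw [inner_neg_left]; linarith))] with ε hε
    rw [smul_neg, ← sub_eq_add_neg] at hε
    rw [indicator_of_mem hε, indicator_of_mem (show ζ ∈ {ζ | 0 < inner ℝ ζ ν} from h)]

/-- At fixed `t` Gauss' theorem gives `-∫_Ω P K_t + a₀ ∫_Ω K_t`. As `P K_t = ∂_t K_t`, the first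
term integrates in time to `1/2 - ∫_Ω K_1`. -/
theorem integral_flux_K_time (hn : 2 ≤ n) (hΩo : IsOpen Ω) (hΩb : Bornology.IsBounded Ω)
    (hΩ : IsC11Domain Ω) {x : E n} (hx : x ∈ frontier Ω) :
    ∫ t in Ioc (0 : ℝ) 1, ∫ y in frontier Ω,
      flux a (D.K t) (x - y) (outerNormal Ω y) ∂(surfaceMeasure n) =
    1 / 2 - (∫ y in Ω, D.K 1 (x - y)) + a.a0 * ∫ t in Ioc (0 : ℝ) 1, ∫ y in Ω, D.K t (x - y) := by
  have := isFiniteMeasure_surfaceMeasure hΩo hΩb hΩ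
  have hfl : ∀ t ∈ Ioc (0 : ℝ) 1, ∫ y in frontier Ω,
      flux a (D.K t) (x - y) (outerNormal Ω y) ∂(surfaceMeasure n) =
      -(∫ y in Ω, a.op (D.K t) (x - y)) + a.a0 * ∫ y in Ω, D.K t (x - y) := by
    intro t ht
    rw [integral_flux a (D.contDiff_K t) hΩo hΩb hΩ,
      integral_sub (integrableOn_comp_sub hΩb (a.contDiff_op (D.contDiff_K t)).continuous x)
        ((integrableOn_comp_sub hΩb (D.contDiff_K t).continuous x).const_mul _),
      integral_const_mul]
    ring
  have hIv := (D.integrableOn_time_volume hΩo x).const_mul a.a0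
  have hIf : IntegrableOn (fun t => ∫ y in frontier Ω,
      flux a (D.K t) (x - y) (outerNormal Ω y) ∂(surfaceMeasure n)) (Ioc 0 1) :=
    (D.integrable_flux_K hn hΩo hΩb hΩ hx).integral_prod_left
  -- The volume integral of `∂_t K_t` is integrable in time because Gauss' theorem expresses it by
  -- the boundary flux and `∫_Ω K_t`, both of which are.
  have hJ : IntegrableOn (fun t => ∫ y in Ω, a.op (D.K t) (x - y)) (Ioc 0 1) := by
    refine (hIv.sub hIf).congr ?_
    filter_upwards [ae_restrict_mem measurableSet_Ioc] with t ht
    simp only [Pi.sub_apply]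
    rw [hfl t ht]
    ring
  have hJn : IntegrableOn (fun t => -∫ y in Ω, a.op (D.K t) (x - y)) (Ioc 0 1) := hJ.neg
  have hν := isOuterUnitNormal_outerNormal hΩ hx
  have hν0 : outerNormal Ω x ≠ 0 := by
    intro h
    have := hν.1
    rw [h] at this
    simp at this
  have hmeas : Measurable fun z : E n => Ω.indicator (fun _ => (1 : ℂ)) (x - z) :=
    (measurable_const.indicator hΩo.measurableSet).comp (measurable_const.sub measurable_id)
  have htime := D.integral_time_eq hmeas (M := 1)
    (fun z => (norm_indicator_le_norm_self _ _).trans (by simp))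
    ((ae_inner_ne_zero hν0).mono fun ζ hζ => tendsto_indicator_rescaled hν hζ) hJ
    fun t ht => by
      rw [setIntegral_comp_sub hΩo]
      congr 1 with z
      rw [D.op_K ht.1.ne']
  rw [D.integral_profile_halfSpace hν0, ← setIntegral_comp_sub hΩo] at htime
  rw [setIntegral_congr_fun measurableSet_Ioc hfl, integral_add hJn hIv, integral_neg, htime,
    integral_const_mul]
  ring

/-- The boundary integral is traded for volume potentials, which make sense for every `x` in the
space and can be differentiated there. All kernels are smooth except in the term with `a₀`. -/
theorem doubleLayer_one_eq (hn : 2 ≤ n) (hΩo : IsOpen Ω) (hΩb : Bornology.IsBounded Ω)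
    (hΩ : IsC11Domain Ω) (hw : ContDiff ℝ ∞ w) (hS : ∀ x, x ≠ 0 → S x = D.par x + w x) {x : E n}
    (hx : x ∈ frontier Ω) : doubleLayer Ω a S (fun _ => 1) x =
      1 / 2 - (∫ y in Ω, D.K 1 (x - y)) + (a.a0 * ∫ t in Ioc (0 : ℝ) 1, ∫ y in Ω, D.K t (x - y)) +
        ∫ y in Ω, (a.op w (x - y) - a.a0 * w (x - y)) := by
  have := isFiniteMeasure_surfaceMeasure hΩo hΩb hΩ
  have hI := D.integrable_flux_K hn hΩo hΩb hΩ hx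
  have h2 := integrableOn_frontier_of_continuousOn hΩo hΩb hΩ (continuousOn_flux a hw hΩo hΩ x)
  have hset : (frontier Ω \ {x} : Set (E n)) =ᵐ[surfaceMeasure n] frontier Ω :=
    sdiff_null_ae_eq_self (surfaceMeasure_singleton hn x)
  rw [doubleLayer, setIntegral_congr_set hset]
  simp only [one_mul]
  rw [integral_congr_ae (D.ae_kernel_eq hn hw hS x), integral_sub hI.integral_prod_right h2,
    ← integral_integral_swap hI, D.integral_flux_K_time hn hΩo hΩb hΩ hx,
    integral_flux a hw hΩo hΩb hΩ]
  ring

end HeatData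

end DoubleLayer

namespace DoubleLayer

open MeasureTheory Set Filter Topology

/-! ### Volume potentials and their gradients -/

theorem exists_norm_comp_sub_le {n : ℕ} {Ω : Set (E n)} {F : Type*} [NormedAddCommGroup F]
    (hΩb : Bornology.IsBounded Ω) {f : E n → F} (hf : Continuous f)
    (R : ℝ) : ∃ C : ℝ, 0 ≤ C ∧ ∀ x ∈ Metric.closedBall (0 : E n) R, ∀ y ∈ Ω, ‖f (x - y)‖ ≤ C := by
  have hc : IsCompact (Metric.closedBall (0 : E n) R ×ˢ closure Ω) :=
    (isCompact_closedBall 0 R).prod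
      (Metric.isCompact_of_isClosed_isBounded isClosed_closure hΩb.closure)
  obtain ⟨C, hC⟩ := hc.exists_bound_of_continuousOn (f := fun p : E n × E n => f (p.1 - p.2))
    (hf.comp (continuous_fst.sub continuous_snd)).continuousOn
  exact ⟨max C 0, le_max_right _ _, fun x hx y hy =>
    (hC (x, y) ⟨hx, subset_closure hy⟩).trans (le_max_left _ _)⟩

section VolumePotential

variable {n : ℕ} {Ω : Set (E n)} {F : Type*} [NormedAddCommGroup F] [NormedSpace ℝ F]

theorem hasFDerivAt_integral_comp_sub (hΩo : IsOpen Ω) (hΩb : Bornology.IsBounded Ω) {f : E n → F}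
    (hf : ContDiff ℝ 1 f) (x : E n) :
    HasFDerivAt (fun x => ∫ y in Ω, f (x - y)) (∫ y in Ω, fderiv ℝ f (x - y)) x := by
  have hf' : Continuous (fderiv ℝ f) := hf.continuous_fderiv (by simp)
  obtain ⟨C, -, hC⟩ := exists_norm_comp_sub_le hΩb hf' (‖x‖ + 1)
  have hball : Metric.ball x 1 ⊆ Metric.closedBall (0 : E n) (‖x‖ + 1) := by
    intro z hz
    rw [mem_closedBall_zero_iff]
    have h1 : ‖z - x‖ < 1 := by rwa [← dist_eq_norm]
    have h2 := norm_le_insert' z x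
    linarith
  refine hasFDerivAt_integral_of_dominated_of_fderiv_le (bound := fun _ => C)
    (F' := fun x y => fderiv ℝ f (x - y))
    (Metric.ball_mem_nhds x one_pos)
    (Eventually.of_forall fun z =>
      (integrableOn_comp_sub hΩb hf.continuous z).aestronglyMeasurable)
    (integrableOn_comp_sub hΩb hf.continuous x)
    (integrableOn_comp_sub hΩb hf' x).aestronglyMeasurable ?_
    (integrableOn_const (hΩb.measure_lt_top.ne)) ?_
  · filter_upwards [ae_restrict_mem hΩo.measurableSet] with y hy z hz using hC z (hball hz) y hy
  · refine Eventually.of_forall fun y z _ => ?_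
    have h1 : HasFDerivAt (fun z : E n => z - y) (ContinuousLinearMap.id ℝ (E n)) z :=
      (hasFDerivAt_id z).sub_const y
    have h2 := ((hf.differentiable (by simp)) (z - y)).hasFDerivAt.comp z h1
    rwa [ContinuousLinearMap.comp_id] at h2

/-- A volume potential with smooth kernel is of class `C^{1,1}` on bounded sets. -/
theorem exists_gradient_comp_sub (hΩo : IsOpen Ω) (hΩb : Bornology.IsBounded Ω) {f : E n → ℂ}
    (hf : ContDiff ℝ ∞ f) (R : ℝ) : ∃ G : E n → E n →L[ℝ] ℂ, Continuous G ∧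
      (∀ x, HasFDerivAt (fun x => ∫ y in Ω, f (x - y)) (G x) x) ∧
      ∃ C : ℝ, 0 ≤ C ∧ ∀ x ∈ Metric.closedBall (0 : E n) R, ∀ x' ∈ Metric.closedBall (0 : E n) R,
        ‖G x - G x'‖ ≤ C * ‖x - x'‖ := by
  have h1 : ContDiff ℝ ∞ (fderiv ℝ f) := hf.fderiv_right (by simp)
  have h2 : ContDiff ℝ ∞ (fderiv ℝ (fderiv ℝ f)) := h1.fderiv_right (by simp)
  have hd := fun x => hasFDerivAt_integral_comp_sub hΩo hΩb (h1.of_le (by simp)) x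
  refine ⟨fun x => ∫ y in Ω, fderiv ℝ f (x - y),
    continuous_iff_continuousAt.mpr fun x => (hd x).continuousAt,
    hasFDerivAt_integral_comp_sub hΩo hΩb (hf.of_le (by simp)), ?_⟩
  obtain ⟨C, hC0, hC⟩ := exists_norm_comp_sub_le hΩb h2.continuous R
  refine ⟨C * volume.real Ω, by positivity, fun x hx x' hx' => ?_⟩
  refine (convex_closedBall (0 : E n) R).norm_image_sub_le_of_norm_hasFDerivWithin_le
    (fun z hz => (hd z).hasFDerivWithinAt) (fun z hz => ?_) hx' hx
  exact norm_setIntegral_le_of_norm_le_const hΩb.measure_lt_top fun y hy => hC z hz y hy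

end VolumePotential

/-! ### Gradients of the volume potentials of the heat kernel -/

namespace HeatData

variable {n : ℕ} {a : Coeffs n} (D : HeatData a) {Ω : Set (E n)}

theorem norm_setIntegral_comp_sub_le {F : Type*} [NormedAddCommGroup F]
    [NormedSpace ℝ F] {f : E n → F} {t M : ℝ} (ht : 0 < t) (hle : ∀ z, ‖f z‖ ≤ M * D.g t z)
    (hM : 0 ≤ M) (x : E n) : ‖∫ y in Ω, f (x - y)‖ ≤ M * D.mass := by
  have hi : Integrable fun y => M * D.g t (x - y) := ((D.integrable_g ht).comp_sub_left x).const_mul M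
  refine (norm_integral_le_of_norm_le hi.integrableOn
    (Eventually.of_forall fun y => hle (x - y))).trans ?_
  refine (setIntegral_le_integral hi (Eventually.of_forall fun y =>
    mul_nonneg hM (D.g_nonneg ht _))).trans ?_
  rw [integral_const_mul, integral_sub_left_eq_self (fun z => D.g t z) volume x, D.integral_g ht]

/-- The gradient of the volume potential of `K_t`. -/
def volGrad (Ω : Set (E n)) (t : ℝ) (x : E n) : E n →L[ℝ] ℂ := ∫ y in Ω, fderiv ℝ (D.K t) (x - y)

theorem hasFDerivAt_volume (hΩo : IsOpen Ω) (hΩb : Bornology.IsBounded Ω) (t : ℝ) (x : E n) :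
    HasFDerivAt (fun x => ∫ y in Ω, D.K t (x - y)) (D.volGrad Ω t x) x :=
  hasFDerivAt_integral_comp_sub hΩo hΩb ((D.contDiff_K t).of_le (by simp)) x

/-- The pointwise bounds for the first and second derivatives are integrated over the whole space,
where `g t` has constant mass. Hence neither bound depends on the position relative to the boundary.
-/
theorem exists_volGrad_bounds (hΩo : IsOpen Ω) (hΩb : Bornology.IsBounded Ω) :
    ∃ C : ℝ, 0 ≤ C ∧ ∀ t ∈ Ioc (0 : ℝ) 1, (∀ x, ‖D.volGrad Ω t x‖ ≤ C * (√t)⁻¹) ∧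
      ∀ x x', ‖D.volGrad Ω t x - D.volGrad Ω t x'‖ ≤ C * t⁻¹ * ‖x - x'‖ := by
  obtain ⟨C, hC0, hC⟩ := D.exists_kernel_bounds
  have hm := D.mass_nonneg
  refine ⟨C * D.mass, by positivity, fun t ht => ⟨fun x => ?_, fun x x' => ?_⟩⟩
  · have ht0 := ht.1
    refine (D.norm_setIntegral_comp_sub_le ht.1 (M := C * (√t)⁻¹) (fun z => ?_)
      (by positivity) x).trans_eq (by ring)
    rw [mul_assoc]
    exact (hC t ht z).2.1
  · have ht0 := ht.1
    have h1 : ContDiff ℝ ∞ (fderiv ℝ (D.K t)) := (D.contDiff_K t).fderiv_right (by simp)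
    refine convex_univ.norm_image_sub_le_of_norm_hasFDerivWithin_le (fun z _ =>
      (hasFDerivAt_integral_comp_sub hΩo hΩb (h1.of_le (by simp)) z).hasFDerivWithinAt)
      (fun z _ => ?_) (mem_univ x') (mem_univ x)
    refine (D.norm_setIntegral_comp_sub_le ht.1 (M := C * t⁻¹) (fun z => ?_)
      (by positivity) z).trans_eq (by ring)
    rw [mul_assoc]
    exact (hC t ht z).2.2.1

theorem continuousOn_uncurry_fderiv_K :
    ContinuousOn (fun p : ℝ × E n => fderiv ℝ (D.K p.1) p.2) (Ioi 0 ×ˢ univ) := by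
  simp only [fderiv_K]
  refine D.continuousOn_uncurry_K.smul ?_
  unfold ℓ
  refine continuousOn_const.sub (ContinuousOn.smul
    ((continuousOn_const.mul continuousOn_fst).inv₀ ?_)
    (D.BL.continuous.comp continuous_snd).continuousOn)
  intro p hp
  have : p.1 ≠ 0 := ne_of_gt hp.1
  simpa using this

theorem aestronglyMeasurable_volGrad (hΩo : IsOpen Ω) (x : E n) :
    AEStronglyMeasurable (fun t => D.volGrad Ω t x) (volume.restrict (Ioc (0 : ℝ) 1)) := by
  have h1 : ContinuousOn (fun p : ℝ × E n => fderiv ℝ (D.K p.1) (x - p.2)) (Ioc 0 1 ×ˢ Ω) :=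
    D.continuousOn_uncurry_fderiv_K.comp (f := fun p : ℝ × E n => (p.1, x - p.2))
      (by fun_prop) fun p hp => ⟨hp.1.1, mem_univ _⟩
  have h2 := h1.aestronglyMeasurable (μ := (volume : Measure ℝ).prod volume)
    (measurableSet_Ioc.prod hΩo.measurableSet)
  rw [← Measure.prod_restrict] at h2
  exact h2.integral_prod_right'

theorem integrableOn_inv_sqrt : IntegrableOn (fun t : ℝ => (√t)⁻¹) (Ioc 0 1) := by
  rw [← intervalIntegrable_iff_integrableOn_Ioc_of_le zero_le_one]
  have : IntervalIntegrable (fun t : ℝ => t ^ (-(1 / 2) : ℝ)) volume 0 1 :=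
    intervalIntegral.intervalIntegrable_rpow' (by norm_num)
  refine this.congr fun t ht => ?_
  rw [uIoc_of_le zero_le_one] at ht
  rw [Real.rpow_neg ht.1.le, Real.sqrt_eq_rpow]

theorem hasFDerivAt_time_volume (hΩo : IsOpen Ω) (hΩb : Bornology.IsBounded Ω) (x : E n) :
    HasFDerivAt (fun x => ∫ t in Ioc (0 : ℝ) 1, ∫ y in Ω, D.K t (x - y))
      (∫ t in Ioc (0 : ℝ) 1, D.volGrad Ω t x) x := by
  obtain ⟨C, hC0, hC⟩ := D.exists_volGrad_bounds hΩo hΩb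
  refine hasFDerivAt_integral_of_dominated_of_fderiv_le (bound := fun t => C * (√t)⁻¹)
    (F' := fun x t => D.volGrad Ω t x) univ_mem
    (Eventually.of_forall fun z => (D.integrableOn_time_volume hΩo z).aestronglyMeasurable)
    (D.integrableOn_time_volume hΩo x) (D.aestronglyMeasurable_volGrad hΩo x) ?_
    (integrableOn_inv_sqrt.const_mul C) ?_
  · filter_upwards [ae_restrict_mem measurableSet_Ioc] with t ht z _ using (hC t ht).1 z
  · exact Eventually.of_forall fun t z _ => D.hasFDerivAt_volume hΩo hΩb t z

theorem continuous_time_volGrad (hΩo : IsOpen Ω) (hΩb : Bornology.IsBounded Ω) :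
    Continuous fun x => ∫ t in Ioc (0 : ℝ) 1, D.volGrad Ω t x := by
  obtain ⟨C, hC0, hC⟩ := D.exists_volGrad_bounds hΩo hΩb
  refine continuous_of_dominated (fun x => D.aestronglyMeasurable_volGrad hΩo x) (fun x => ?_)
    (integrableOn_inv_sqrt.const_mul C) ?_
  · filter_upwards [ae_restrict_mem measurableSet_Ioc] with t ht using (hC t ht).1 x
  · filter_upwards [ae_restrict_mem measurableSet_Ioc] with t ht
    refine (LipschitzWith.of_dist_le_mul (K := (C * t⁻¹).toNNReal) fun x x' => ?_).continuous
    have ht0 := ht.1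
    rw [dist_eq_norm, dist_eq_norm, Real.coe_toNNReal _ (by positivity)]
    exact (hC t ht).2 x x'

end HeatData

/-! ### The logarithmic modulus of continuity -/

theorem omega_one_eq {d : ℝ} (hd : 0 < d) : omega 1 d =
    if d ≤ Real.exp (-1) then d * |Real.log d| else Real.exp (-1) := by
  simp [omega, hd.ne']

theorem omega_one_zero : omega 1 0 = 0 := by simp [omega]

theorem one_le_abs_log {d : ℝ} (hd : 0 < d) (h : d ≤ Real.exp (-1)) : 1 ≤ |Real.log d| := by
  have h1 : Real.log d ≤ -1 := by
    rw [← Real.log_exp (-1)]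
    exact Real.log_le_log hd h
  rw [abs_of_nonpos (by linarith)]
  linarith

theorem omega_one_nonneg {d : ℝ} (hd : 0 ≤ d) : 0 ≤ omega 1 d := by
  rcases hd.eq_or_lt with rfl | hd
  · rw [omega_one_zero]
  · rw [omega_one_eq hd]
    split_ifs <;> positivity

/-- On bounded sets a Lipschitz bound is stronger than a bound by `ω₁`. The factor `exp 1`
compensates the constant value `exp(-1)` of `ω₁` for large arguments. -/
theorem exists_le_omega_one (R : ℝ) : ∃ C : ℝ, 0 ≤ C ∧ ∀ d : ℝ, 0 ≤ d → d ≤ R →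
    d ≤ C * omega 1 d := by
  refine ⟨max 1 (R * Real.exp 1), by positivity, fun d hd hR => ?_⟩
  rcases hd.eq_or_lt with rfl | hd
  · rw [omega_one_zero, mul_zero]
  rw [omega_one_eq hd]
  split_ifs with h
  · have := one_le_abs_log hd h
    calc d ≤ 1 * (d * |Real.log d|) := by nlinarith
      _ ≤ _ := by gcongr; exact le_max_left _ _
  · calc d ≤ R * Real.exp 1 * Real.exp (-1) := by
          rw [mul_assoc, ← Real.exp_add]; simpa using hR
      _ ≤ _ := by gcongr; exact le_max_right _ _

/-- A family of Lipschitz functions with constants `1/t` that is bounded by `t^{-1/2}` integrates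
to a function with modulus of continuity `r |log r|`. -/
theorem exists_setIntegral_le_omega_one {C : ℝ} (hC : 0 ≤ C) : ∃ C' : ℝ, 0 ≤ C' ∧
    ∀ (u : ℝ → ℝ) (d : ℝ), 0 < d → IntegrableOn u (Ioc 0 1) →
      (∀ t ∈ Ioc (0 : ℝ) 1, u t ≤ C * (√t)⁻¹) → (∀ t ∈ Ioc (0 : ℝ) 1, u t ≤ C * t⁻¹ * d) →
      ∫ t in Ioc (0 : ℝ) 1, u t ≤ C' * omega 1 d := by
  have hsq : ∀ b : ℝ, 0 ≤ b → ∫ t in (0 : ℝ)..b, (√t)⁻¹ = 2 * √b := by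
    intro b hb
    have : ∫ t in (0 : ℝ)..b, (√t)⁻¹ = ∫ t in (0 : ℝ)..b, t ^ (-(1 / 2) : ℝ) := by
      refine intervalIntegral.integral_congr_ae (Eventually.of_forall fun t ht => ?_)
      rw [uIoc_of_le hb] at ht
      rw [Real.rpow_neg ht.1.le, Real.sqrt_eq_rpow]
    rw [this, integral_rpow (Or.inl (by norm_num)), Real.sqrt_eq_rpow]
    norm_num
    ring
  have hi : ∀ b c : ℝ, 0 ≤ b → b ≤ 1 → 0 ≤ c → c ≤ 1 →
      IntervalIntegrable (fun t : ℝ => C * (√t)⁻¹) volume b c := by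
    intro b c hb hb1 hc hc1
    have : IntervalIntegrable (fun t : ℝ => C * (√t)⁻¹) volume 0 1 := by
      rw [intervalIntegrable_iff_integrableOn_Ioc_of_le zero_le_one]
      exact HeatData.integrableOn_inv_sqrt.const_mul C
    refine this.mono_set ?_
    rw [uIcc_of_le zero_le_one]
    exact uIcc_subset_Icc ⟨hb, hb1⟩ ⟨hc, hc1⟩
  -- For `d ≤ exp(-1)` the two pieces give `2C d + 2C d|log d| ≤ 4C d|log d|`; for larger `d` the
  -- total is at most `2C`, and `exp 1` offsets the value `exp(-1)` of `ω₁`.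
  refine ⟨4 * C * Real.exp 1, by positivity, fun u d hd hu h1 h2 => ?_⟩
  have huI : IntervalIntegrable u volume 0 1 := by
    rwa [intervalIntegrable_iff_integrableOn_Ioc_of_le zero_le_one]
  rw [← intervalIntegral.integral_of_le zero_le_one, omega_one_eq hd]
  split_ifs with h
  · have hlog := one_le_abs_log hd h
    have hd1 : d ≤ 1 := h.trans (by rw [Real.exp_le_one_iff]; norm_num)
    have hdd : d ^ 2 ≤ 1 := pow_le_one₀ hd.le hd1
    have hdd0 : 0 < d ^ 2 := by positivity
    have hu1 : IntervalIntegrable u volume 0 (d ^ 2) := huI.mono_set (by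
      rw [uIcc_of_le zero_le_one]; exact uIcc_subset_Icc ⟨le_rfl, zero_le_one⟩ ⟨hdd0.le, hdd⟩)
    have hu2 : IntervalIntegrable u volume (d ^ 2) 1 := huI.mono_set (by
      rw [uIcc_of_le zero_le_one]; exact uIcc_subset_Icc ⟨hdd0.le, hdd⟩ ⟨zero_le_one, le_rfl⟩)
    -- The splitting point `d²` is where the bounds `t^{-1/2}` and `d/t` coincide.
    rw [← intervalIntegral.integral_add_adjacent_intervals hu1 hu2]
    have e1 : ∫ t in (0 : ℝ)..d ^ 2, u t ≤ 2 * C * d := by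
      calc _ ≤ ∫ t in (0 : ℝ)..d ^ 2, C * (√t)⁻¹ :=
            intervalIntegral.integral_mono_on_of_le_Ioo hdd0.le hu1 (hi _ _ le_rfl zero_le_one
              hdd0.le hdd) fun t ht => h1 t ⟨ht.1, ht.2.le.trans hdd⟩
        _ = _ := by
            rw [intervalIntegral.integral_const_mul, hsq _ hdd0.le, Real.sqrt_sq hd.le]; ring
    have hinv : IntervalIntegrable (fun t : ℝ => C * t⁻¹ * d) volume (d ^ 2) 1 := by
      refine ContinuousOn.intervalIntegrable ?_
      refine (continuousOn_const.mul (continuousOn_id.inv₀ fun t ht => ?_)).mul continuousOn_const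
      rw [uIcc_of_le hdd] at ht
      exact (hdd0.trans_le ht.1).ne'
    have e2 : ∫ t in (d ^ 2)..1, u t ≤ 2 * C * (d * |Real.log d|) := by
      calc _ ≤ ∫ t in (d ^ 2)..1, C * t⁻¹ * d :=
            intervalIntegral.integral_mono_on_of_le_Ioo hdd hu2 hinv fun t ht =>
              h2 t ⟨hdd0.trans ht.1, ht.2.le⟩
        _ = _ := by
            rw [intervalIntegral.integral_mul_const, intervalIntegral.integral_const_mul,
              integral_inv_of_pos hdd0 one_pos, one_div, Real.log_inv, Real.log_pow,
              abs_of_nonpos (Real.log_nonpos hd.le hd1)]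
            push_cast
            ring
    have he : 1 ≤ Real.exp 1 := Real.one_le_exp zero_le_one
    have hX : d ≤ d * |Real.log d| := le_mul_of_one_le_right hd.le hlog
    calc _ ≤ 2 * C * d + 2 * C * (d * |Real.log d|) := add_le_add e1 e2
      _ ≤ 2 * C * (d * |Real.log d|) + 2 * C * (d * |Real.log d|) := by gcongr
      _ = 4 * C * 1 * (d * |Real.log d|) := by ring
      _ ≤ _ := by gcongr
  · calc _ ≤ ∫ t in (0 : ℝ)..1, C * (√t)⁻¹ :=
          intervalIntegral.integral_mono_on_of_le_Ioo zero_le_one huI (hi _ _ le_rfl zero_le_one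
            zero_le_one le_rfl) fun t ht => h1 t ⟨ht.1, ht.2.le⟩
      _ = 2 * C := by
          rw [intervalIntegral.integral_const_mul, hsq _ zero_le_one, Real.sqrt_one]; ring
      _ ≤ 4 * C := by linarith
      _ = _ := by
          rw [mul_assoc, ← Real.exp_add]; simp

end DoubleLayer

namespace DoubleLayer

open MeasureTheory Set Filter Topology

/-! ### Traces on the boundary of functions with a modulus of continuity for the gradient -/

namespace CoordCylinder

variable {n : ℕ} {Ω : Set (E n)} {p : E n} (c : CoordCylinder Ω p)

/-- The linear part of `pt`. -/
def ptL : (E (n - 1) × ℝ) →L[ℝ] E n :=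
  (c.R.symm.toContinuousLinearEquiv : WithLp 2 (E (n - 1) × ℝ) →L[ℝ] E n).comp
    ((WithLp.prodContinuousLinearEquiv 2 ℝ (E (n - 1)) ℝ).symm : E (n - 1) × ℝ →L[ℝ] _)

/-- The derivative of the local parametrization. -/
def paramDeriv (η : E (n - 1)) : E (n - 1) →L[ℝ] E n :=
  c.ptL.comp ((ContinuousLinearMap.id ℝ _).prod (fderiv ℝ c.γ η))

theorem hasFDerivAt_param (hc : c.IsC11) {η : E (n - 1)}
    (hη : η ∈ Metric.ball (0 : E (n - 1)) c.r) : HasFDerivAt c.param (c.paramDeriv η) η := by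
  have h1 := (hasFDerivAt_id (𝕜 := ℝ) η).prodMk (c.hasFDerivAt_γ hc hη)
  exact (c.ptL.hasFDerivAt.comp η h1).const_add p

theorem norm_paramDeriv_sub_le (η η' : E (n - 1)) :
    ‖c.paramDeriv η - c.paramDeriv η'‖ ≤ ‖c.ptL‖ * ‖fderiv ℝ c.γ η - fderiv ℝ c.γ η'‖ := by
  have h : c.paramDeriv η - c.paramDeriv η' =
      c.ptL.comp ((0 : E (n - 1) →L[ℝ] E (n - 1)).prod (fderiv ℝ c.γ η - fderiv ℝ c.γ η')) := by
    rw [paramDeriv, paramDeriv, ← ContinuousLinearMap.comp_sub]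
    congr 1
    ext v <;> simp
  rw [h]
  refine (ContinuousLinearMap.opNorm_comp_le _ _).trans ?_
  gcongr
  rw [ContinuousLinearMap.opNorm_prod, Prod.norm_def]
  simp

theorem contDiffOn_param (hc : c.IsC11) : ContDiffOn ℝ 1 c.param (Metric.ball 0 c.r) := by
  have hγ : ContDiffOn ℝ 1 c.γ (Metric.ball 0 c.r) := by
    have := (contDiffOn_succ_iff_fderiv_of_isOpen (𝕜 := ℝ) (n := 0) (f := c.γ)
      (Metric.isOpen_ball (x := (0 : E (n - 1))) (ε := c.r))).mpr
      ⟨hc.1, by simp, contDiffOn_zero.mpr (c.continuousOn_fderiv_γ hc)⟩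
    simpa using this
  exact contDiffOn_const.add (c.ptL.contDiff.comp_contDiffOn (contDiffOn_id.prodMk hγ))

theorem exists_norm_paramDeriv_le (hc : c.IsC11) : ∃ M : ℝ, 1 ≤ M ∧
    ∀ η ∈ Metric.ball (0 : E (n - 1)) c.r, ‖c.paramDeriv η‖ ≤ M := by
  obtain ⟨M, hM0, hM⟩ := c.exists_norm_fderiv_γ_le hc
  refine ⟨max 1 (‖c.ptL‖ * max 1 M), le_max_left _ _, fun η hη => le_max_of_le_right ?_⟩
  refine (ContinuousLinearMap.opNorm_comp_le _ _).trans ?_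
  gcongr
  rw [ContinuousLinearMap.opNorm_prod, Prod.norm_def]
  exact max_le_max ContinuousLinearMap.norm_id_le (hM η hη)

end CoordCylinder

/-- By the chain rule the derivative of the trace is `G ∘ param` composed with `paramDeriv`; its
increment combines the modulus of `G` with the Lipschitz bound for `paramDeriv`. The parameter `L`
in `hmod` takes up the Lipschitz constant of `param`, so that `ω₁` is evaluated directly at the
distance of the parameters. -/
theorem isC1OmegaOnBoundary_of_gradient {n : ℕ} {Ω : Set (E n)} (hΩo : IsOpen Ω)
    (hΩb : Bornology.IsBounded Ω) {f U : E n → ℂ} {G : E n → E n →L[ℝ] ℂ} (hG : Continuous G)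
    (hU : ∀ x, HasFDerivAt U (G x) x) (hf : ∀ x ∈ frontier Ω, f x = U x)
    (hmod : ∃ C : ℝ, 0 ≤ C ∧ ∀ x ∈ frontier Ω, ∀ x' ∈ frontier Ω, ∀ L d : ℝ, 1 ≤ L → 0 < d →
      ‖x - x'‖ ≤ L * d → ‖G x - G x'‖ ≤ C * L * omega 1 d) :
    IsC1OmegaOnBoundary (omega 1) Ω f := by
  intro p hp c hc
  obtain ⟨C, hC0, hC⟩ := hmod
  obtain ⟨M, hM1, hM⟩ := c.exists_norm_paramDeriv_le hc
  obtain ⟨K, hK⟩ := hc.2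
  obtain ⟨C1, hC10, hC1⟩ := exists_le_omega_one (c.r + c.r)
  obtain ⟨M', hM'⟩ := (isCompact_frontier hΩb).exists_bound_of_continuousOn hG.continuousOn
  have hM'0 : 0 ≤ M' := (norm_nonneg _).trans (hM' p hp)
  have hmem : ∀ η ∈ Metric.ball (0 : E (n - 1)) c.r, c.param η ∈ frontier Ω := fun η hη =>
    c.param_mem_frontier hΩo hc hη
  have hUC : ContDiff ℝ 1 U := contDiff_one_iff_hasFDerivAt.mpr ⟨G, hG, hU⟩
  have hd : ∀ η ∈ Metric.ball (0 : E (n - 1)) c.r,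
      fderiv ℝ (fun η => f (c.param η)) η = (G (c.param η)).comp (c.paramDeriv η) := by
    intro η hη
    have h1 : (fun η => f (c.param η)) =ᶠ[𝓝 η] U ∘ c.param := by
      filter_upwards [Metric.isOpen_ball.mem_nhds hη] with ξ hξ using hf _ (hmem ξ hξ)
    rw [h1.fderiv_eq]
    exact ((hU _).comp η (c.hasFDerivAt_param hc hη)).fderiv
  have hlip : ∀ η ∈ Metric.ball (0 : E (n - 1)) c.r, ∀ η' ∈ Metric.ball (0 : E (n - 1)) c.r,
      ‖c.param η - c.param η'‖ ≤ M * ‖η - η'‖ := fun η hη η' hη' =>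
    (convex_ball (0 : E (n - 1)) c.r).norm_image_sub_le_of_norm_hasFDerivWithin_le
      (fun ξ hξ => (c.hasFDerivAt_param hc hξ).hasFDerivWithinAt) hM hη' hη
  refine ⟨(hUC.comp_contDiffOn (c.contDiffOn_param hc)).congr fun η hη => hf _ (hmem η hη),
    C * M * M + M' * (‖c.ptL‖ * (K * C1)), fun η hη η' hη' => ?_⟩
  rcases eq_or_ne η η' with rfl | hne
  · rw [sub_self, norm_zero, dist_self, omega_one_zero, mul_zero]
  have hpos : 0 < ‖η - η'‖ := norm_pos_iff.mpr (sub_ne_zero.mpr hne)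
  have hle : ‖η - η'‖ ≤ c.r + c.r := by
    rw [mem_ball_zero_iff] at hη hη'
    exact (norm_sub_le _ _).trans (add_le_add hη.le hη'.le)
  have hom := omega_one_nonneg hpos.le
  have e : (G (c.param η)).comp (c.paramDeriv η) - (G (c.param η')).comp (c.paramDeriv η') =
      (G (c.param η) - G (c.param η')).comp (c.paramDeriv η) +
        (G (c.param η')).comp (c.paramDeriv η - c.paramDeriv η') := by
    ext v; simp
  have h1 : ‖(G (c.param η) - G (c.param η')).comp (c.paramDeriv η)‖ ≤
      C * M * omega 1 ‖η - η'‖ * M :=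
    (ContinuousLinearMap.opNorm_comp_le _ _).trans (mul_le_mul
      (hC _ (hmem η hη) _ (hmem η' hη') M _ hM1 hpos (hlip η hη η' hη')) (hM η hη)
      (norm_nonneg _) (by positivity))
  have h2 : ‖fderiv ℝ c.γ η - fderiv ℝ c.γ η'‖ ≤ K * (C1 * omega 1 ‖η - η'‖) := by
    have := hK.dist_le_mul η hη η' hη'
    rw [dist_eq_norm, dist_eq_norm] at this
    exact this.trans (mul_le_mul_of_nonneg_left (hC1 _ hpos.le hle) K.2)
  have h3 : ‖(G (c.param η')).comp (c.paramDeriv η - c.paramDeriv η')‖ ≤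
      M' * (‖c.ptL‖ * (K * (C1 * omega 1 ‖η - η'‖))) :=
    (ContinuousLinearMap.opNorm_comp_le _ _).trans (mul_le_mul (hM' _ (hmem η' hη'))
      ((c.norm_paramDeriv_sub_le η η').trans (mul_le_mul_of_nonneg_left h2 (norm_nonneg _)))
      (norm_nonneg _) hM'0)
  rw [hd η hη, hd η' hη', e, dist_eq_norm]
  refine (norm_add_le _ _).trans ((add_le_add h1 h3).trans_eq ?_)
  ring

theorem norm_add_smul_sub_le {n : ℕ} (α : ℂ) (A A' B B' : E n →L[ℝ] ℂ) :
    ‖(A + α • B) - (A' + α • B')‖ ≤ ‖A - A'‖ + ‖α‖ * ‖B - B'‖ := by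
  refine ContinuousLinearMap.opNorm_le_bound _ (by positivity) fun v => ?_
  have e : ((A + α • B) - (A' + α • B')) v = (A - A') v + α * (B - B') v := by
    simp only [sub_apply, add_apply, smul_apply, smul_eq_mul]
    ring
  rw [e, add_mul, mul_assoc]
  refine (norm_add_le _ _).trans (add_le_add ((A - A').le_opNorm v) ?_)
  rw [norm_mul]
  exact mul_le_mul_of_nonneg_left ((B - B').le_opNorm v) (norm_nonneg _)

theorem exists_norm_le_omega_one (R : ℝ) : ∃ C : ℝ, 0 ≤ C ∧ ∀ s L d : ℝ, s ≤ R → 1 ≤ L → 0 < d →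
    s ≤ L * d → s ≤ C * L * omega 1 d := by
  obtain ⟨C, hC0, hC⟩ := exists_le_omega_one (max R 1)
  refine ⟨C, hC0, fun s L d hs hL hd hsd => ?_⟩
  rcases le_total d (max R 1) with h | h
  · calc s ≤ L * d := hsd
      _ ≤ L * (C * omega 1 d) := by gcongr; exact hC d hd.le h
      _ = _ := by ring
  -- For large `d` the function `ω₁` is constant, and the bound `s ≤ R` is used in place of `s ≤ L
  -- d`.
  · have h1 : (1 : ℝ) ≤ max R 1 := le_max_right _ _
    have h2 : ∀ b : ℝ, 1 ≤ b → omega 1 b = Real.exp (-1) := by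
      intro b hb
      have he : Real.exp (-1) < 1 := 
        (Real.exp_lt_exp.mpr (by norm_num)).trans_eq Real.exp_zero
      rw [omega_one_eq (by linarith), if_neg (by linarith)]
    have h3 := hC (max R 1) (by linarith) le_rfl
    rw [h2 _ h1] at h3
    rw [h2 _ (h1.trans h)]
    calc s ≤ max R 1 := hs.trans (le_max_left _ _)
      _ ≤ C * Real.exp (-1) := h3
      _ = C * 1 * Real.exp (-1) := by ring
      _ ≤ _ := by gcongr

/-! ### Regularity of the potential in dimension at least two -/

namespace HeatData

variable {n : ℕ} {a : Coeffs n} (D : HeatData a) {Ω : Set (E n)}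

theorem exists_norm_time_volGrad_sub_le (hΩo : IsOpen Ω) (hΩb : Bornology.IsBounded Ω) :
    ∃ C : ℝ, 0 ≤ C ∧ ∀ x x' : E n, ∀ L d : ℝ, 1 ≤ L → 0 < d → ‖x - x'‖ ≤ L * d →
      ‖(∫ t in Ioc (0 : ℝ) 1, D.volGrad Ω t x) - ∫ t in Ioc (0 : ℝ) 1, D.volGrad Ω t x'‖ ≤
        C * L * omega 1 d := by
  obtain ⟨C, hC0, hC⟩ := D.exists_volGrad_bounds hΩo hΩb
  obtain ⟨C', hC'0, hC'⟩ := exists_setIntegral_le_omega_one (C := 2 * C) (by positivity)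
  have hi : ∀ x, IntegrableOn (fun t => D.volGrad Ω t x) (Ioc 0 1) := fun x =>
    (integrableOn_inv_sqrt.const_mul C).mono' (D.aestronglyMeasurable_volGrad hΩo x) (by
      filter_upwards [ae_restrict_mem measurableSet_Ioc] with t ht using (hC t ht).1 x)
  refine ⟨C', hC'0, fun x x' L d hL hd hxd => ?_⟩
  have hL0 : 0 < L := one_pos.trans_le hL
  rw [← integral_sub (hi x) (hi x')]
  -- Division by `L ≥ 1` turns the Lipschitz bound at distance `L d` into one at distance `d` and
  -- does not spoil the other bound, so the constant is independent of `L`.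
  have h := hC' (fun t => L⁻¹ * ‖D.volGrad Ω t x - D.volGrad Ω t x'‖) d hd
    (((hi x).sub (hi x')).norm.const_mul _) (fun t ht => ?_) (fun t ht => ?_)
  · rw [integral_const_mul] at h
    refine (norm_integral_le_integral_norm _).trans ?_
    rw [inv_mul_le_iff₀ hL0] at h
    exact h.trans_eq (by ring)
  · have h1 := norm_sub_le (D.volGrad Ω t x) (D.volGrad Ω t x')
    have h2 := (hC t ht).1 x
    have h3 := (hC t ht).1 x'
    have h4 : L⁻¹ * ‖D.volGrad Ω t x - D.volGrad Ω t x'‖ ≤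
        ‖D.volGrad Ω t x - D.volGrad Ω t x'‖ :=
      mul_le_of_le_one_left (norm_nonneg _) (inv_le_one_of_one_le₀ hL)
    linarith
  · have ht0 := ht.1
    rw [inv_mul_le_iff₀ hL0]
    calc _ ≤ C * t⁻¹ * ‖x - x'‖ := (hC t ht).2 x x'
      _ ≤ C * t⁻¹ * (L * d) := by gcongr
      _ = L * (1 * C * t⁻¹ * d) := by ring
      _ ≤ _ := by gcongr; norm_num

theorem isC1OmegaOnBoundary_doubleLayer_one (hn : 2 ≤ n) (hΩo : IsOpen Ω)
    (hΩb : Bornology.IsBounded Ω) (hΩ : IsC11Domain Ω) {S w : E n → ℂ} (hw : ContDiff ℝ ∞ w)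
    (hS : ∀ x, x ≠ 0 → S x = D.par x + w x) :
    IsC1OmegaOnBoundary (omega 1) Ω (doubleLayer Ω a S (fun _ => 1)) := by
  -- All the smooth kernels of `doubleLayer_one_eq` are gathered in `h`; its potential has a
  -- gradient that is Lipschitz on bounded sets.
  set h : E n → ℂ := fun z => a.op w z - a.a0 * w z - D.K 1 z with hh
  have hP : ContDiff ℝ ∞ fun z => a.op w z - a.a0 * w z :=
    (a.contDiff_op hw).sub (contDiff_const.mul hw)
  have hhs : ContDiff ℝ ∞ h := hP.sub (D.contDiff_K 1)
  obtain ⟨R, hR⟩ := (isCompact_frontier hΩb).isBounded.subset_closedBall (0 : E n)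
  obtain ⟨Gh, hGhc, hGh, Ch, hCh0, hCh⟩ := exists_gradient_comp_sub hΩo hΩb hhs R
  obtain ⟨CZ, hCZ0, hCZ⟩ := D.exists_norm_time_volGrad_sub_le hΩo hΩb
  obtain ⟨C1, hC10, hC1⟩ := exists_norm_le_omega_one (R + R)
  refine isC1OmegaOnBoundary_of_gradient hΩo hΩb
    (U := fun x => 1 / 2 + ((∫ y in Ω, h (x - y)) +
      a.a0 * ∫ t in Ioc (0 : ℝ) 1, ∫ y in Ω, D.K t (x - y)))
    (G := fun x => Gh x + a.a0 • ∫ t in Ioc (0 : ℝ) 1, D.volGrad Ω t x)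
    (hGhc.add ((D.continuous_time_volGrad hΩo hΩb).const_smul a.a0))
    (fun x => ((hGh x).add ((D.hasFDerivAt_time_volume hΩo hΩb x).const_mul a.a0)).const_add _)
    (fun x hx => ?_) ⟨Ch * C1 + ‖a.a0‖ * CZ, by positivity, fun x hx x' hx' L d hL hd hxd => ?_⟩
  · rw [D.doubleLayer_one_eq hn hΩo hΩb hΩ hw hS hx, hh,
      integral_sub (integrableOn_comp_sub hΩb hP.continuous x)
        (integrableOn_comp_sub hΩb (D.contDiff_K 1).continuous x)]
    ring
  · have hs : ‖x - x'‖ ≤ R + R := (norm_sub_le _ _).trans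
      (add_le_add (mem_closedBall_zero_iff.mp (hR hx)) (mem_closedBall_zero_iff.mp (hR hx')))
    have h1 := (hCh x (hR hx) x' (hR hx')).trans
      (mul_le_mul_of_nonneg_left (hC1 _ L d hs hL hd hxd) hCh0)
    have h2 := mul_le_mul_of_nonneg_left (hCZ x x' L d hL hd hxd) (norm_nonneg a.a0)
    refine (norm_add_smul_sub_le a.a0 _ _ _ _).trans ((add_le_add h1 h2).trans_eq ?_)
    ring

end HeatData

/-! ### The one-dimensional case -/

/-- A cylinder meets the boundary in a single point, of finite surface measure, so every function is
locally integrable there; compactness of the boundary does the rest. -/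
theorem integrableOn_of_dim_one {Ω : Set (E 1)} (hΩo : IsOpen Ω)
    (hΩb : Bornology.IsBounded Ω) (hΩ : IsC11Domain Ω) (f : E 1 → ℂ) :
    IntegrableOn f (frontier Ω) (surfaceMeasure 1) := by
  refine LocallyIntegrableOn.integrableOn_isCompact (fun x hx => ?_) (isCompact_frontier hΩb)
  obtain ⟨c, hc⟩ := hΩ x hx
  refine ⟨frontier Ω ∩ c.cyl, inter_mem self_mem_nhdsWithin
    (mem_nhdsWithin_of_mem_nhds (c.isOpen_cyl.mem_nhds c.center_mem_cyl)), ?_⟩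
  have : Subsingleton (E (1 - 1)) := inferInstanceAs (Subsingleton (EuclideanSpace ℝ (Fin 0)))
  have hsub : frontier Ω ∩ c.cyl ⊆ {x} := by
    rw [c.frontier_inter_cyl hΩo hc]
    rintro _ ⟨η, -, rfl⟩
    rw [Subsingleton.elim η 0, c.param_zero]
    rfl
  have hx1 : surfaceMeasure 1 {x} < ⊤ :=
    (measure_mono (singleton_subset_iff.mpr hx)).trans_lt (surfaceMeasure_frontier_lt_top hΩo hΩb hΩ)
  exact (integrableOn_singleton (by finiteness) hx1).mono_set hsub

/-- The parameter space is a single point, so every function has a constant trace in each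
parametrization. -/
theorem isC1OmegaOnBoundary_of_dim_one (Ω : Set (E 1)) (f : E 1 → ℂ) :
    IsC1OmegaOnBoundary (omega 1) Ω f := by
  intro p _ c _
  have : Subsingleton (E (1 - 1)) := inferInstanceAs (Subsingleton (EuclideanSpace ℝ (Fin 0)))
  have hf : (fun η => f (c.param η)) = fun _ => f (c.param 0) := by
    funext η
    rw [Subsingleton.elim η 0]
  refine ⟨hf ▸ contDiffOn_const, 0, fun η _ η' _ => ?_⟩
  rw [Subsingleton.elim η η', sub_self, norm_zero, zero_mul]

end DoubleLayer

end

theorem lemma5p4 (n : ℕ) (hn : 1 ≤ n) (Ω : Set (DoubleLayer.E n)) (hΩo : IsOpen Ω)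
    (hΩb : Bornology.IsBounded Ω) (hΩ : DoubleLayer.IsC11Domain Ω)
    (a : DoubleLayer.Coeffs n) (ha : a.IsElliptic) (har : a.HasRealPrincipalPart)
    (S : DoubleLayer.E n → ℂ) (hS : DoubleLayer.IsFundamentalSolution a S) :
    (∀ x ∈ frontier Ω, MeasureTheory.IntegrableOn (DoubleLayer.kernel Ω a S x)
      (frontier Ω \ {x}) (DoubleLayer.surfaceMeasure n)) ∧
    DoubleLayer.IsC1OmegaOnBoundary (DoubleLayer.omega 1) Ω
      (DoubleLayer.doubleLayer Ω a S (fun _ => 1)) := by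
  -- The case `n = 1` is separated because the Fubini argument needs boundary points to be null
  -- sets, which holds only for `n ≥ 2`.
  rcases hn.eq_or_lt with rfl | hn2
  · exact ⟨fun x _ => (DoubleLayer.integrableOn_of_dim_one hΩo hΩb hΩ _).mono_set Set.sdiff_subset,
      DoubleLayer.isC1OmegaOnBoundary_of_dim_one Ω _⟩
  · obtain ⟨D⟩ := DoubleLayer.exists_heatData a ha har
    obtain ⟨w, hw, hSw⟩ := D.exists_contDiff_eq_par_add hn hS
    exact ⟨fun x hx => (D.integrableOn_kernel hn2 hΩo hΩb hΩ hw hSw hx).mono_set Set.sdiff_subset,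
      D.isC1OmegaOnBoundary_doubleLayer_one hn2 hΩo hΩb hΩ hw hSw⟩
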